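/- Let $k$ be a field, let $A$ and $B$ be finite-dimensional $k$-algebras, let $M={}_AM_B$ and $N={}_BN_A$ be finite-dimensional bimodules, and let $l\ge 0$ be an integer. Notation. Write $A^e=A\otimes_k A^{\mathrm{op}}$ and $B^e=B\otimes_kB^{\mathrm{op}}$, and identify bimodules with left modules over these algebras. For a finite-dimensional algebra $R$ let $D_{\mathrm{sg}}(R)=D^b(R\text{-mod})/K^b(R\text{-proj})$ be the singularity category (finitely generated modules, Verdier quotient). Set $\mathrm{HH}^n_{\mathrm{sg}}(A,A)=\mathrm{Hom}_{D_{\mathrm{sg}}(A^e)}(A,A[n])$ for $n\in\mathbb Z$; composition in $D_{\mathrm{sg}}(A^e)$, $f\cdot g=f[n]\circ g$ for $g$ of degree $n$, makes $\mathrm{HH}^*_{\mathrm{sg}}(A,A)=\bigoplus_{n}\mathrm{HH}^n_{\mathrm{sg}}(A,A)$ a graded ring. Let $\Omega^0(A)=A$ and, for $r\ge 1$, let $\Omega^r(A)$ be the image of the bar differential $A^{\otimes (r+2)}\to A^{\otimes (r+1)}$, $a_0\otimes\cdots\otimes a_{r+1}\mapsto\sum_{i=0}^r(-1)^i a_0\otimes\cdots\otimes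 a_ia_{i+1}\otimes\cdots\otimes a_{r+1}$. Assume that $(M,N)$ defines a singular equivalence of Morita type with level $l$: $M$ is projective as a left $A$-module and as a right $B$-module, $N$ is projective as a left $B$-module and as a right $A$-module, $M\otimes_BN\cong\Omega^l(A)$ in the stable category of finitely generated $A$-$A$-bimodules (bimodule maps modulo those that factor through a projective bimodule), and $N\otimes_AM\cong\Omega^l(B)$ in the stable category of finitely generated $B$-$B$-bimodules. Then $F=M\otimes_B-\otimes_BN$ and $G=N\otimes_A-\otimes_AM$ are exact and preserve projective bimodules, hence induce functors $F\colon D_{\mathrm{sg}}(B^e)\to D_{\mathrm{sg}}(A^e)$ and $G\colon D_{\mathrm{sg}}(A^e)\to D_{\mathrm{sg}}(B^e)$ that commute with shifts. Claim. 1. The graded rings $\mathrm{HH}^*_{\mathrm{sg}}(A,A)$ and $\mathrm{HH}^*_{\mathrm{sg}}(B,B)$ are graded commutative: $f\cdot g=(-1)^{mn}g\cdot f$ for $f$ of degree $m$ and $g$ of degree $n$. 2. There are isomorphisms $\alpha\colon F(B)[l]\cong A$ in $D_{\mathrm{sg}}(A^e)$ and $\beta\colon G(A)[l]\cong B$ in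 $D_{\mathrm{sg}}(B^e)$. 3. For all such $\alpha$ and $\beta$, the maps $$\mathrm{Hom}(B,B[n])\to\mathrm{Hom}(A,A[n]),\quad f\mapsto \alpha[n]\circ F(f)[l]\circ\alpha^{-1},$$ $$\mathrm{Hom}(A,A[n])\to\mathrm{Hom}(B,B[n]),\quad g\mapsto \beta[n]\circ G(g)[l]\circ\beta^{-1}$$ (for $n\in\mathbb Z$, with the canonical identifications $F(B[n])[l]\cong F(B)[l][n]$ and $G(A[n])[l]\cong G(A)[l][n]$, the latter exchange of shifts being the one given by $[n][l]=[n+l]=[l][n]$) are the components of mutually inverse isomorphisms of graded rings $$\mathrm{HH}^*_{\mathrm{sg}}(B,B)\to \mathrm{HH}^*_{\mathrm{sg}}(A,A),\qquad \mathrm{HH}^*_{\mathrm{sg}}(A,A)\to \mathrm{HH}^*_{\mathrm{sg}}(B,B).$$ -/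

import Mathlib

open scoped TensorProduct

universe v u

noncomputable section

open CategoryTheory CategoryTheory.Limits CategoryTheory.Pretriangulated

section SingularityCategory

variable (C : Type u) [Category.{v} C] [Abelian C]

instance instHasDerivedCategoryStd : HasDerivedCategory.{max u v} C :=
  HasDerivedCategory.standard C

/-- The bounded derived category `D^b(C)`. -/
abbrev BoundedDerived : Type (max u v) :=
  (DerivedCategory.TStructure.t (C := C)).bounded.FullSubcategory

variable {C} in
/-- Bounded cochain complexes of projective objects. -/
structure IsBoundedProjective (K : CochainComplex C ℤ) : Prop where
  bounded : ∃ a b : ℤ, K.IsStrictlyGE a ∧ K.IsStrictlyLE b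
  projective : ∀ n : ℤ, Projective (K.X n)

/-- The essential image of `K^b(Proj C)` in `D(C)`. -/
def IsPerfect : ObjectProperty (DerivedCategory C) :=
  fun X => ∃ K : CochainComplex C ℤ, IsBoundedProjective K ∧
    Nonempty (X ≅ DerivedCategory.Q.obj K)

variable {C} in
lemma IsBoundedProjective.isKProjective {K : CochainComplex C ℤ} (h : IsBoundedProjective K) :
    K.IsKProjective := by
  obtain ⟨a, b, ha, hb⟩ := h.bounded
  have := h.projective
  exact CochainComplex.isKProjective_of_projective K b

instance : (IsPerfect C).IsClosedUnderIsomorphisms where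
  of_iso := by
    rintro X Y e ⟨K, hK, ⟨i⟩⟩
    exact ⟨K, hK, ⟨e.symm ≪≫ i⟩⟩

instance : (IsPerfect C).IsStableUnderShift ℤ where
  isStableUnderShiftBy n := ⟨by
    rintro X ⟨K, hK, ⟨e⟩⟩
    obtain ⟨a, b, ha, hb⟩ := hK.bounded
    refine ⟨K⟦n⟧, ⟨⟨a - n, b - n, K.isStrictlyGE_shift a n _ (by lia),
      K.isStrictlyLE_shift b n _ (by lia)⟩, fun i => hK.projective _⟩,
      ⟨(shiftFunctor _ n).mapIso e ≪≫ (DerivedCategory.Q.commShiftIso n).symm.app K⟩⟩⟩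

instance : (IsPerfect C).ContainsZero where
  exists_zero := by
    obtain ⟨Z, hz⟩ := HasZeroObject.zero (C := CochainComplex C ℤ)
    refine ⟨DerivedCategory.Q.obj Z, ?_, _, ⟨⟨0, 0, ?_, ?_⟩, ?_⟩, ⟨Iso.refl _⟩⟩
    · exact Functor.map_isZero _ hz
    · rw [CochainComplex.isStrictlyGE_iff]
      intro i _
      exact (HomologicalComplex.eval C _ i).map_isZero hz
    · rw [CochainComplex.isStrictlyLE_iff]
      intro i _
      exact (HomologicalComplex.eval C _ i).map_isZero hz
    · intro n
      exact ((HomologicalComplex.eval C _ n).map_isZero hz).projective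

instance : (IsPerfect C).IsTriangulatedClosed₃ := .mk' (by
  rintro T hT ⟨K, hK, ⟨e⟩⟩ ⟨L, hL, ⟨e'⟩⟩
  have := hK.isKProjective
  obtain ⟨φ, hφ⟩ : ∃ φ : K ⟶ L, DerivedCategory.Q.map φ = e.inv ≫ T.mor₁ ≫ e'.hom := by
    obtain ⟨g, hg⟩ := (CochainComplex.IsKProjective.Qh_map_bijective K
      ((HomotopyCategory.quotient _ _).obj L)).surjective
      ((DerivedCategory.quotientCompQhIso C).hom.app K ≫ (e.inv ≫ T.mor₁ ≫ e'.hom) ≫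
        (DerivedCategory.quotientCompQhIso C).inv.app L)
    obtain ⟨φ, rfl⟩ := (HomotopyCategory.quotient _ _).map_surjective g
    refine ⟨φ, ?_⟩
    rw [← cancel_epi ((DerivedCategory.quotientCompQhIso C).hom.app K),
      ← DerivedCategory.quotientCompQhIso_hom_naturality, hg]
    simp
  obtain ⟨ei, -⟩ := exists_iso_of_arrow_iso _ _ hT
    (DerivedCategory.mappingCone_triangle_distinguished φ)
    (Arrow.isoMk e e' (by
      change e.hom ≫ DerivedCategory.Q.map φ = T.mor₁ ≫ e'.hom
      simp [hφ]))
  obtain ⟨a, b, ha, hb⟩ := hK.bounded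
  obtain ⟨c, d, hc, hd⟩ := hL.bounded
  refine ⟨CochainComplex.mappingCone φ, ⟨⟨min (a - 1) c, max (b - 1) d, ?_, ?_⟩, fun n => ?_⟩,
    ⟨Triangle.π₃.mapIso ei⟩⟩
  · rw [CochainComplex.isStrictlyGE_iff]
    intro i hi
    refine IsZero.of_iso ?_ (HomologicalComplex.homotopyCofiber.XIsoBiprod φ i (i + 1) rfl)
    rw [biprod_isZero_iff]
    exact ⟨K.isZero_of_isStrictlyGE a _ (by lia), L.isZero_of_isStrictlyGE c _ (by lia)⟩
  · rw [CochainComplex.isStrictlyLE_iff]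
    intro i hi
    refine IsZero.of_iso ?_ (HomologicalComplex.homotopyCofiber.XIsoBiprod φ i (i + 1) rfl)
    rw [biprod_isZero_iff]
    exact ⟨K.isZero_of_isStrictlyLE b _ (by lia), L.isZero_of_isStrictlyLE d _ (by lia)⟩
  · have := hK.projective (n + 1)
    have := hL.projective n
    exact Projective.of_iso
      (HomologicalComplex.homotopyCofiber.XIsoBiprod φ n (n + 1) rfl).symm inferInstance)

instance : (IsPerfect C).IsTriangulated where
  toIsTriangulatedClosed₂ := .of_isTriangulatedClosed₃

/-- Perfect objects of `D^b(C)`. -/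
abbrev IsPerfectB : ObjectProperty (BoundedDerived C) :=
  (IsPerfect C).inverseImage (DerivedCategory.TStructure.t (C := C)).bounded.ι

/-- The singularity category `D^b(C) / K^b(Proj C)` (Verdier quotient). -/
abbrev Dsg : Type (max u v) := (IsPerfectB C).trW.Localization

variable {C}

/-- The image in `D_sg(C)` of an object `X` of `C`, viewed as a complex in degree `0`. -/
def toDsg : C ⥤ Dsg C :=
  ObjectProperty.lift _ (DerivedCategory.singleFunctor C 0) (fun X =>
    ⟨⟨0, (CochainComplex.singleFunctor C 0).obj X, Iso.refl _, inferInstance⟩,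
      ⟨0, (CochainComplex.singleFunctor C 0).obj X, Iso.refl _, inferInstance⟩⟩) ⋙
    (IsPerfectB C).trW.Q

section Functoriality

universe v' u'

variable {E : Type u'} [Category.{v'} E] [Abelian E]
variable (F : C ⥤ E) [F.Additive] [PreservesFiniteLimits F] [PreservesFiniteColimits F]

lemma mapDerivedCategory_bounded (X : BoundedDerived C) :
    (DerivedCategory.TStructure.t (C := E)).bounded (F.mapDerivedCategory.obj X.obj) := by
  obtain ⟨X, ⟨⟨a, K, e, hK⟩, ⟨b, L, e', hL⟩⟩⟩ := X
  refine ⟨⟨a, _, F.mapDerivedCategory.mapIso e ≪≫ F.mapDerivedCategoryFactors.app K, ?_⟩,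
    ⟨b, _, F.mapDerivedCategory.mapIso e' ≪≫ F.mapDerivedCategoryFactors.app L, ?_⟩⟩
  · rw [CochainComplex.isStrictlyGE_iff]
    intro i hi
    exact F.map_isZero (K.isZero_of_isStrictlyGE a _ (by lia))
  · rw [CochainComplex.isStrictlyLE_iff]
    intro i hi
    exact F.map_isZero (L.isZero_of_isStrictlyLE b _ (by lia))

/-- The functor on bounded derived categories induced by an exact functor. -/
def mapBoundedDerived : BoundedDerived C ⥤ BoundedDerived E :=
  ObjectProperty.lift _ ((DerivedCategory.TStructure.t (C := C)).bounded.ι ⋙ F.mapDerivedCategory)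
    (mapDerivedCategory_bounded F)

instance : (mapBoundedDerived F).CommShift ℤ := by
  unfold mapBoundedDerived; infer_instance

instance : (mapBoundedDerived F).IsTriangulated := by
  unfold mapBoundedDerived; infer_instance

lemma isPerfectB_mapBoundedDerived [F.PreservesProjectiveObjects] (X : BoundedDerived C)
    (hX : IsPerfectB C X) : IsPerfectB E ((mapBoundedDerived F).obj X) := by
  obtain ⟨K, hK, ⟨e⟩⟩ := hX
  refine ⟨_, ⟨?_, fun n => ?_⟩, ⟨F.mapDerivedCategory.mapIso e ≪≫ F.mapDerivedCategoryFactors.app K⟩⟩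
  · obtain ⟨a, b, ha, hb⟩ := hK.bounded
    refine ⟨a, b, ?_, ?_⟩
    · rw [CochainComplex.isStrictlyGE_iff]
      intro i hi
      exact F.map_isZero (K.isZero_of_isStrictlyGE a _ (by lia))
    · rw [CochainComplex.isStrictlyLE_iff]
      intro i hi
      exact F.map_isZero (K.isZero_of_isStrictlyLE b _ (by lia))
  · have := hK.projective n
    exact Functor.PreservesProjectiveObjects.projective_obj this

/-- `mapBoundedDerived F` as a morphism of localizers. -/
def sgLocalizerMorphism [F.PreservesProjectiveObjects] :
    LocalizerMorphism (IsPerfectB C).trW (IsPerfectB E).trW where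
  functor := mapBoundedDerived F
  map := by
    intro X Y f hf
    obtain ⟨Z, g, h, hT, hZ⟩ := hf
    exact ⟨_, _, _, (mapBoundedDerived F).map_distinguished _ hT,
      isPerfectB_mapBoundedDerived F Z hZ⟩

instance [F.PreservesProjectiveObjects] : (sgLocalizerMorphism F).functor.CommShift ℤ :=
  inferInstanceAs ((mapBoundedDerived F).CommShift ℤ)

/-- The functor `D_sg(C) ⥤ D_sg(E)` induced by an exact functor that preserves projectives. -/
def mapDsg [F.PreservesProjectiveObjects] : Dsg C ⥤ Dsg E :=
  (sgLocalizerMorphism F).localizedFunctor (IsPerfectB C).trW.Q (IsPerfectB E).trW.Q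

instance [F.PreservesProjectiveObjects] : (mapDsg F).CommShift ℤ :=
  inferInstanceAs (((sgLocalizerMorphism F).localizedFunctor
    (IsPerfectB C).trW.Q (IsPerfectB E).trW.Q).CommShift ℤ)

end Functoriality
end SingularityCategory

section GradedEnd

open DirectSum

variable {D : Type u} [Category.{v} D] [HasShift D ℤ]

/-- The degree `n` part `Hom(X, X⟦n⟧)` of the graded endomorphism ring. -/
def GrEndPart (X : D) (n : ℤ) : Type v := ShiftedHom X X n

/-- The unit is the identity of `X`, in degree `0`. -/
instance (X : D) : GradedMonoid.GOne (GrEndPart X) where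
  one := ShiftedHom.mk₀ (0 : ℤ) rfl (𝟙 X)

/-- The product is composition: `f * g = f⟦j⟧ ∘ g` for `g` of degree `j`. -/
instance (X : D) : GradedMonoid.GMul (GrEndPart X) where
  mul f g := ShiftedHom.comp (X := X) (Y := X) (Z := X) g f rfl

lemma GrEndPart.mk_comp_eq {X : D} {a b c c' : ℤ} (f : ShiftedHom X X a) (g : ShiftedHom X X b)
    (h : b + a = c) (h' : b + a = c') :
    (⟨c, f.comp g h⟩ : GradedMonoid (GrEndPart X)) = ⟨c', f.comp g h'⟩ := by
  subst h
  subst h'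
  rfl

instance (X : D) : GradedMonoid.GMonoid (GrEndPart X) where
  one_mul := by
    rintro ⟨n, (f : ShiftedHom X X n)⟩
    exact (GrEndPart.mk_comp_eq f (ShiftedHom.mk₀ (0 : ℤ) rfl (𝟙 X)) _ (zero_add n)).trans
      (congrArg (fun x => (⟨_, x⟩ : GradedMonoid (GrEndPart X))) (f.comp_mk₀_id _ _))
  mul_one := by
    rintro ⟨n, (f : ShiftedHom X X n)⟩
    exact (GrEndPart.mk_comp_eq (ShiftedHom.mk₀ (0 : ℤ) rfl (𝟙 X)) f _ (add_zero n)).trans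
      (congrArg (fun x => (⟨_, x⟩ : GradedMonoid (GrEndPart X))) (ShiftedHom.mk₀_id_comp _ _ f))
  mul_assoc := by
    rintro ⟨a, (f : ShiftedHom X X a)⟩ ⟨b, (g : ShiftedHom X X b)⟩ ⟨c, (h : ShiftedHom X X c)⟩
    exact (congrArg (fun x => (⟨_, x⟩ : GradedMonoid (GrEndPart X)))
      (ShiftedHom.comp_assoc h g f rfl rfl rfl).symm).trans
        (GrEndPart.mk_comp_eq (ShiftedHom.comp h g rfl) f (add_assoc a b c).symm rfl)

variable [Preadditive D]

instance (X : D) (n : ℤ) : AddCommGroup (GrEndPart X n) :=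
  inferInstanceAs (AddCommGroup (X ⟶ X⟦n⟧))

variable [∀ n : ℤ, (shiftFunctor D n).Additive]

instance (X : D) : DirectSum.GRing (GrEndPart X) where
  mul_zero _ := ShiftedHom.zero_comp _ _ _ _
  zero_mul _ := ShiftedHom.comp_zero _ _ rfl
  mul_add _ _ _ := ShiftedHom.add_comp _ _ _ _
  add_mul _ _ _ := ShiftedHom.comp_add _ _ _ _
  natCast n := n • (GradedMonoid.GOne.one : GrEndPart X 0)
  natCast_zero := zero_smul _ _
  natCast_succ _ := succ_nsmul _ _
  intCast n := n • (GradedMonoid.GOne.one : GrEndPart X 0)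
  intCast_ofNat _ := natCast_zsmul _ _
  intCast_negSucc_ofNat _ := negSucc_zsmul _ _

/-- The graded ring `⨁ₙ Hom(X, X⟦n⟧)`. -/
abbrev GrEnd (X : D) : Type v := ⨁ n : ℤ, GrEndPart X n

/-- `f * g = (-1)^(m n) g * f` for `f` of degree `m` and `g` of degree `n`. -/
def GrEnd.IsGradedCommutative (X : D) : Prop :=
  ∀ (m n : ℤ) (f : GrEndPart X m) (g : GrEndPart X n),
    (of (GrEndPart X) m f * of (GrEndPart X) n g : GrEnd X) =
      (m * n).negOnePow • (of (GrEndPart X) n g * of (GrEndPart X) m f : GrEnd X)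

end GradedEnd

section Bimodules

open scoped TensorProduct ModuleCat.Algebra
open MulOpposite

variable {k : Type u} [Field k]
variable {A B D E F : Type u} [Ring A] [Algebra k A] [Ring B] [Algebra k B] [Ring D] [Algebra k D]
  [Ring E] [Algebra k E] [Ring F] [Algebra k F]

/-- The action of `A ⊗ D` on `M ⊗_k X`, where `A` acts on `M` and `D` acts on `X`. -/
def kTensorAct (M : ModuleCat.{u} (A ⊗[k] E)) (X : ModuleCat.{u} (F ⊗[k] D)) :
    A ⊗[k] D →ₐ[k] Module.End k (M ⊗[k] X) :=
  (Module.endTensorEndAlgHom (R := k) (S := k) (A := k) (M := M) (N := X)).comp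
    (Algebra.TensorProduct.map
      ((Algebra.lsmul k k M).comp (Algebra.TensorProduct.includeLeft : A →ₐ[k] A ⊗[k] E))
      ((Algebra.lsmul k k X).comp (Algebra.TensorProduct.includeRight : D →ₐ[k] F ⊗[k] D)))

/-- `M ⊗_k X`, with `A ⊗ D` acting through `A` on `M` and through `D` on `X`. -/
def KTensor (M : ModuleCat.{u} (A ⊗[k] E)) (X : ModuleCat.{u} (F ⊗[k] D)) : Type u := M ⊗[k] X

namespace KTensor

section
variable (M : ModuleCat.{u} (A ⊗[k] E)) (X : ModuleCat.{u} (F ⊗[k] D))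

instance : AddCommGroup (KTensor M X) := inferInstanceAs (AddCommGroup (M ⊗[k] X))

instance : Module k (KTensor M X) := inferInstanceAs (Module k (M ⊗[k] X))

instance : Module (A ⊗[k] D) (KTensor M X) :=
  Module.compHom (M ⊗[k] X) (kTensorAct M X).toRingHom

end

variable {M : ModuleCat.{u} (A ⊗[k] E)} {X : ModuleCat.{u} (F ⊗[k] D)}

def tmul (m : M) (x : X) : KTensor M X := m ⊗ₜ[k] x

lemma smul_def (r : A ⊗[k] D) (z : KTensor M X) : r • z = kTensorAct M X r z := rfl

lemma smul_tmul (a : A) (d : D) (m : M) (x : X) :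
    (a ⊗ₜ[k] d) • (tmul m x : KTensor M X) =
      tmul ((a ⊗ₜ[k] (1 : E)) • m) (((1 : F) ⊗ₜ[k] d) • x) := rfl

instance : IsScalarTower k (A ⊗[k] D) (KTensor M X) where
  smul_assoc c r z := by
    rw [smul_def, smul_def, map_smul]
    rfl

lemma add_tmul (m m' : M) (x : X) : (tmul (m + m') x : KTensor M X) = tmul m x + tmul m' x :=
  TensorProduct.add_tmul _ _ _

lemma tmul_add (m : M) (x x' : X) : (tmul m (x + x') : KTensor M X) = tmul m x + tmul m x' :=
  TensorProduct.tmul_add _ _ _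

lemma smul_tmul' (c : k) (m : M) (x : X) :
    (tmul (c • m) x : KTensor M X) = tmul m (c • x) := TensorProduct.smul_tmul _ _ _

@[elab_as_elim]
lemma induction_on {p : KTensor M X → Prop} (z : KTensor M X) (zero : p 0)
    (tmul : ∀ m x, p (tmul m x)) (add : ∀ z w, p z → p w → p (z + w)) : p z :=
  TensorProduct.induction_on z zero tmul add

/-- The universal property of `M ⊗_k X` for additive maps. -/
def liftAdd {Y : Type u} [AddCommGroup Y] (f : M →+ X →+ Y)
    (hf : ∀ (c : k) m x, f (c • m) x = f m (c • x)) : KTensor M X →+ Y :=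
  (TensorProduct.liftAddHom f hf : M ⊗[k] X →+ Y)

@[simp]
lemma liftAdd_tmul {Y : Type u} [AddCommGroup Y] (f : M →+ X →+ Y) (hf) (m : M) (x : X) :
    (liftAdd f hf : KTensor M X →+ Y) (tmul m x) = f m x := rfl

/-- Equivariant bilinear maps give linear maps on `M ⊗_k X`. -/
def lift {Y : Type u} [AddCommGroup Y] [Module (A ⊗[k] D) Y] (f : M →+ X →+ Y)
    (hf : ∀ (c : k) m x, f (c • m) x = f m (c • x))
    (h : ∀ (a : A) (d : D) (m : M) (x : X),
      f ((a ⊗ₜ[k] (1 : E)) • m) (((1 : F) ⊗ₜ[k] d) • x) = (a ⊗ₜ[k] d) • f m x) :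
    KTensor M X →ₗ[A ⊗[k] D] Y :=
  { (liftAdd f hf : KTensor M X →+ Y) with
    map_smul' := by
      intro r z
      change liftAdd f hf (r • z) = r • liftAdd f hf z
      induction r using TensorProduct.induction_on with
      | zero => simp
      | add r s hr hs => rw [add_smul, map_add, hr, hs, add_smul]
      | tmul a d =>
        induction z using induction_on with
        | zero => simp
        | add z w hz hw => rw [smul_add, map_add, hz, hw, map_add, smul_add]
        | tmul m x => rw [smul_tmul, liftAdd_tmul, liftAdd_tmul, h] }

@[simp]
lemma lift_tmul {Y : Type u} [AddCommGroup Y] [Module (A ⊗[k] D) Y] (f : M →+ X →+ Y)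
    (hf) (h) (m : M) (x : X) : (lift f hf h : KTensor M X →ₗ[A ⊗[k] D] Y) (tmul m x) = f m x := rfl

end KTensor

instance [Module.Finite k A] [Module.Finite k D] : IsNoetherianRing (A ⊗[k] D) :=
  isNoetherian_of_tower k (isNoetherian_of_isNoetherianRing_of_finite k (A ⊗[k] D))

lemma FGModuleCat.finite_base [Module.Finite k A] [Module.Finite k D]
    (M : FGModuleCat.{u} (A ⊗[k] D)) : Module.Finite k M.obj :=
  have := M.property
  Module.Finite.trans (A ⊗[k] D) M.obj

instance [Module.Finite k A] [Module.Finite k D] [Module.Finite k E] [Module.Finite k F]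
    (M : FGModuleCat.{u} (A ⊗[k] E)) (X : FGModuleCat.{u} (F ⊗[k] D)) :
    Module.Finite (A ⊗[k] D) (KTensor M.obj X.obj) := by
  have := M.finite_base
  have := X.finite_base
  have : Module.Finite k (KTensor M.obj X.obj) :=
    inferInstanceAs (Module.Finite k (M.obj ⊗[k] X.obj))
  exact Module.Finite.of_restrictScalars_finite k _ _

/-- The submodule of `M ⊗_k X` generated by the elements `m b ⊗ x - m ⊗ b x`. -/
def balancingSubmodule (M : ModuleCat.{u} (A ⊗[k] Bᵐᵒᵖ)) (X : ModuleCat.{u} (B ⊗[k] D)) :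
    Submodule (A ⊗[k] D) (KTensor M X) :=
  Submodule.span _ {z | ∃ (m : M) (b : B) (x : X),
    z = KTensor.tmul (((1 : A) ⊗ₜ[k] op b) • m) x - KTensor.tmul m ((b ⊗ₜ[k] (1 : D)) • x)}

/-- `M ⊗_B X` -/
abbrev BTensor (M : ModuleCat.{u} (A ⊗[k] Bᵐᵒᵖ)) (X : ModuleCat.{u} (B ⊗[k] D)) : Type u :=
  KTensor M X ⧸ balancingSubmodule M X

namespace BTensor

variable {M M' : ModuleCat.{u} (A ⊗[k] Bᵐᵒᵖ)} {X X' : ModuleCat.{u} (B ⊗[k] D)}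

def tmul (m : M) (x : X) : BTensor M X := (balancingSubmodule M X).mkQ (KTensor.tmul m x)

lemma add_tmul (m m' : M) (x : X) : (tmul (m + m') x : BTensor M X) = tmul m x + tmul m' x := by
  rw [tmul, KTensor.add_tmul, map_add]; rfl

lemma tmul_add (m : M) (x x' : X) : (tmul m (x + x') : BTensor M X) = tmul m x + tmul m x' := by
  rw [tmul, KTensor.tmul_add, map_add]; rfl

lemma smul_tmul (a : A) (d : D) (m : M) (x : X) :
    (a ⊗ₜ[k] d) • (tmul m x : BTensor M X) =
      tmul ((a ⊗ₜ[k] (1 : Bᵐᵒᵖ)) • m) (((1 : B) ⊗ₜ[k] d) • x) := by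
  rw [tmul, ← map_smul, KTensor.smul_tmul]; rfl

lemma balanced (b : B) (m : M) (x : X) :
    (tmul (((1 : A) ⊗ₜ[k] op b) • m) x : BTensor M X) = tmul m ((b ⊗ₜ[k] (1 : D)) • x) := by
  rw [tmul, tmul, ← sub_eq_zero, ← map_sub, Submodule.mkQ_apply, Submodule.Quotient.mk_eq_zero]
  exact Submodule.subset_span ⟨m, b, x, rfl⟩

@[elab_as_elim]
lemma induction_on {p : BTensor M X → Prop} (z : BTensor M X) (zero : p 0)
    (tmul : ∀ m x, p (tmul m x)) (add : ∀ z w, p z → p w → p (z + w)) : p z := by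
  obtain ⟨z, rfl⟩ := Submodule.mkQ_surjective _ z
  induction z using KTensor.induction_on with
  | zero => simpa using zero
  | tmul m x => exact tmul m x
  | add z w hz hw => rw [map_add]; exact add _ _ hz hw

/-- `m ⊗ x` as a biadditive map. -/
def tmulHom : M →+ X →+ BTensor M X :=
  AddMonoidHom.mk' (fun m => AddMonoidHom.mk' (fun x => tmul m x) (tmul_add m))
    (fun m m' => by ext x; exact add_tmul m m' x)

@[simp] lemma tmulHom_apply (m : M) (x : X) : tmulHom m x = (tmul m x : BTensor M X) := rfl

lemma algebraMap_smul_left (c : k) (m : M) : c • m = ((1 : A) ⊗ₜ[k] op (algebraMap k B c)) • m := by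
  have : algebraMap k (A ⊗[k] Bᵐᵒᵖ) c = (1 : A) ⊗ₜ[k] op (algebraMap k B c) := by
    rw [Algebra.TensorProduct.algebraMap_apply, Algebra.algebraMap_eq_smul_one,
      TensorProduct.smul_tmul, ← Algebra.algebraMap_eq_smul_one]
    rfl
  rw [← this]; rfl

lemma algebraMap_smul_right (c : k) (x : X) : c • x = ((algebraMap k B c) ⊗ₜ[k] (1 : D)) • x := rfl

/-- The universal property of `M ⊗_B X`: balanced biadditive maps give additive maps. -/
def liftAdd {P : Type u} [AddCommGroup P] (f : M →+ X →+ P)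
    (hf : ∀ (b : B) (m : M) (x : X),
      f (((1 : A) ⊗ₜ[k] op b) • m) x = f m ((b ⊗ₜ[k] (1 : D)) • x)) :
    BTensor M X →+ P :=
  QuotientAddGroup.lift (balancingSubmodule M X).toAddSubgroup
    (KTensor.liftAdd f (fun c m x => by
      rw [algebraMap_smul_left, algebraMap_smul_right, hf])) (by
    intro z hz
    set φ : KTensor M X →+ P := KTensor.liftAdd f _ with hφ
    have key : ∀ r : A ⊗[k] D, φ (r • z) = 0 := by
      refine Submodule.span_induction (p := fun z _ => ∀ r : A ⊗[k] D, φ (r • z) = 0)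
        ?_ ?_ ?_ ?_ hz
      · rintro _ ⟨m, b, x, rfl⟩ r
        induction r using TensorProduct.induction_on with
        | zero => simp
        | add r s hr hs => rw [add_smul, map_add, hr, hs, add_zero]
        | tmul a d =>
          rw [smul_sub, KTensor.smul_tmul, KTensor.smul_tmul, map_sub, sub_eq_zero]
          change f _ _ = f _ _
          rw [smul_smul, smul_smul, Algebra.TensorProduct.tmul_mul_tmul,
            Algebra.TensorProduct.tmul_mul_tmul, mul_one, mul_one, one_mul, one_mul]
          have h1 : (a ⊗ₜ[k] op b) • m = ((1 : A) ⊗ₜ[k] op b) • ((a ⊗ₜ[k] (1 : Bᵐᵒᵖ)) • m) := by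
            rw [smul_smul, Algebra.TensorProduct.tmul_mul_tmul, mul_one, one_mul]
          have h2 : (b ⊗ₜ[k] d) • x = (b ⊗ₜ[k] (1 : D)) • (((1 : B) ⊗ₜ[k] d) • x) := by
            rw [smul_smul, Algebra.TensorProduct.tmul_mul_tmul, mul_one, one_mul]
          rw [h1, h2, hf]
      · intro r; simp
      · intro z w _ _ hz hw r
        rw [smul_add, map_add, hz, hw, add_zero]
      · intro s z _ hz r
        rw [smul_smul]
        exact hz _
    simpa using key 1)

@[simp]
lemma liftAdd_tmul {P : Type u} [AddCommGroup P] (f : M →+ X →+ P) (hf) (m : M) (x : X) :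
    liftAdd f hf (tmul m x) = f m x := rfl

/-- Balanced equivariant maps give linear maps on `M ⊗_B X`. -/
def lift {P : Type u} [AddCommGroup P] [Module (A ⊗[k] D) P] (f : M →+ X →+ P)
    (hf : ∀ (b : B) (m : M) (x : X),
      f (((1 : A) ⊗ₜ[k] op b) • m) x = f m ((b ⊗ₜ[k] (1 : D)) • x))
    (h : ∀ (a : A) (d : D) (m : M) (x : X),
      f ((a ⊗ₜ[k] (1 : Bᵐᵒᵖ)) • m) (((1 : B) ⊗ₜ[k] d) • x) = (a ⊗ₜ[k] d) • f m x) :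
    BTensor M X →ₗ[A ⊗[k] D] P :=
  { liftAdd f hf with
    map_smul' := by
      intro r z
      change liftAdd f hf (r • z) = r • liftAdd f hf z
      induction r using TensorProduct.induction_on with
      | zero => simp
      | add r s hr hs => rw [add_smul, map_add, hr, hs, add_smul]
      | tmul a d =>
        induction z using induction_on with
        | zero => simp
        | add z w hz hw => rw [smul_add, map_add, hz, hw, map_add, smul_add]
        | tmul m x => rw [smul_tmul, liftAdd_tmul, liftAdd_tmul, h] }

@[simp]
lemma lift_tmul {P : Type u} [AddCommGroup P] [Module (A ⊗[k] D) P] (f : M →+ X →+ P) (hf) (h)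
    (m : M) (x : X) : lift f hf h (tmul m x) = f m x := rfl

/-- `f ⊗_B g` -/
def map (f : M →ₗ[A ⊗[k] Bᵐᵒᵖ] M') (g : X →ₗ[B ⊗[k] D] X') :
    BTensor M X →ₗ[A ⊗[k] D] BTensor M' X' :=
  lift ((AddMonoidHom.compl₂ tmulHom g.toAddMonoidHom).comp f.toAddMonoidHom)
    (fun b m x => by
      change tmul (f _) (g _) = tmul (f _) (g _)
      rw [map_smul, map_smul, balanced])
    (fun a d m x => by
      change tmul (f _) (g _) = _ • tmul (f _) (g _)
      rw [map_smul, map_smul, smul_tmul])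

@[simp]
lemma map_tmul (f : M →ₗ[A ⊗[k] Bᵐᵒᵖ] M') (g : X →ₗ[B ⊗[k] D] X') (m : M) (x : X) :
    map f g (tmul m x) = tmul (f m) (g x) := rfl

lemma hom_ext {P : Type u} [AddCommGroup P] {f g : BTensor M X →+ P}
    (h : ∀ m x, f (tmul m x) = g (tmul m x)) : f = g := by
  ext z
  induction z using induction_on with
  | zero => simp
  | tmul m x => exact h m x
  | add z w hz hw => rw [map_add, map_add, hz, hw]

lemma linearMap_ext {P : Type u} [AddCommGroup P] [Module (A ⊗[k] D) P]
    {f g : BTensor M X →ₗ[A ⊗[k] D] P} (h : ∀ m x, f (tmul m x) = g (tmul m x)) : f = g :=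
  LinearMap.toAddMonoidHom_injective (hom_ext h)

end BTensor

instance [Module.Finite k A] [Module.Finite k D] [Module.Finite k B]
    (M : FGModuleCat.{u} (A ⊗[k] Bᵐᵒᵖ)) (X : FGModuleCat.{u} (B ⊗[k] D)) :
    Module.Finite (A ⊗[k] D) (BTensor M.obj X.obj) := inferInstance

end Bimodules

section Bimodules2

open scoped TensorProduct ModuleCat.Algebra
open MulOpposite

variable {k : Type u} [Field k]
variable {A B D E F : Type u} [Ring A] [Algebra k A] [Ring B] [Algebra k B] [Ring D] [Algebra k D]
  [Ring E] [Algebra k E] [Ring F] [Algebra k F]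

/-- `M` as a left module over the first tensor factor. -/
abbrev resLeft (M : ModuleCat.{u} (A ⊗[k] E)) : ModuleCat.{u} A :=
  (ModuleCat.restrictScalars
    (Algebra.TensorProduct.includeLeft : A →ₐ[k] A ⊗[k] E).toRingHom).obj M

/-- `M` as a module over the second tensor factor. -/
abbrev resRight (M : ModuleCat.{u} (A ⊗[k] E)) : ModuleCat.{u} E :=
  (ModuleCat.restrictScalars
    (Algebra.TensorProduct.includeRight : E →ₐ[k] A ⊗[k] E).toRingHom).obj M

namespace BTensor

variable {M M' : ModuleCat.{u} (A ⊗[k] Bᵐᵒᵖ)} {X X' : ModuleCat.{u} (B ⊗[k] D)}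

/-- A dual basis of `M` as a module over the first tensor factor. -/
lemma exists_left_section (M : ModuleCat.{u} (A ⊗[k] E)) (hM : Module.Projective A (resLeft M)) :
    ∃ s : M →+ (M →₀ A), (∀ (a : A) (m : M), s ((a ⊗ₜ[k] (1 : E)) • m) = a • s m) ∧
      ∀ m, ((s m).sum fun j a => (a ⊗ₜ[k] (1 : E)) • j) = m := by
  obtain ⟨s, hs⟩ := hM.out
  exact ⟨s.toAddMonoidHom, fun a m => s.map_smul a m, fun m => hs m⟩

lemma exists_right_section (M : ModuleCat.{u} (A ⊗[k] E))
    (hM : Module.Projective E (resRight M)) :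
    ∃ s : M →+ (M →₀ E), (∀ (a : E) (m : M), s (((1 : A) ⊗ₜ[k] a) • m) = a • s m) ∧
      ∀ m, ((s m).sum fun j a => ((1 : A) ⊗ₜ[k] a) • j) = m := by
  obtain ⟨s, hs⟩ := hM.out
  exact ⟨s.toAddMonoidHom, fun a m => s.map_smul a m, fun m => hs m⟩

/-- For `M` with a dual basis over `Bᵒᵖ`, the map `M ⊗_B X → X^(M)`. -/
def coordLeft (s : M →+ (M →₀ Bᵐᵒᵖ))
    (hs : ∀ (b : Bᵐᵒᵖ) (m : M), s (((1 : A) ⊗ₜ[k] b) • m) = b • s m) (X : ModuleCat.{u} (B ⊗[k] D)) :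
    BTensor M X →+ (M →₀ X) :=
  liftAdd (AddMonoidHom.mk' (fun m => AddMonoidHom.mk'
      (fun x => (s m).mapRange (fun t => (t.unop ⊗ₜ[k] (1 : D)) • x) (by simp))
      (fun x y => by ext j; simp [smul_add]))
      (fun m m' => by ext x j; simp [TensorProduct.add_tmul, add_smul])) (by
    intro b m x
    ext j
    simp [hs, smul_smul])

lemma coordLeft_tmul (s : M →+ (M →₀ Bᵐᵒᵖ)) (hs) (m : M) (x : X) :
    coordLeft s hs X (tmul m x) =
      (s m).mapRange (fun t => (t.unop ⊗ₜ[k] (1 : D)) • x) (by simp) := rfl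

lemma sum_coordLeft (s : M →+ (M →₀ Bᵐᵒᵖ)) (hs)
    (hs' : ∀ m, ((s m).sum fun j a => ((1 : A) ⊗ₜ[k] a) • j) = m) (z : BTensor M X) :
    ((coordLeft s hs X z).sum fun j x => tmul j x) = z := by
  have : (Finsupp.liftAddHom (fun j => tmulHom j)).comp (coordLeft s hs X) =
      AddMonoidHom.id (BTensor M X) := by
    refine hom_ext fun m x => ?_
    change ((coordLeft s hs X (tmul m x)).sum fun j x => tmul j x) = tmul m x
    rw [coordLeft_tmul, Finsupp.sum_mapRange_index (fun j => by exact (tmulHom j).map_zero)]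
    conv_rhs => rw [← hs' m]
    change _ = (tmulHom (X := X)).flip x _
    rw [Finsupp.sum, Finsupp.sum, map_sum]
    refine Finset.sum_congr rfl fun j _ => ?_
    exact (balanced _ _ _).symm
  exact DFunLike.congr_fun this z

lemma exact_left (hM : Module.Projective Bᵐᵒᵖ (resRight M)) {X₁ X₂ X₃ : ModuleCat.{u} (B ⊗[k] D)}
    (f : X₁ →ₗ[B ⊗[k] D] X₂) (g : X₂ →ₗ[B ⊗[k] D] X₃) (h : Function.Exact f g) :
    Function.Exact (map (M := M) LinearMap.id f) (map (M := M) LinearMap.id g) := by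
  obtain ⟨s, hs, hs'⟩ := exists_right_section M hM
  intro z
  constructor
  · intro hz
    have key : (coordLeft s hs X₂ z).mapRange g (map_zero _) = 0 := by
      rw [← map_zero (coordLeft s hs X₃), ← hz]
      have : (Finsupp.mapRange.addMonoidHom g.toAddMonoidHom).comp (coordLeft s hs X₂) =
          (coordLeft s hs X₃).comp (map (M := M) LinearMap.id g).toAddMonoidHom := by
        refine hom_ext fun m x => ?_
        change ((coordLeft s hs X₂ (tmul m x)).mapRange g (map_zero _)) =
          coordLeft s hs X₃ (tmul m (g x))
        rw [coordLeft_tmul, coordLeft_tmul]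
        ext j
        simp
      exact DFunLike.congr_fun this z
    have hw : ∀ m, ∃ w, f w = coordLeft s hs X₂ z m := fun m => (h _).1 (by
      have := DFunLike.congr_fun key m
      simpa using this)
    choose w hw using hw
    refine ⟨(coordLeft s hs X₂ z).sum fun j _ => tmul j (w j), ?_⟩
    conv_rhs => rw [← sum_coordLeft s hs hs' z]
    rw [Finsupp.sum, map_sum]
    refine Finset.sum_congr rfl fun j _ => ?_
    rw [map_tmul, hw]
    rfl
  · rintro ⟨w, rfl⟩
    induction w using induction_on with
    | zero => simp
    | tmul m x =>
      rw [map_tmul, map_tmul, h.apply_apply_eq_zero]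
      exact (tmulHom _).map_zero
    | add z w hz hw => rw [map_add, map_add, hz, hw, add_zero]

/-- For `X` with a dual basis over `B`, the map `M ⊗_B X → M^(X)`. -/
def coordRight (s : X →+ (X →₀ B))
    (hs : ∀ (b : B) (x : X), s ((b ⊗ₜ[k] (1 : D)) • x) = b • s x) (M : ModuleCat.{u} (A ⊗[k] Bᵐᵒᵖ)) :
    BTensor M X →+ (X →₀ M) :=
  liftAdd (AddMonoidHom.mk' (fun m => AddMonoidHom.mk'
      (fun x => (s x).mapRange (fun t => ((1 : A) ⊗ₜ[k] op t) • m)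
        (by rw [MulOpposite.op_zero, TensorProduct.tmul_zero]; exact zero_smul (A ⊗[k] Bᵐᵒᵖ) m))
      (fun x y => by ext j; simp [TensorProduct.tmul_add, add_smul]))
      (fun m m' => by ext x j; simp [smul_add])) (by
    intro b m x
    ext j
    simp [hs, smul_smul])

lemma coordRight_tmul (s : X →+ (X →₀ B)) (hs) (m : M) (x : X) :
    coordRight s hs M (tmul m x) =
      (s x).mapRange (fun t => ((1 : A) ⊗ₜ[k] op t) • m)
        (by rw [MulOpposite.op_zero, TensorProduct.tmul_zero]; exact zero_smul (A ⊗[k] Bᵐᵒᵖ) m) := rfl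

lemma sum_coordRight (s : X →+ (X →₀ B)) (hs)
    (hs' : ∀ x, ((s x).sum fun j b => (b ⊗ₜ[k] (1 : D)) • j) = x) (z : BTensor M X) :
    ((coordRight s hs M z).sum fun j m => tmul m j) = z := by
  have : (Finsupp.liftAddHom (fun j => (tmulHom (M := M) (X := X)).flip j)).comp
      (coordRight s hs M) = AddMonoidHom.id (BTensor M X) := by
    refine hom_ext fun m x => ?_
    change ((coordRight s hs M (tmul m x)).sum fun j m => tmul m j) = tmul m x
    rw [coordRight_tmul, Finsupp.sum_mapRange_index
      (fun j => by exact ((tmulHom (M := M) (X := X)).flip j).map_zero)]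
    conv_rhs => rw [← hs' x]
    change _ = tmulHom m _
    rw [Finsupp.sum, Finsupp.sum, map_sum]
    refine Finset.sum_congr rfl fun j _ => ?_
    exact balanced _ _ _
  exact DFunLike.congr_fun this z

lemma exact_right (hX : Module.Projective B (resLeft X)) {M₁ M₂ M₃ : ModuleCat.{u} (A ⊗[k] Bᵐᵒᵖ)}
    (f : M₁ →ₗ[A ⊗[k] Bᵐᵒᵖ] M₂) (g : M₂ →ₗ[A ⊗[k] Bᵐᵒᵖ] M₃) (h : Function.Exact f g) :
    Function.Exact (map (X := X) f LinearMap.id) (map (X := X) g LinearMap.id) := by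
  obtain ⟨s, hs, hs'⟩ := exists_left_section X hX
  intro z
  constructor
  · intro hz
    have key : (coordRight s hs M₂ z).mapRange g (map_zero _) = 0 := by
      rw [← map_zero (coordRight s hs M₃), ← hz]
      have : (Finsupp.mapRange.addMonoidHom g.toAddMonoidHom).comp (coordRight s hs M₂) =
          (coordRight s hs M₃).comp (map (X := X) g LinearMap.id).toAddMonoidHom := by
        refine hom_ext fun m x => ?_
        change ((coordRight s hs M₂ (tmul m x)).mapRange g (map_zero _)) =
          coordRight s hs M₃ (tmul (g m) x)
        rw [coordRight_tmul, coordRight_tmul]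
        ext j
        simp
      exact DFunLike.congr_fun this z
    have hw : ∀ m, ∃ w, f w = coordRight s hs M₂ z m := fun m => (h _).1 (by
      have := DFunLike.congr_fun key m
      simpa using this)
    choose w hw using hw
    refine ⟨(coordRight s hs M₂ z).sum fun j _ => tmul (w j) j, ?_⟩
    conv_rhs => rw [← sum_coordRight s hs hs' z]
    rw [Finsupp.sum, map_sum]
    refine Finset.sum_congr rfl fun j _ => ?_
    rw [map_tmul, hw]
    rfl
  · rintro ⟨w, rfl⟩
    induction w using induction_on with
    | zero => simp
    | tmul m x =>
      rw [map_tmul, map_tmul, h.apply_apply_eq_zero]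
      exact ((tmulHom (M := M₃) (X := X)).flip x).map_zero
    | add z w hz hw => rw [map_add, map_add, hz, hw, add_zero]

/-- The biadditive map `(m, x) ↦ g(m, σ(x))`, coefficientwise. -/
def bimap {M X J P W : Type u} [AddCommGroup M] [AddCommGroup X] [AddCommGroup P]
    [AddCommGroup W] (g : M →+ P →+ W) (σ : X →+ (J →₀ P)) : M →+ X →+ (J →₀ W) :=
  AddMonoidHom.mk' (fun m => (Finsupp.mapRange.addMonoidHom (g m)).comp σ)
    (fun m m' => AddMonoidHom.ext fun x => Finsupp.ext fun q => by
      change g (m + m') (σ x q) = g m (σ x q) + g m' (σ x q)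
      rw [map_add, AddMonoidHom.add_apply])

/-- The biadditive map `(f, d) ↦ f ⊗ d`. -/
def finsuppTmul (J : Type u) : (J →₀ A) →+ D →+ (J →₀ (A ⊗[k] D)) :=
  AddMonoidHom.mk' (fun f => AddMonoidHom.mk'
      (fun d => f.mapRange (fun a => a ⊗ₜ[k] d) (TensorProduct.zero_tmul _ _))
      (fun d d' => by ext j; simp [TensorProduct.tmul_add]))
    (fun f f' => by ext d j; simp [TensorProduct.add_tmul])

/-- The biadditive map `(a, f) ↦ a ⊗ f`. -/
def tmulFinsupp (J : Type u) : A →+ (J →₀ D) →+ (J →₀ (A ⊗[k] D)) :=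
  AddMonoidHom.mk' (fun a => AddMonoidHom.mk'
      (fun f => f.mapRange (fun d => a ⊗ₜ[k] d) (TensorProduct.tmul_zero _ _))
      (fun d d' => by ext j; simp [TensorProduct.tmul_add]))
    (fun f f' => by ext d j; simp [TensorProduct.add_tmul])

/-- The biadditive map `(m, b) ↦ m b`. -/
def rightAct (M : ModuleCat.{u} (A ⊗[k] E)) : M →+ E →+ M :=
  AddMonoidHom.mk' (fun m => AddMonoidHom.mk' (fun b => ((1 : A) ⊗ₜ[k] b) • m)
      (fun b b' => by rw [TensorProduct.tmul_add, add_smul]))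
    (fun m m' => by ext b; exact smul_add _ _ _)

/-- The biadditive map `(x, b) ↦ b x`. -/
def leftAct (X : ModuleCat.{u} (B ⊗[k] D)) : X →+ B →+ X :=
  AddMonoidHom.mk' (fun m => AddMonoidHom.mk' (fun b => (b ⊗ₜ[k] (1 : D)) • m)
      (fun b b' => by rw [TensorProduct.add_tmul, add_smul]))
    (fun m m' => by ext b; exact smul_add _ _ _)

/-- Auxiliary map for the projectivity of `M ⊗_B P`. -/
def auxLeft (s : M →+ (M →₀ A)) (hs : ∀ (a : A) (m : M), s ((a ⊗ₜ[k] (1 : Bᵐᵒᵖ)) • m) = a • s m) :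
    M →+ (B ⊗[k] D) →+ (M →₀ (A ⊗[k] D)) :=
  AddMonoidHom.mk' (fun m => TensorProduct.liftAddHom
    ((finsuppTmul (k := k) (A := A) (D := D) M).comp
      (s.comp ((rightAct M m).comp (MulOpposite.opAddEquiv : B ≃+ Bᵐᵒᵖ).toAddMonoidHom)))
    (fun c b d => by
      have h : ((1 : A) ⊗ₜ[k] op (c • b)) • m =
          ((algebraMap k A c) ⊗ₜ[k] (1 : Bᵐᵒᵖ)) • (((1 : A) ⊗ₜ[k] op b) • m) := by
        rw [smul_smul, Algebra.TensorProduct.tmul_mul_tmul, one_mul, mul_one,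
          Algebra.algebraMap_eq_smul_one, TensorProduct.smul_tmul, op_smul]
      refine Finsupp.ext fun j => ?_
      change (s (((1 : A) ⊗ₜ[k] op (c • b)) • m)) j ⊗ₜ[k] d =
        (s (((1 : A) ⊗ₜ[k] op b) • m)) j ⊗ₜ[k] (c • d)
      rw [h, hs, Finsupp.smul_apply, smul_eq_mul, ← Algebra.smul_def, TensorProduct.smul_tmul]))
    (fun m m' => by
      refine AddMonoidHom.ext fun t => ?_
      induction t using TensorProduct.induction_on with
      | zero => rw [map_zero, map_zero]
      | add t t' h h' => rw [map_add, h, h', map_add]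
      | tmul b d =>
        change finsuppTmul (k := k) (A := A) (D := D) M (s (rightAct M (m + m') (op b))) d =
          finsuppTmul M (s (rightAct M m (op b))) d + finsuppTmul M (s (rightAct M m' (op b))) d
        rw [map_add, AddMonoidHom.add_apply, map_add, map_add, AddMonoidHom.add_apply])

lemma auxLeft_tmul (s : M →+ (M →₀ A)) (hs) (m : M) (b : B) (d : D) :
    auxLeft s hs m (b ⊗ₜ[k] d) = (s (((1 : A) ⊗ₜ[k] op b) • m)).mapRange (fun a => a ⊗ₜ[k] d)
        (TensorProduct.zero_tmul _ _) := rfl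

lemma projective_left (hM : Module.Projective A (resLeft M))
    [hX : Module.Projective (B ⊗[k] D) X] :
    Module.Projective (A ⊗[k] D) (BTensor M X) := by
  obtain ⟨s, hs, hs'⟩ := exists_left_section M hM
  obtain ⟨σ, hσ⟩ := hX.out
  have hΨ₁ : ∀ (m : M) (b : B) (t : B ⊗[k] D),
      auxLeft (D := D) s hs (((1 : A) ⊗ₜ[k] op b) • m) t = auxLeft s hs m ((b ⊗ₜ[k] 1) * t) := by
    intro m b t
    induction t using TensorProduct.induction_on with
    | zero => simp
    | add t t' h h' => rw [map_add, h, h', mul_add, map_add]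
    | tmul b' d =>
      rw [Algebra.TensorProduct.tmul_mul_tmul, one_mul, auxLeft_tmul, auxLeft_tmul, smul_smul,
        Algebra.TensorProduct.tmul_mul_tmul, one_mul, op_mul]
  have hΨ₂ : ∀ (a : A) (d : D) (m : M) (t : B ⊗[k] D),
      auxLeft s hs ((a ⊗ₜ[k] (1 : Bᵐᵒᵖ)) • m) ((1 ⊗ₜ[k] d) * t) =
        (a ⊗ₜ[k] d) • auxLeft s hs m t := by
    intro a d m t
    induction t using TensorProduct.induction_on with
    | zero => simp
    | add t t' h h' => rw [mul_add, map_add, h, h', map_add, smul_add]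
    | tmul b' d' =>
      have h : ((1 : A) ⊗ₜ[k] op b') • ((a ⊗ₜ[k] (1 : Bᵐᵒᵖ)) • m) =
          (a ⊗ₜ[k] (1 : Bᵐᵒᵖ)) • (((1 : A) ⊗ₜ[k] op b') • m) := by
        rw [smul_smul, smul_smul, Algebra.TensorProduct.tmul_mul_tmul,
          Algebra.TensorProduct.tmul_mul_tmul, mul_one, mul_one, one_mul, one_mul]
      rw [Algebra.TensorProduct.tmul_mul_tmul, one_mul, auxLeft_tmul, auxLeft_tmul, h, hs]
      ext j
      simp
  let i : BTensor M X →ₗ[A ⊗[k] D] (X →₀ (M →₀ (A ⊗[k] D))) := lift (bimap (auxLeft s hs) σ.toAddMonoidHom)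
    (fun b m x => by
      ext q : 1
      change auxLeft s hs _ (σ x q) = auxLeft s hs m (σ _ q)
      rw [hΨ₁, map_smul σ]
      rfl)
    (fun a d m x => by
      ext q : 1
      change auxLeft s hs _ (σ _ q) = (a ⊗ₜ[k] d) • auxLeft s hs m (σ x q)
      rw [← hΨ₂, map_smul σ]
      rfl)
  let π : (X →₀ (M →₀ (A ⊗[k] D))) →ₗ[A ⊗[k] D] BTensor M X :=
    Finsupp.lsum ℕ (fun q => Finsupp.linearCombination (A ⊗[k] D) (fun j => tmul j q))
  have hπ : ∀ (q : X) (m : M) (t : B ⊗[k] D),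
      Finsupp.linearCombination (A ⊗[k] D) (fun j => (tmul j q : BTensor M X))
        (auxLeft s hs m t) = tmul m (t • q) := by
    intro q m t
    induction t using TensorProduct.induction_on with
    | zero =>
      rw [map_zero, map_zero, zero_smul]
      exact ((tmulHom m).map_zero).symm
    | add t t' h h' => rw [map_add, map_add, h, h', add_smul, tmul_add]
    | tmul b d =>
      have h : (b ⊗ₜ[k] d) • q = (b ⊗ₜ[k] (1 : D)) • (((1 : B) ⊗ₜ[k] d) • q) := by
        rw [smul_smul, Algebra.TensorProduct.tmul_mul_tmul, mul_one, one_mul]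
      rw [h, ← balanced, auxLeft_tmul, Finsupp.linearCombination_apply,
        Finsupp.sum_mapRange_index (fun j => by exact zero_smul (A ⊗[k] D) _)]
      conv_rhs => rw [← hs' (((1 : A) ⊗ₜ[k] op b) • m)]
      change _ = (tmulHom (X := X)).flip _ _
      rw [Finsupp.sum, Finsupp.sum, map_sum]
      refine Finset.sum_congr rfl fun j _ => ?_
      exact smul_tmul _ _ _ _
  refine Module.Projective.of_split i π (linearMap_ext fun m x => ?_)
  change π ((Finsupp.mapRange (auxLeft s hs m) (map_zero _)) (σ x)) = tmul m x
  rw [Finsupp.lsum_apply, Finsupp.sum_mapRange_index (fun q => map_zero _)]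
  conv_rhs => rw [← hσ x]
  change _ = tmulHom m _
  rw [Finsupp.linearCombination_apply, Finsupp.sum, Finsupp.sum, map_sum]
  exact Finset.sum_congr rfl fun q _ => hπ q m _

/-- Auxiliary map for the projectivity of `P ⊗_B X`. -/
def auxRight (s : X →+ (X →₀ D)) (hs : ∀ (d : D) (x : X), s (((1 : B) ⊗ₜ[k] d) • x) = d • s x) :
    X →+ (A ⊗[k] Bᵐᵒᵖ) →+ (X →₀ (A ⊗[k] D)) :=
  AddMonoidHom.mk' (fun x => TensorProduct.liftAddHom
    ((tmulFinsupp (k := k) (A := A) (D := D) X).compl₂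
      (s.comp ((leftAct X x).comp (MulOpposite.opAddEquiv : B ≃+ Bᵐᵒᵖ).symm.toAddMonoidHom)))
    (fun c a b => by
      have h : (unop (c • b) ⊗ₜ[k] (1 : D)) • x =
          ((1 : B) ⊗ₜ[k] algebraMap k D c) • ((unop b ⊗ₜ[k] (1 : D)) • x) := by
        rw [smul_smul, Algebra.TensorProduct.tmul_mul_tmul, one_mul, mul_one,
          Algebra.algebraMap_eq_smul_one, ← TensorProduct.smul_tmul, unop_smul]
      refine Finsupp.ext fun j => ?_
      change (c • a) ⊗ₜ[k] (s ((unop b ⊗ₜ[k] (1 : D)) • x)) j =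
        a ⊗ₜ[k] (s ((unop (c • b) ⊗ₜ[k] (1 : D)) • x)) j
      rw [h, hs, Finsupp.smul_apply, smul_eq_mul, ← Algebra.smul_def, TensorProduct.smul_tmul]))
    (fun x x' => by
      refine AddMonoidHom.ext fun t => ?_
      induction t using TensorProduct.induction_on with
      | zero => rw [map_zero, map_zero]
      | add t t' h h' => rw [map_add, h, h', map_add]
      | tmul a b =>
        change tmulFinsupp (k := k) (A := A) (D := D) X a (s (leftAct X (x + x') (unop b))) =
          tmulFinsupp X a (s (leftAct X x (unop b))) + tmulFinsupp X a (s (leftAct X x' (unop b)))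
        rw [map_add, AddMonoidHom.add_apply, map_add, map_add])

lemma auxRight_tmul (s : X →+ (X →₀ D)) (hs) (x : X) (a : A) (b : Bᵐᵒᵖ) :
    auxRight s hs x (a ⊗ₜ[k] b) = (s ((unop b ⊗ₜ[k] (1 : D)) • x)).mapRange (fun d => a ⊗ₜ[k] d)
        (TensorProduct.tmul_zero _ _) := rfl

lemma projective_right (hX : Module.Projective D (resRight X))
    [hM : Module.Projective (A ⊗[k] Bᵐᵒᵖ) M] :
    Module.Projective (A ⊗[k] D) (BTensor M X) := by
  obtain ⟨s, hs, hs'⟩ := exists_right_section X hX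
  obtain ⟨σ, hσ⟩ := hM.out
  have hΨ₁ : ∀ (x : X) (b : B) (t : A ⊗[k] Bᵐᵒᵖ),
      auxRight (A := A) s hs ((b ⊗ₜ[k] (1 : D)) • x) t = auxRight s hs x ((1 ⊗ₜ[k] op b) * t) := by
    intro x b t
    induction t using TensorProduct.induction_on with
    | zero => simp
    | add t t' h h' => rw [map_add, h, h', mul_add, map_add]
    | tmul a b' =>
      rw [Algebra.TensorProduct.tmul_mul_tmul, one_mul, auxRight_tmul, auxRight_tmul, smul_smul,
        Algebra.TensorProduct.tmul_mul_tmul, one_mul, unop_mul, unop_op]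
  have hΨ₂ : ∀ (a : A) (d : D) (x : X) (t : A ⊗[k] Bᵐᵒᵖ),
      auxRight s hs (((1 : B) ⊗ₜ[k] d) • x) ((a ⊗ₜ[k] 1) * t) =
        (a ⊗ₜ[k] d) • auxRight s hs x t := by
    intro a d x t
    induction t using TensorProduct.induction_on with
    | zero => simp
    | add t t' h h' => rw [mul_add, map_add, h, h', map_add, smul_add]
    | tmul a' b =>
      have h : (unop b ⊗ₜ[k] (1 : D)) • (((1 : B) ⊗ₜ[k] d) • x) =
          ((1 : B) ⊗ₜ[k] d) • ((unop b ⊗ₜ[k] (1 : D)) • x) := by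
        rw [smul_smul, smul_smul, Algebra.TensorProduct.tmul_mul_tmul,
          Algebra.TensorProduct.tmul_mul_tmul, mul_one, mul_one, one_mul, one_mul]
      rw [Algebra.TensorProduct.tmul_mul_tmul, one_mul, auxRight_tmul, auxRight_tmul, h, hs]
      ext j
      simp
  let i : BTensor M X →ₗ[A ⊗[k] D] (M →₀ (X →₀ (A ⊗[k] D))) := lift (bimap (auxRight s hs) σ.toAddMonoidHom).flip
    (fun b m x => by
      ext q : 1
      change auxRight s hs x (σ _ q) = auxRight s hs _ (σ m q)
      rw [hΨ₁, map_smul σ]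
      rfl)
    (fun a d m x => by
      ext q : 1
      change auxRight s hs _ (σ _ q) = (a ⊗ₜ[k] d) • auxRight s hs x (σ m q)
      rw [← hΨ₂, map_smul σ]
      rfl)
  let π : (M →₀ (X →₀ (A ⊗[k] D))) →ₗ[A ⊗[k] D] BTensor M X :=
    Finsupp.lsum ℕ (fun q => Finsupp.linearCombination (A ⊗[k] D) (fun j => tmul q j))
  have hπ : ∀ (q : M) (x : X) (t : A ⊗[k] Bᵐᵒᵖ),
      Finsupp.linearCombination (A ⊗[k] D) (fun j => (tmul q j : BTensor M X))
        (auxRight s hs x t) = tmul (t • q) x := by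
    intro q x t
    induction t using TensorProduct.induction_on with
    | zero =>
      rw [map_zero, map_zero]
      refine Eq.symm ((congrArg (fun y => tmul y x) (zero_smul (A ⊗[k] Bᵐᵒᵖ) q)).trans ?_)
      exact ((tmulHom (M := M) (X := X)).flip x).map_zero
    | add t t' h h' => rw [map_add, map_add, h, h', add_smul, add_tmul]
    | tmul a b =>
      have h : (a ⊗ₜ[k] b) • q = ((1 : A) ⊗ₜ[k] op (unop b)) • ((a ⊗ₜ[k] (1 : Bᵐᵒᵖ)) • q) := by
        rw [smul_smul, Algebra.TensorProduct.tmul_mul_tmul, mul_one, one_mul, op_unop]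
      rw [h, balanced, auxRight_tmul, Finsupp.linearCombination_apply,
        Finsupp.sum_mapRange_index (fun j => by exact zero_smul (A ⊗[k] D) _)]
      conv_rhs => rw [← hs' ((unop b ⊗ₜ[k] (1 : D)) • x)]
      change _ = tmulHom _ _
      rw [Finsupp.sum, Finsupp.sum, map_sum]
      refine Finset.sum_congr rfl fun j _ => ?_
      exact smul_tmul _ _ _ _
  refine Module.Projective.of_split i π (linearMap_ext fun m x => ?_)
  change π ((Finsupp.mapRange (auxRight s hs x) (map_zero _)) (σ m)) = tmul m x
  rw [Finsupp.lsum_apply, Finsupp.sum_mapRange_index (fun q => map_zero _)]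
  conv_rhs => rw [← hσ m]
  change _ = (tmulHom (X := X)).flip x _
  rw [Finsupp.linearCombination_apply, Finsupp.sum, Finsupp.sum, map_sum]
  exact Finset.sum_congr rfl fun q _ => hπ q x _

end BTensor
end Bimodules2

section TensorFunctors

open scoped TensorProduct ModuleCat.Algebra
open MulOpposite

section General

variable {R S : Type u} [Ring R] [IsNoetherianRing R] [Ring S] [IsNoetherianRing S]

lemma FGModuleCat.exact_iff_function_exact (T : ShortComplex (FGModuleCat.{u} R)) :
    T.Exact ↔ Function.Exact T.f.hom.hom T.g.hom.hom := by
  rw [← ShortComplex.exact_map_iff_of_faithful T (forget₂ (FGModuleCat.{u} R) (ModuleCat.{u} R))]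
  exact ShortComplex.ShortExact.moduleCat_exact_iff_function_exact _

lemma FGModuleCat.projective_iff (P : FGModuleCat.{u} R) :
    Projective P ↔ Module.Projective R P.obj := by
  constructor
  · intro hP
    obtain ⟨n, f, hf⟩ := Module.Finite.exists_fin' R P.obj
    let F : FGModuleCat.{u} R := FGModuleCat.of R (ULift.{u} (Fin n) → R)
    let e : (ULift.{u} (Fin n) → R) ≃ₗ[R] (Fin n → R) :=
      LinearEquiv.funCongrLeft R R Equiv.ulift.symm
    let p : F ⟶ P := ObjectProperty.homMk (ModuleCat.ofHom (f.comp e.toLinearMap))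
    have hp : Epi p := by
      refine (forget₂ (FGModuleCat.{u} R) (ModuleCat.{u} R)).epi_of_epi_map ?_
      rw [ModuleCat.epi_iff_surjective]
      exact hf.comp e.surjective
    refine Module.Projective.of_split (Projective.factorThru (𝟙 P) p).hom.hom p.hom.hom ?_
    have := Projective.factorThru_comp (𝟙 P) p
    exact congrArg (fun g => g.hom.hom) this
  · intro hP
    refine ⟨fun {E X} f e he => ?_⟩
    have hs : Function.Surjective e.hom.hom := by
      rw [← ModuleCat.epi_iff_surjective]
      exact inferInstanceAs (Epi ((forget₂ (FGModuleCat.{u} R) (ModuleCat.{u} R)).map e))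
    obtain ⟨g, hg⟩ := Module.projective_lifting_property e.hom.hom f.hom.hom hs
    exact ⟨ObjectProperty.homMk (ModuleCat.ofHom g), FGModuleCat.hom_ext hg⟩

end General

variable {k : Type u} [Field k]
variable {A B D E : Type u} [Ring A] [Algebra k A] [Ring B] [Algebra k B] [Ring D] [Algebra k D]
  [Ring E] [Algebra k E]
variable [Module.Finite k A] [Module.Finite k B] [Module.Finite k D] [Module.Finite k E]

/-- `M` is projective over each of the two tensor factors. -/
class IsLeftRightProjective (M : FGModuleCat.{u} (A ⊗[k] E)) : Prop where
  left : Module.Projective A (resLeft M.obj)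
  right : Module.Projective E (resRight M.obj)

/-- The functor `M ⊗_B -` on finitely generated modules over `B ⊗ D`. -/
def tensorLeft (M : FGModuleCat.{u} (A ⊗[k] Bᵐᵒᵖ)) :
    FGModuleCat.{u} (B ⊗[k] D) ⥤ FGModuleCat.{u} (A ⊗[k] D) where
  obj X := FGModuleCat.of _ (BTensor M.obj X.obj)
  map f := FGModuleCat.ofHom (BTensor.map LinearMap.id f.hom.hom)
  map_id _ := FGModuleCat.hom_ext (BTensor.linearMap_ext fun _ _ => rfl)
  map_comp _ _ := FGModuleCat.hom_ext (BTensor.linearMap_ext fun _ _ => rfl)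

/-- The functor `- ⊗_B N` on finitely generated modules over `A ⊗ Bᵒᵖ`. -/
def tensorRight (N : FGModuleCat.{u} (B ⊗[k] D)) :
    FGModuleCat.{u} (A ⊗[k] Bᵐᵒᵖ) ⥤ FGModuleCat.{u} (A ⊗[k] D) where
  obj X := FGModuleCat.of _ (BTensor X.obj N.obj)
  map f := FGModuleCat.ofHom (BTensor.map f.hom.hom LinearMap.id)
  map_id _ := FGModuleCat.hom_ext (BTensor.linearMap_ext fun _ _ => rfl)
  map_comp _ _ := FGModuleCat.hom_ext (BTensor.linearMap_ext fun _ _ => rfl)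

instance (M : FGModuleCat.{u} (A ⊗[k] Bᵐᵒᵖ)) : (tensorLeft (D := D) M).Additive where
  map_add := FGModuleCat.hom_ext (BTensor.linearMap_ext fun _ _ => BTensor.tmul_add _ _ _)

instance (N : FGModuleCat.{u} (B ⊗[k] D)) : (tensorRight (A := A) N).Additive where
  map_add := FGModuleCat.hom_ext (BTensor.linearMap_ext fun _ _ => BTensor.add_tmul _ _ _)

lemma tensorLeft_exact (M : FGModuleCat.{u} (A ⊗[k] Bᵐᵒᵖ)) [h : IsLeftRightProjective M] :
    PreservesFiniteLimits (tensorLeft (D := D) M) ∧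
      PreservesFiniteColimits (tensorLeft (D := D) M) :=
  ((tensorLeft (D := D) M).exact_tfae.out 1 3).1 fun S hS => by
    rw [FGModuleCat.exact_iff_function_exact] at hS ⊢
    exact BTensor.exact_left h.right _ _ hS

lemma tensorRight_exact (N : FGModuleCat.{u} (B ⊗[k] D)) [h : IsLeftRightProjective N] :
    PreservesFiniteLimits (tensorRight (A := A) N) ∧
      PreservesFiniteColimits (tensorRight (A := A) N) :=
  ((tensorRight (A := A) N).exact_tfae.out 1 3).1 fun S hS => by
    rw [FGModuleCat.exact_iff_function_exact] at hS ⊢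
    exact BTensor.exact_right h.left _ _ hS

section
variable (M : FGModuleCat.{u} (A ⊗[k] Bᵐᵒᵖ)) [IsLeftRightProjective M]
instance : PreservesFiniteLimits (tensorLeft (D := D) M) := (tensorLeft_exact M).1
instance : PreservesFiniteColimits (tensorLeft (D := D) M) := (tensorLeft_exact M).2
instance : (tensorLeft (D := D) M).PreservesProjectiveObjects where
  projective_obj {X} hX := by
    rw [FGModuleCat.projective_iff] at hX ⊢
    exact BTensor.projective_left IsLeftRightProjective.left
end

section
variable (N : FGModuleCat.{u} (B ⊗[k] D)) [IsLeftRightProjective N]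
instance : PreservesFiniteLimits (tensorRight (A := A) N) := (tensorRight_exact N).1
instance : PreservesFiniteColimits (tensorRight (A := A) N) := (tensorRight_exact N).2
instance : (tensorRight (A := A) N).PreservesProjectiveObjects where
  projective_obj {X} hX := by
    rw [FGModuleCat.projective_iff] at hX ⊢
    exact BTensor.projective_right IsLeftRightProjective.right
end

end TensorFunctors

section InducedMap

variable {D : Type u} [Category.{v} D] [HasShift D ℤ]

universe v' u'
variable {D' : Type u'} [Category.{v'} D'] [HasShift D' ℤ]

/-- Let `F` be a functor that commutes with shifts, and `α : (F X)⟦l⟧ ≅ Y`. This is the map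
`Hom(X, X⟦n⟧) → Hom(Y, Y⟦n⟧)` that sends `f` to `F f`, shifted by `l` and
transported along `α`. -/
def GrEndPart.induced (F : D ⥤ D') [F.CommShift ℤ] {X : D} {Y : D'} {l : ℤ}
    (α : (F.obj X)⟦l⟧ ≅ Y) (n : ℤ) (f : GrEndPart X n) : GrEndPart Y n :=
  (α.inv ≫ (ShiftedHom.map f F)⟦l⟧' ≫ (shiftFunctorComm D' n l).hom.app (F.obj X) ≫ α.hom⟦n⟧' :
    Y ⟶ Y⟦n⟧)

end InducedMap

section StableCategory

variable (C : Type u) [Category.{v} C] [Preadditive C]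

/-- Two morphisms are identified if their difference factors through a projective object. -/
def stableRel : HomRel C := fun X Y f g =>
  ∃ (P : C) (_ : Projective P) (a : X ⟶ P) (b : P ⟶ Y), f - g = a ≫ b

/-- The stable category: `C` modulo morphisms that factor through projective objects. -/
abbrev StableCategory : Type u := Quotient (stableRel C)

/-- The functor from `C` to its stable category. -/
abbrev toStable : C ⥤ StableCategory C := Quotient.functor (stableRel C)

end StableCategory

section SingularHochschild

open scoped TensorProduct ModuleCat.Algebra
open MulOpposite

variable (k : Type u) [Field k] (A : Type u) [Ring A] [Algebra k A]

/-- The underlying type of the `A`-`A`-bimodule `A`. -/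
def RegularBimodule (_k : Type u) (A : Type u) : Type u := A

instance : AddCommGroup (RegularBimodule k A) := inferInstanceAs (AddCommGroup A)

/-- The action `(a ⊗ b) • x = a * x * b`. -/
instance : Module (A ⊗[k] Aᵐᵒᵖ) (RegularBimodule k A) :=
  instModuleTensorProductMop k A

lemma RegularBimodule.smul_def (a : A) (b : Aᵐᵒᵖ) (x : A) :
    (a ⊗ₜ[k] b) • (show RegularBimodule k A from x) = (a * (x * unop b) : A) := rfl

instance [Module.Finite k A] : Module.Finite (A ⊗[k] Aᵐᵒᵖ) (RegularBimodule k A) :=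
  .of_surjective (LinearMap.toSpanSingleton (A ⊗[k] Aᵐᵒᵖ) (RegularBimodule k A) (1 : A))
    (fun a => ⟨(show A from a) ⊗ₜ[k] 1, by
      change (show A from a) * ((1 : A) * (1 : A)) = (show A from a)
      rw [mul_one, mul_one]⟩)

variable [Module.Finite k A]

/-- Finitely generated `A`-`A`-bimodules. -/
abbrev FGBimod : Type (u + 1) := FGModuleCat.{u} (A ⊗[k] Aᵐᵒᵖ)

/-- `A` as an `A`-`A`-bimodule. -/
def regular : FGBimod k A := FGModuleCat.of _ (RegularBimodule k A)

/-- The bimodule `A` as an object of the singularity category of `A`-`A`-bimodules. -/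
def regularSg : Dsg (FGBimod k A) := (toDsg (C := FGBimod k A)).obj (regular k A)

/-- The Hochschild singular cohomology ring
`HH_sg^*(A, A) = ⨁ₙ Hom(A, A⟦n⟧)`, in the singularity category of `A`-`A`-bimodules. -/
abbrev HHsg : Type (u + 1) := GrEnd (regularSg k A)

variable {k A} in
/-- `A ⊗_k X` -/
def freeLeft (X : FGBimod k A) : FGBimod k A := FGModuleCat.of _ (KTensor (regular k A).obj X.obj)

variable {k A} in
/-- The map `A ⊗_k X → X`, `a ⊗ x ↦ a x`. -/
def leftAction (X : FGBimod k A) : freeLeft X ⟶ X :=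
  FGModuleCat.ofHom (KTensor.lift (M := (regular k A).obj) (X := X.obj)
    ((BTensor.leftAct X.obj).flip)
    (fun c a x => by
      change ((algebraMap k A c * ((show A from a) * 1)) ⊗ₜ[k] (1 : Aᵐᵒᵖ)) • x =
        ((show A from a) ⊗ₜ[k] (1 : Aᵐᵒᵖ)) • ((algebraMap k A c) ⊗ₜ[k] (1 : Aᵐᵒᵖ)) • x
      rw [smul_smul, Algebra.TensorProduct.tmul_mul_tmul, mul_one, mul_one, Algebra.commutes])
    (fun a d b x => by
      change ((a * ((show A from b) * 1)) ⊗ₜ[k] (1 : Aᵐᵒᵖ)) • ((1 : A) ⊗ₜ[k] d) • x =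
        (a ⊗ₜ[k] d) • ((show A from b) ⊗ₜ[k] (1 : Aᵐᵒᵖ)) • x
      rw [smul_smul, smul_smul, Algebra.TensorProduct.tmul_mul_tmul,
        Algebra.TensorProduct.tmul_mul_tmul, mul_one, mul_one, mul_one, one_mul]))

variable {k A} in
/-- The map `A ⊗_k f`. -/
def freeLeftMap {X Y : FGBimod k A} (f : X ⟶ Y) : freeLeft X ⟶ freeLeft Y :=
  FGModuleCat.ofHom (KTensor.lift (M := (regular k A).obj) (X := X.obj)
    (AddMonoidHom.mk' (fun a => AddMonoidHom.mk' (fun x => KTensor.tmul a (f.hom.hom x))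
        (fun x y => by rw [map_add, KTensor.tmul_add]))
      (fun a b => AddMonoidHom.ext fun x => KTensor.add_tmul _ _ _))
    (fun c a x => by
      refine (KTensor.smul_tmul' c a (f.hom.hom x)).trans (congrArg (KTensor.tmul a) ?_)
      exact (f.hom.hom.map_smul (algebraMap k (A ⊗[k] Aᵐᵒᵖ) c) x).symm)
    (fun a d m x => by
      change KTensor.tmul _ (f.hom.hom _) =
        (a ⊗ₜ[k] d) • KTensor.tmul m (f.hom.hom x)
      rw [map_smul, KTensor.smul_tmul]))

/-- The bimodule `A^{⊗ (n + 1)}`. -/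
def barObj : ℕ → FGBimod k A
  | 0 => regular k A
  | n + 1 => freeLeft (barObj n)

/-- The bar differential `A^{⊗ (n + 2)} → A^{⊗ (n + 1)}`,
`a₀ ⊗ ⋯ ⊗ aₙ₊₁ ↦ ∑ᵢ (-1)^i a₀ ⊗ ⋯ ⊗ aᵢ aᵢ₊₁ ⊗ ⋯ ⊗ aₙ₊₁`. -/
def barD : (n : ℕ) → (barObj k A (n + 1) ⟶ barObj k A n)
  | 0 => leftAction (regular k A)
  | n + 1 => leftAction (freeLeft (barObj k A n)) -
      freeLeftMap (X := freeLeft (barObj k A n)) (Y := barObj k A n) (barD n)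

/-- `Ω^r(A)`: the image of the bar differential `A^{⊗ (r + 2)} → A^{⊗ (r + 1)}` for `r ≥ 1`,
and `A` for `r = 0`. -/
def syzygy : ℕ → FGBimod k A
  | 0 => regular k A
  | r + 1 => FGModuleCat.of _ (LinearMap.range (barD k A (r + 1)).hom.hom)

end SingularHochschild

section SingularEquivalence

open scoped TensorProduct ModuleCat.Algebra
open MulOpposite

variable {k : Type u} [Field k] {A B : Type u} [Ring A] [Algebra k A] [Ring B] [Algebra k B]
  [Module.Finite k A] [Module.Finite k B]

/-- The functor `M ⊗_B - ⊗_B N` from `B`-`B`-bimodules to `A`-`A`-bimodules. -/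
def tensorBoth (M : FGModuleCat.{u} (A ⊗[k] Bᵐᵒᵖ)) (N : FGModuleCat.{u} (B ⊗[k] Aᵐᵒᵖ)) :
    FGBimod k B ⥤ FGBimod k A :=
  tensorLeft M ⋙ tensorRight N

section
variable (M : FGModuleCat.{u} (A ⊗[k] Bᵐᵒᵖ)) (N : FGModuleCat.{u} (B ⊗[k] Aᵐᵒᵖ))

instance : (tensorBoth M N).Additive := by unfold tensorBoth; infer_instance

variable [IsLeftRightProjective M] [IsLeftRightProjective N]

instance : PreservesFiniteLimits (tensorBoth M N) := by unfold tensorBoth; infer_instance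
instance : PreservesFiniteColimits (tensorBoth M N) := by unfold tensorBoth; infer_instance
instance : (tensorBoth M N).PreservesProjectiveObjects := by unfold tensorBoth; infer_instance

end

/-- `(M, N)` defines a singular equivalence of Morita type with level `l` between `A` and `B`. -/
structure IsSingularEquivalenceOfMoritaType (l : ℕ) (M : FGModuleCat.{u} (A ⊗[k] Bᵐᵒᵖ))
    (N : FGModuleCat.{u} (B ⊗[k] Aᵐᵒᵖ)) : Prop where
  projective_M : IsLeftRightProjective M
  projective_N : IsLeftRightProjective N
  /-- `M ⊗_B N ≅ Ω^l(A)` in the stable category of `A`-`A`-bimodules. -/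
  iso_left : Nonempty ((toStable (FGBimod k A)).obj ((tensorLeft M).obj N) ≅
    (toStable (FGBimod k A)).obj (syzygy k A l))
  /-- `N ⊗_A M ≅ Ω^l(B)` in the stable category of `B`-`B`-bimodules. -/
  iso_right : Nonempty ((toStable (FGBimod k B)).obj ((tensorLeft N).obj M) ≅
    (toStable (FGBimod k B)).obj (syzygy k B l))

variable {l : ℕ} {M : FGModuleCat.{u} (A ⊗[k] Bᵐᵒᵖ)} {N : FGModuleCat.{u} (B ⊗[k] Aᵐᵒᵖ)}

namespace IsSingularEquivalenceOfMoritaType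

lemma symm (h : IsSingularEquivalenceOfMoritaType l M N) :
    IsSingularEquivalenceOfMoritaType l N M :=
  ⟨h.projective_N, h.projective_M, h.iso_right, h.iso_left⟩

/-- The functor `M ⊗_B - ⊗_B N` on singularity categories of bimodules. -/
def functor (h : IsSingularEquivalenceOfMoritaType l M N) : Dsg (FGBimod k B) ⥤ Dsg (FGBimod k A) :=
  haveI := h.projective_M
  haveI := h.projective_N
  mapDsg (tensorBoth M N)

instance (h : IsSingularEquivalenceOfMoritaType l M N) : h.functor.CommShift ℤ :=
  haveI := h.projective_M
  haveI := h.projective_N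
  inferInstanceAs ((mapDsg (tensorBoth M N)).CommShift ℤ)

end IsSingularEquivalenceOfMoritaType

end SingularEquivalence

end

/-! Write `Ω^r` for `Ω^r(A)` and `R_r` for the functor `- ⊗_A Ω^r`. The bar sequences `0 → Ω^(r+1) →
A^{⊗(r+2)} → Ω^r → 0` split as sequences of left modules and as sequences of right modules. Hence
the `R_r` are exact, preserve projective bimodules, and fit into short exact sequences of functors
`0 → R_(r+1) → V_r → R_r → 0` with `V_r = - ⊗_A A^{⊗(r+2)}`. The connecting morphisms `R_r →
R_(r+1)[1]` are natural and commute with `[n]` up to the sign `(-1)^n` (`connecting_shift`). At the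
object `A` the middle term is projective, so these morphisms become invertible in the singularity
category, and their composite is an isomorphism `σ_r : A ≅ Ω^r[r]`.

Graded commutativity (`SyzygySystem.intertwines_id`). A class `g : A → A[n]` is a fraction. Followed
by `σ_p` with `p` large it comes from a morphism `A → Ω^p[p+n]` of the bounded derived category with
`p + n ≥ 0`, because a perfect complex has no nonzero maps to modules shifted far enough. Such a
morphism factors through `p + n` connecting morphisms, and what is left is a bimodule map `Ω^(p+n) →
Ω^p`, which is the same as a natural transformation `R_(p+n) → R_p`. So both `σ_p` and `g` followed
by `σ_p` are components at `A` of graded natural transformations out of the identity functor.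
Naturality of these with respect to `f : A → A[m]` is the Koszul sign rule; cancelling the
invertible `σ_p` gives the rule for `f` and `g`.

Inverse isomorphisms (`GrEndPart.transport_transport`). The functor `GF` is `(N ⊗_A M) ⊗_B - ⊗_B (N
⊗_A M)`. Since `N ⊗_A M` is stably `Ω^l(B)`, the constructions above, done once on the left and once
on the right, yield an invertible `w : B → GF(B)[2l]` under which `f` corresponds to `GF(f)`; the
sign `(-1)^(2ln)` is trivial. The isomorphisms `α` and `β` yield another invertible `γ : B →
GF(B)[2l]`, under which the composite of the two maps of the theorem, applied to `f`, corresponds to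
`GF(f)`. The composite is therefore conjugation by a degree `0` automorphism of `B`, which is
trivial by graded commutativity. This is why every choice of `α` and `β` works; the other composite
follows by exchanging `A` and `B`. -/

noncomputable section

open CategoryTheory CategoryTheory.Limits CategoryTheory.Pretriangulated

/-! ### Graded natural transformations and their Koszul signs. -/

section GradedNatTrans

universe v₁ v₂ v₃ v₄ u₁ u₂ u₃ u₄

variable {C : Type u₁} [Category.{v₁} C] [HasShift C ℤ]
  {D : Type u₂} [Category.{v₂} D] [HasShift D ℤ]
  {E : Type u₃} [Category.{v₃} E] [HasShift E ℤ]

section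

variable [Preadditive D]

/-- A natural transformation `F X → (G X)⟦a⟧` that commutes with shifts up to the sign
`(-1)^(a n)`. -/
structure GradedNatTrans (F G : C ⥤ D) [F.CommShift ℤ] [G.CommShift ℤ] (a : ℤ) where
  app (X : C) : ShiftedHom (F.obj X) (G.obj X) a
  naturality {X Y : C} (f : X ⟶ Y) : F.map f ≫ app Y = app X ≫ (G.map f)⟦a⟧'
  shift (n : ℤ) (X : C) : app (X⟦n⟧) ≫ ((G.commShiftIso n).hom.app X)⟦a⟧' =
    (a * n).negOnePow • ((F.commShiftIso n).hom.app X ≫ (app X)⟦n⟧' ≫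
      (shiftFunctorComm D a n).hom.app (G.obj X))

namespace GradedNatTrans

variable {F G : C ⥤ D} [F.CommShift ℤ] [G.CommShift ℤ] {a : ℤ}

/-- Naturality moves `F f` past `u`, which leaves the component of `u` at `Y⟦n⟧` to be compared with
the one at `Y`. The axiom `shift` makes this comparison, and it is the only source of the sign. -/
lemma map_comp (u : GradedNatTrans F G a) {X Y : C} {n : ℤ} (f : ShiftedHom X Y n) {c : ℤ}
    (h : a + n = c) :
    (f.map F).comp (u.app Y) h =
      (a * n).negOnePow • (u.app X).comp (f.map G) ((add_comm n a).trans h) := by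
  simp only [ShiftedHom.comp, ShiftedHom.map, Functor.map_comp, Category.assoc]
  have := u.naturality f
  rw [← reassoc_of% this]
  have := u.shift n Y =≫ (shiftFunctorAdd' D n a c ((add_comm n a).trans h)).inv.app (G.obj Y)
  rw [Category.assoc] at this
  rw [this]
  simp only [Linear.units_smul_comp, Linear.comp_units_smul, smul_smul, Int.units_mul_self,
    one_smul, Category.assoc]
  rw [shiftFunctorComm_eq D a n c h]
  simp

/-- A natural transformation that commutes with shifts, as a graded one of degree `0`. -/
def ofNatTrans (τ : F ⟶ G) [NatTrans.CommShift τ ℤ] : GradedNatTrans F G 0 where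
  app X := ShiftedHom.mk₀ 0 rfl (τ.app X)
  naturality f := by
    simp only [ShiftedHom.mk₀, Category.assoc, ← NatTrans.naturality, τ.naturality_assoc]
    simp
  shift n X := by
    rw [zero_mul, Int.negOnePow_zero, one_smul, shiftFunctorComm_eq D 0 n n (zero_add n)]
    simp only [ShiftedHom.mk₀, Category.assoc, Functor.map_comp, shiftFunctorZero',
      Iso.symm_hom, Iso.trans_hom, NatTrans.comp_app, eqToIso_refl, Iso.refl_trans,
      shiftFunctorAdd'_zero_add_inv_app, shiftFunctorAdd'_add_zero_hom_app]
    rw [τ.shift_app_comm_assoc, ← Functor.map_comp_assoc, Iso.inv_hom_id_app]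
    have := (shiftFunctorZero D ℤ).inv.naturality ((G.commShiftIso n).hom.app X)
    refine (τ.app _ ≫= this).symm.trans ?_
    simp

/-- Transport along isomorphisms of functors that commute with shifts. -/
def conj (u : GradedNatTrans F G a) {F' G' : C ⥤ D} [F'.CommShift ℤ] [G'.CommShift ℤ]
    (e : F' ≅ F) [NatTrans.CommShift e.hom ℤ] (e' : G ≅ G') [NatTrans.CommShift e'.hom ℤ] :
    GradedNatTrans F' G' a where
  app X := e.hom.app X ≫ u.app X ≫ (e'.hom.app X)⟦a⟧'
  naturality {X Y} f := by
    have := u.naturality f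
    simp only [NatTrans.naturality_assoc, Category.assoc, reassoc_of% this, ← Functor.map_comp,
      NatTrans.naturality]
  shift n X := by
    have h1 := e.hom.shift_app_comm n X
    have h2 := e'.hom.shift_app_comm n X
    have h3 := u.shift n X
    have h4 := (shiftFunctorComm D a n).hom.naturality (e'.hom.app X)
    simp only [Functor.comp_map] at h4
    simp only [Functor.map_comp, Category.assoc, reassoc_of% h1, h4]
    rw [← Functor.map_comp, ← h2, Functor.map_comp, reassoc_of% h3]
    simp only [Linear.units_smul_comp, Linear.comp_units_smul, Category.assoc]

/-- Precomposition with a functor that commutes with shifts. -/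
def whiskerLeft (u : GradedNatTrans F G a) (H : E ⥤ C) [H.CommShift ℤ] :
    GradedNatTrans (H ⋙ F) (H ⋙ G) a where
  app X := u.app (H.obj X)
  naturality f := u.naturality (H.map f)
  shift n X := by
    have h1 := u.naturality ((H.commShiftIso n).hom.app X)
    have h3 := u.shift n (H.obj X)
    simp only [Functor.commShiftIso_comp_hom_app, Functor.map_comp, Category.assoc,
      Functor.comp_obj]
    rw [← reassoc_of% h1, h3]
    simp only [Linear.comp_units_smul]

/-- Descent along a localization functor. -/
def localize (L : C ⥤ E) (W : MorphismProperty C) [L.IsLocalization W] [L.CommShift ℤ]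
    {F G : E ⥤ D} [F.CommShift ℤ] [G.CommShift ℤ]
    (u : GradedNatTrans (L ⋙ F) (L ⋙ G) a) : GradedNatTrans F G a where
  app := (Localization.liftNatTrans L W (L ⋙ F) (L ⋙ G ⋙ shiftFunctor D a) F
    (G ⋙ shiftFunctor D a) ⟨u.app, fun _ _ f => u.naturality f⟩).app
  naturality f := (Localization.liftNatTrans L W (L ⋙ F) (L ⋙ G ⋙ shiftFunctor D a) F
    (G ⋙ shiftFunctor D a) ⟨u.app, fun _ _ f => u.naturality f⟩).naturality f
  shift n X := by
    set τ := Localization.liftNatTrans L W (L ⋙ F) (L ⋙ G ⋙ shiftFunctor D a) F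
      (G ⋙ shiftFunctor D a) ⟨u.app, fun _ _ f => u.naturality f⟩ with hτ
    have hτ' (X : C) : τ.app (L.obj X) = u.app X := by simp [hτ]
    -- Both sides of the shift identity are natural in the object, so they may be compared on
    -- objects in the image of `L` alone.
    let α : shiftFunctor E n ⋙ F ⟶ G ⋙ shiftFunctor D n ⋙ shiftFunctor D a :=
      Functor.whiskerLeft (shiftFunctor E n) τ ≫
        Functor.whiskerRight (G.commShiftIso n).hom (shiftFunctor D a)
    let β : shiftFunctor E n ⋙ F ⟶ G ⋙ shiftFunctor D n ⋙ shiftFunctor D a :=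
      (F.commShiftIso n).hom ≫ Functor.whiskerRight τ (shiftFunctor D n) ≫
        Functor.whiskerLeft G (shiftFunctorComm D a n).hom
    have h : α = (a * n).negOnePow • β := Localization.natTrans_ext L W (fun X => by
      rw [NatTrans.app_units_zsmul]
      change τ.app _ ≫ _ = (a * n).negOnePow • (_ ≫ (τ.app _)⟦n⟧' ≫ _)
      have h1 := u.shift n X
      have h2 := τ.naturality ((L.commShiftIso n).hom.app X)
      simp only [hτ', Functor.commShiftIso_comp_hom_app, Functor.map_comp, Category.assoc,
        Functor.comp_map, Functor.comp_obj] at h1 h2 ⊢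
      rw [← cancel_epi (F.map ((L.commShiftIso n).hom.app X)), reassoc_of% h2]
      refine h1.trans ?_
      simp only [Linear.comp_units_smul]
      rfl)
    have := NatTrans.congr_app h X
    rwa [NatTrans.app_units_zsmul] at this

@[simp]
lemma localize_app (L : C ⥤ E) (W : MorphismProperty C) [L.IsLocalization W] [L.CommShift ℤ]
    {F G : E ⥤ D} [F.CommShift ℤ] [G.CommShift ℤ]
    (u : GradedNatTrans (L ⋙ F) (L ⋙ G) a) (X : C) :
    (u.localize L W).app (L.obj X) = u.app X := by
  simp [localize]

variable [Preadditive E]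

/-- Postcomposition with an additive functor that commutes with shifts. -/
def whiskerRight (u : GradedNatTrans F G a) (H : D ⥤ E) [H.CommShift ℤ] [H.Additive] :
    GradedNatTrans (F ⋙ H) (G ⋙ H) a where
  app X := (u.app X).map H
  naturality f := by
    have h1 := u.naturality f
    simp only [ShiftedHom.map, Functor.comp_map, ← Functor.commShiftIso_hom_naturality,
      ← Functor.map_comp_assoc, h1, Category.assoc]
  shift n X := by
    have h := H.congr_map (u.shift n X)
    have h2 := H.map_shiftFunctorComm_hom_app (G.obj X) a n
    simp only [Functor.map_comp, Functor.map_units_smul, h2] at h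
    simp only [ShiftedHom.map, Functor.commShiftIso_comp_hom_app, Functor.map_comp,
      Category.assoc, ← Functor.commShiftIso_hom_naturality_assoc, reassoc_of% h,
      Linear.units_smul_comp]
    simp [← Functor.map_comp]

/-- A graded natural transformation can be checked after a fully faithful functor. -/
def reflect (H : D ⥤ E) [H.CommShift ℤ] [H.Additive] [H.Full] [H.Faithful]
    (u : GradedNatTrans (F ⋙ H) (G ⋙ H) a) : GradedNatTrans F G a where
  app X := H.preimage (u.app X ≫ (H.commShiftIso a).inv.app _)
  naturality f := H.map_injective (by
    have h1 := u.naturality f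
    simp only [Functor.comp_map] at h1
    simp only [Functor.map_comp, Functor.map_preimage, reassoc_of% h1, Category.assoc,
      Functor.commShiftIso_inv_naturality])
  shift n X := H.map_injective (by
    have h := u.shift n X
    have h2 := H.map_shiftFunctorComm_hom_app (G.obj X) a n
    have hv (X : C) : ∃ v : ShiftedHom (F.obj X) (G.obj X) a, u.app X = v.map H :=
      ⟨H.preimage (u.app X ≫ (H.commShiftIso a).inv.app _), by simp [ShiftedHom.map]⟩
    obtain ⟨v, hv₁⟩ := hv (X⟦n⟧)
    obtain ⟨w, hw⟩ := hv X
    rw [hv₁, hw] at h ⊢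
    simp only [Functor.commShiftIso_comp_hom_app, Functor.map_comp, Category.assoc,
      ShiftedHom.map] at h
    have h5 : ((H.commShiftIso n).inv.app (G.obj X))⟦a⟧' ≫
        ((H.commShiftIso n).hom.app (G.obj X))⟦a⟧' = 𝟙 _ := by
      rw [← Functor.map_comp, Iso.inv_hom_id_app, CategoryTheory.Functor.map_id]
    rw [← cancel_mono ((H.commShiftIso a).hom.app _ ≫ ((H.commShiftIso n).hom.app _)⟦a⟧')]
    simp only [ShiftedHom.map, Category.assoc, Iso.hom_inv_id_app, Functor.comp_obj,
      Category.comp_id, Functor.map_comp, Functor.map_preimage, Functor.map_units_smul,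
      Linear.units_smul_comp, h2, Functor.commShiftIso_hom_naturality_assoc,
      Iso.inv_hom_id_app_assoc, h5, h])

lemma reflect_app (H : D ⥤ E) [H.CommShift ℤ] [H.Additive] [H.Full] [H.Faithful]
    (u : GradedNatTrans (F ⋙ H) (G ⋙ H) a) (X : C) : ((u.reflect H).app X).map H = u.app X := by
  simp only [ShiftedHom.map, reflect, Functor.map_preimage, Category.assoc,
    Iso.inv_hom_id_app, Functor.comp_obj, Category.comp_id]

end GradedNatTrans
end

/-! ### Morphisms that commute, up to sign, with the action of graded endomorphisms. -/

section Intertwining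

variable [Preadditive D] [∀ n : ℤ, (shiftFunctor D n).Additive] {X : C}

/-- A family of maps from the graded endomorphisms of `X` to those of `W`. -/
abbrev GrEndMaps (X : C) (W : D) : Type _ := ∀ n : ℤ, ShiftedHom X X n → ShiftedHom W W n

/-- The action of a functor on graded endomorphisms. -/
def GrEndMaps.ofFunctor (F : C ⥤ D) [F.CommShift ℤ] (X : C) : GrEndMaps X (F.obj X) :=
  fun _ f => f.map F

/-- `g` commutes, up to the Koszul sign, with the actions `θ` and `θ'`. -/
def Intertwines {W W' : D} (θ : GrEndMaps X W) (θ' : GrEndMaps X W') {a : ℤ}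
    (g : ShiftedHom W W' a) : Prop :=
  ∀ (n c : ℤ) (f : ShiftedHom X X n) (h : a + n = c),
    (θ n f).comp g h = (a * n).negOnePow • g.comp (θ' n f) ((add_comm n a).trans h)

lemma ShiftedHom.comp_units_smul {X Y Z : D} {a b c : ℤ} (f : ShiftedHom X Y a)
    (g : ShiftedHom Y Z b) (h : b + a = c) (r : ℤˣ) : f.comp (r • g) h = r • f.comp g h := by
  rw [ShiftedHom.comp, ShiftedHom.comp, Functor.map_units_smul, Linear.units_smul_comp,
    Linear.comp_units_smul]

omit [∀ n : ℤ, (shiftFunctor D n).Additive] in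
lemma ShiftedHom.units_smul_comp {X Y Z : D} {a b c : ℤ} (f : ShiftedHom X Y a)
    (g : ShiftedHom Y Z b) (h : b + a = c) (r : ℤˣ) : (r • f).comp g h = r • f.comp g h := by
  rw [ShiftedHom.comp, ShiftedHom.comp, Linear.units_smul_comp]

omit [∀ n : ℤ, (shiftFunctor D n).Additive] [Preadditive D] in
lemma ShiftedHom.comp_left_cancel {X Y Z : D} {a b c : ℤ} (f : ShiftedHom X Y a) [IsIso f]
    {g g' : ShiftedHom Y Z b} (h : b + a = c) (hg : f.comp g h = f.comp g' h) : g = g' := by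
  rw [ShiftedHom.comp, ShiftedHom.comp, cancel_epi, cancel_mono] at hg
  exact (shiftFunctor D a).map_injective hg

omit [∀ n : ℤ, (shiftFunctor D n).Additive] [Preadditive D] in
lemma ShiftedHom.comp_right_cancel {X Y Z : D} {a b c : ℤ} {f f' : ShiftedHom X Y a}
    (g : ShiftedHom Y Z b) [IsIso g] (h : b + a = c) (hg : f.comp g h = f'.comp g h) :
    f = f' := by
  rwa [ShiftedHom.comp, ShiftedHom.comp, cancel_mono] at hg

instance {X Y Z : D} {a b c : ℤ} (f : ShiftedHom X Y a) (g : ShiftedHom Y Z b)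
    (h : b + a = c) [IsIso f] [IsIso g] : IsIso (f.comp g h) := by
  unfold ShiftedHom.comp; infer_instance

instance {X Y : D} (f : X ⟶ Y) [IsIso f] : IsIso (ShiftedHom.mk₀ (0 : ℤ) rfl f) := by
  unfold ShiftedHom.mk₀; infer_instance

instance {X Y : C} {a : ℤ} (f : ShiftedHom X Y a) [IsIso f] (F : C ⥤ D) [F.CommShift ℤ] :
    IsIso (f.map F) := by
  unfold ShiftedHom.map; infer_instance

namespace Intertwines

variable {W W' W'' : D} {θ : GrEndMaps X W} {θ' : GrEndMaps X W'} {θ'' : GrEndMaps X W''}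
  {a b c : ℤ}

/-- Moving `f` past the two factors in turn costs `(-1)^(an)` and `(-1)^(bn)`, whose product is the
sign for degree `a + b`. -/
lemma comp {g : ShiftedHom W W' a} {g' : ShiftedHom W' W'' b} (hg : Intertwines θ θ' g)
    (hg' : Intertwines θ' θ'' g') (h : b + a = c) : Intertwines θ θ'' (g.comp g' h) := by
  intro n d f hd
  rw [← ShiftedHom.comp_assoc _ _ _ (rfl : a + n = a + n) h (by lia), hg n _ f rfl,
    ShiftedHom.units_smul_comp, ShiftedHom.comp_assoc _ _ _ _ (rfl : b + n = b + n) (by lia),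
    hg' n _ f rfl, ShiftedHom.comp_units_smul, smul_smul, ← Int.negOnePow_add, ← add_mul,
    add_comm a b, h, ← ShiftedHom.comp_assoc _ _ _ h (add_comm n b) (by lia)]

/-- An intertwiner followed by an invertible intertwiner is one only if its first factor is. -/
lemma of_comp {g : ShiftedHom W W' a} {g' : ShiftedHom W' W'' b} [IsIso g'] (h : b + a = c)
    (hg : Intertwines θ θ'' (g.comp g' h)) (hg' : Intertwines θ' θ'' g') :
    Intertwines θ θ' g := by
  intro n d f hd
  refine ShiftedHom.comp_right_cancel g' (rfl : b + d = b + d) ?_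
  have h1 := hg n (b + d) f (by lia)
  rw [← ShiftedHom.comp_assoc _ _ _ hd h (by lia),
    ShiftedHom.comp_assoc _ _ _ h (add_comm n b) (by lia)] at h1
  rw [h1, ShiftedHom.units_smul_comp, ShiftedHom.comp_assoc _ _ _ _ rfl (by lia),
    hg' n _ f rfl, ShiftedHom.comp_units_smul, smul_smul, ← Int.negOnePow_add, ← h, add_mul, add_comm (b * n)]

end Intertwines

end Intertwining

end GradedNatTrans

/-! ### Lifting functors and graded transformations to the singularity category. -/

section SgLift

universe v' u' v'' u''

variable {C : Type u} [Category.{v} C] [Abelian C] {E : Type u'} [Category.{v'} E] [Abelian E]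
  {E' : Type u''} [Category.{v''} E'] [Abelian E']

variable (C) in
/-- The inclusion of the bounded derived category. -/
abbrev BoundedDerived.ι : BoundedDerived C ⥤ DerivedCategory C :=
  (DerivedCategory.TStructure.t (C := C)).bounded.ι

/-- Compatible lifts of an additive functor to the derived, bounded derived and
singularity categories. -/
structure SgLift (F : C ⥤ E) [F.Additive] where
  der : DerivedCategory C ⥤ DerivedCategory E
  [commShiftDer : der.CommShift ℤ]
  isoDer : DerivedCategory.Q ⋙ der ≅ F.mapHomologicalComplex (.up ℤ) ⋙ DerivedCategory.Q
  [commShift_isoDer : NatTrans.CommShift isoDer.hom ℤ]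
  bdd : BoundedDerived C ⥤ BoundedDerived E
  [commShiftBdd : bdd.CommShift ℤ]
  isoBdd : bdd ⋙ BoundedDerived.ι E ≅ BoundedDerived.ι C ⋙ der
  [commShift_isoBdd : NatTrans.CommShift isoBdd.hom ℤ]
  sg : Dsg C ⥤ Dsg E
  [commShiftSg : sg.CommShift ℤ]
  isoSg : (IsPerfectB C).trW.Q ⋙ sg ≅ bdd ⋙ (IsPerfectB E).trW.Q
  [commShift_isoSg : NatTrans.CommShift isoSg.hom ℤ]

namespace SgLift

attribute [instance] commShiftDer commShift_isoDer commShiftBdd commShift_isoBdd commShiftSg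
  commShift_isoSg

/-- The lift given by the functoriality of the singularity category. -/
def ofExact (F : C ⥤ E) [F.Additive] [PreservesFiniteLimits F] [PreservesFiniteColimits F]
    [F.PreservesProjectiveObjects] : SgLift F where
  der := F.mapDerivedCategory
  isoDer := F.mapDerivedCategoryFactors
  bdd := mapBoundedDerived F
  isoBdd := ObjectProperty.liftCompιIso _ _ _
  commShift_isoBdd := inferInstanceAs (NatTrans.CommShift (ObjectProperty.liftCompιIso _ _ _).hom ℤ)
  sg := mapDsg F
  isoSg := (CatCommSq.iso (sgLocalizerMorphism F).functor (IsPerfectB C).trW.Q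
    (IsPerfectB E).trW.Q ((sgLocalizerMorphism F).localizedFunctor _ _)).symm
  commShift_isoSg := inferInstanceAs (NatTrans.CommShift (CatCommSq.iso
    (sgLocalizerMorphism F).functor (IsPerfectB C).trW.Q
    (IsPerfectB E).trW.Q ((sgLocalizerMorphism F).localizedFunctor _ _)).symm.hom ℤ)

/-- A functor applied degreewise to complexes commutes with shifts by an isomorphism that is the
identity in every degree. Compatibility of degreewise transformations with shifts therefore reduces
to identities; the same holds for the next two instances. -/
instance (X : Type u) [Category.{v} X] [Preadditive X] :
    NatTrans.CommShift (Functor.mapHomologicalComplexIdIso X (.up ℤ)).hom ℤ where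
  shift_comm n := by
    ext K i
    change 𝟙 (K.X (i + n)) ≫ 𝟙 (K.X (i + n)) =
      𝟙 (K.X (i + n)) ≫ 𝟙 (K.X (i + n)) ≫ 𝟙 (K.X (i + n))
    simp only [Category.id_comp]

instance {F G : C ⥤ E} [F.Additive] [G.Additive] (τ : F ⟶ G) :
    NatTrans.CommShift (NatTrans.mapHomologicalComplex τ (.up ℤ)) ℤ where
  shift_comm n := by
    ext K i
    change 𝟙 _ ≫ τ.app _ = τ.app _ ≫ 𝟙 _
    rw [Category.id_comp, Category.comp_id]

instance (F : C ⥤ E) (H : E ⥤ E') [F.Additive] [H.Additive] : NatTrans.CommShift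
    (Functor.mapHomologicalComplexCompIso (Iso.refl (F ⋙ H)) (.up ℤ)).hom ℤ where
  shift_comm n := by
    ext K i
    rw [NatTrans.comp_app, NatTrans.comp_app, Functor.commShiftIso_comp_hom_app]
    change (H.map (𝟙 _) ≫ 𝟙 _) ≫ 𝟙 _ = 𝟙 _ ≫ 𝟙 _
    simp only [CategoryTheory.Functor.map_id, Category.id_comp]

/-- The lift of the identity functor. -/
def id : SgLift (𝟭 C) where
  der := 𝟭 _
  isoDer := Functor.rightUnitor _ ≪≫ (Functor.leftUnitor _).symm ≪≫
    Functor.isoWhiskerRight (Functor.mapHomologicalComplexIdIso C (.up ℤ)).symm _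
  commShift_isoDer := by dsimp; infer_instance
  bdd := 𝟭 _
  isoBdd := Functor.leftUnitor _ ≪≫ (Functor.rightUnitor _).symm
  commShift_isoBdd := by dsimp; infer_instance
  sg := 𝟭 _
  isoSg := Functor.rightUnitor _ ≪≫ (Functor.leftUnitor _).symm
  commShift_isoSg := by dsimp; infer_instance

/-- The lift of a composition of functors. -/
def comp {F : C ⥤ E} {H : E ⥤ E'} [F.Additive] [H.Additive] (S : SgLift F) (T : SgLift H) :
    SgLift (F ⋙ H) where
  der := S.der ⋙ T.der
  isoDer := (Functor.associator _ _ _).symm ≪≫ Functor.isoWhiskerRight S.isoDer _ ≪≫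
    Functor.associator _ _ _ ≪≫ Functor.isoWhiskerLeft _ T.isoDer ≪≫
    (Functor.associator _ _ _).symm ≪≫
    Functor.isoWhiskerRight (Functor.mapHomologicalComplexCompIso (Iso.refl _) (.up ℤ)) _
  commShift_isoDer := by dsimp; infer_instance
  bdd := S.bdd ⋙ T.bdd
  isoBdd := Functor.associator _ _ _ ≪≫ Functor.isoWhiskerLeft _ T.isoBdd ≪≫
    (Functor.associator _ _ _).symm ≪≫ Functor.isoWhiskerRight S.isoBdd _ ≪≫
    Functor.associator _ _ _
  commShift_isoBdd := by dsimp; infer_instance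
  sg := S.sg ⋙ T.sg
  isoSg := (Functor.associator _ _ _).symm ≪≫ Functor.isoWhiskerRight S.isoSg _ ≪≫
    Functor.associator _ _ _ ≪≫ Functor.isoWhiskerLeft _ T.isoSg ≪≫
    (Functor.associator _ _ _).symm
  commShift_isoSg := by dsimp; infer_instance

variable {F G : C ⥤ E} [F.Additive] [G.Additive] (S : SgLift F) (T : SgLift G) {a : ℤ}

/-- Lift of a graded natural transformation of functors on complexes. -/
def derNat (u : GradedNatTrans (F.mapHomologicalComplex (.up ℤ) ⋙ DerivedCategory.Q)
    (G.mapHomologicalComplex (.up ℤ) ⋙ DerivedCategory.Q) a) : GradedNatTrans S.der T.der a :=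
  (u.conj S.isoDer T.isoDer.symm).localize DerivedCategory.Q
    (HomologicalComplex.quasiIso C (.up ℤ))

/-- Lift of a graded natural transformation of functors on derived categories. -/
def bddNat (u : GradedNatTrans S.der T.der a) : GradedNatTrans S.bdd T.bdd a :=
  ((u.whiskerLeft (BoundedDerived.ι C)).conj S.isoBdd T.isoBdd.symm).reflect (BoundedDerived.ι E)

/-- Lift of a graded natural transformation of functors on bounded derived categories. -/
def sgNat (u : GradedNatTrans S.bdd T.bdd a) : GradedNatTrans S.sg T.sg a :=
  ((u.whiskerRight (IsPerfectB E).trW.Q).conj S.isoSg T.isoSg.symm).localize (IsPerfectB C).trW.Q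
    (IsPerfectB C).trW

lemma bddNat_app (u : GradedNatTrans S.der T.der a) (Z : BoundedDerived C) :
    ((S.bddNat T u).app Z).map (BoundedDerived.ι E) =
      S.isoBdd.hom.app Z ≫ u.app Z.obj ≫ (T.isoBdd.inv.app Z)⟦a⟧' := by
  rw [bddNat, GradedNatTrans.reflect_app]
  rfl

lemma sgNat_app (u : GradedNatTrans S.bdd T.bdd a) (Z : BoundedDerived C) :
    (S.sgNat T u).app ((IsPerfectB C).trW.Q.obj Z) =
      S.isoSg.hom.app Z ≫ (u.app Z).map (IsPerfectB E).trW.Q ≫ (T.isoSg.inv.app Z)⟦a⟧' := by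
  rw [sgNat, GradedNatTrans.localize_app]
  rfl

lemma derNat_app (u : GradedNatTrans (F.mapHomologicalComplex (.up ℤ) ⋙ DerivedCategory.Q)
    (G.mapHomologicalComplex (.up ℤ) ⋙ DerivedCategory.Q) a) (K : CochainComplex C ℤ) :
    (S.derNat T u).app (DerivedCategory.Q.obj K) =
      S.isoDer.hom.app K ≫ u.app K ≫ (T.isoDer.inv.app K)⟦a⟧' := by
  rw [derNat, GradedNatTrans.localize_app]
  rfl

variable (C) in
/-- An object of `C` as a bounded complex in degree `0`. -/
def toBounded : C ⥤ BoundedDerived C :=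
  ObjectProperty.lift _ (DerivedCategory.singleFunctor C 0) (fun X =>
    ⟨⟨0, (CochainComplex.singleFunctor C 0).obj X, Iso.refl _, inferInstance⟩,
      ⟨0, (CochainComplex.singleFunctor C 0).obj X, Iso.refl _, inferInstance⟩⟩)

/-- A lift of `F` agrees with `F` on complexes in degree `0`. -/
def singleDer (X : C) : S.der.obj ((DerivedCategory.singleFunctor C 0).obj X) ≅
    (DerivedCategory.singleFunctor E 0).obj (F.obj X) :=
  S.isoDer.app ((HomologicalComplex.single C (.up ℤ) 0).obj X) ≪≫
    DerivedCategory.Q.mapIso ((HomologicalComplex.singleMapHomologicalComplex F (.up ℤ) 0).app X)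

/-- A lift of `F` agrees with `F` on complexes in degree `0`. -/
def singleBdd (X : C) : S.bdd.obj ((toBounded C).obj X) ≅ (toBounded E).obj (F.obj X) :=
  (BoundedDerived.ι E).preimageIso (S.isoBdd.app ((toBounded C).obj X) ≪≫ S.singleDer X)

/-- A lift of `F` agrees with `F` on complexes in degree `0`. -/
def singleSg (X : C) : S.sg.obj (toDsg.obj X) ≅ toDsg.obj (F.obj X) :=
  S.isoSg.app ((toBounded C).obj X) ≪≫ (IsPerfectB E).trW.Q.mapIso (S.singleBdd X)

/-- A natural transformation on bounded derived categories. -/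
def bddOfNatTrans (τ : F ⟶ G) : GradedNatTrans S.bdd T.bdd 0 :=
  S.bddNat T (S.derNat T (.ofNatTrans
    (Functor.whiskerRight (NatTrans.mapHomologicalComplex τ (.up ℤ)) DerivedCategory.Q)))

lemma _root_.ShiftedHom.conj_mk₀ {D : Type*} [Category* D] [HasShift D ℤ] {X Y Z W : D}
    (f : X ⟶ Y) (g : Y ⟶ Z) (h : Z ⟶ W) :
    f ≫ ShiftedHom.mk₀ (0 : ℤ) rfl g ≫ h⟦(0 : ℤ)⟧' = ShiftedHom.mk₀ 0 rfl (f ≫ g ≫ h) := by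
  rw [← ShiftedHom.comp_mk₀ _ 0 rfl, ← ShiftedHom.mk₀_comp 0 rfl, ShiftedHom.mk₀_comp_mk₀,
    ShiftedHom.mk₀_comp_mk₀]

lemma mapHomologicalComplex_app_single (τ : F ⟶ G) (X : C) :
    (NatTrans.mapHomologicalComplex τ (.up ℤ)).app ((HomologicalComplex.single C (.up ℤ) 0).obj X) ≫
      (HomologicalComplex.singleMapHomologicalComplex G (.up ℤ) 0).hom.app X =
    (HomologicalComplex.singleMapHomologicalComplex F (.up ℤ) 0).hom.app X ≫
      (HomologicalComplex.single E (.up ℤ) 0).map (τ.app X) := by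
  refine HomologicalComplex.to_single_hom_ext ?_
  simp [HomologicalComplex.single_map_f_self]
  erw [Category.assoc, Iso.inv_hom_id_assoc, τ.naturality_assoc]
  rfl

lemma derOfNatTrans_app (τ : F ⟶ G) (X : C) :
    (S.derNat T (.ofNatTrans (Functor.whiskerRight (NatTrans.mapHomologicalComplex τ (.up ℤ))
      DerivedCategory.Q))).app ((DerivedCategory.singleFunctor C 0).obj X) =
      ShiftedHom.mk₀ 0 rfl ((S.singleDer X).hom ≫
        (DerivedCategory.singleFunctor E 0).map (τ.app X) ≫ (T.singleDer X).inv) := by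
  change (S.derNat T _).app (DerivedCategory.Q.obj
    ((HomologicalComplex.single C (.up ℤ) 0).obj X)) = _
  rw [derNat_app]
  refine (ShiftedHom.conj_mk₀ _ _ _).trans (congrArg _ ?_)
  have key : DerivedCategory.Q.map ((NatTrans.mapHomologicalComplex τ (.up ℤ)).app
      ((HomologicalComplex.single C (.up ℤ) 0).obj X)) =
      DerivedCategory.Q.map ((HomologicalComplex.singleMapHomologicalComplex F _ 0).hom.app X) ≫
      DerivedCategory.Q.map ((HomologicalComplex.single E (.up ℤ) 0).map (τ.app X)) ≫
      DerivedCategory.Q.map ((HomologicalComplex.singleMapHomologicalComplex G _ 0).inv.app X) := by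
    rw [← Functor.map_comp, ← Functor.map_comp, ← Category.assoc,
      ← mapHomologicalComplex_app_single, Category.assoc, Iso.hom_inv_id_app]
    exact congrArg _ (Category.comp_id _).symm
  refine (congrArg (fun f => S.isoDer.hom.app _ ≫ f ≫ T.isoDer.inv.app _) key).trans ?_
  simp only [Category.assoc]
  exact (Category.assoc _ _ _).symm

/-- Faithfulness of the inclusion, for morphisms of any degree: identities in the bounded derived
category may be tested in the derived category. -/
lemma _root_.BoundedDerived.map_ι_injective {Y Z : BoundedDerived E} {a : ℤ} :
    Function.Injective (fun f : ShiftedHom Y Z a => f.map (BoundedDerived.ι E)) := by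
  intro f g hfg
  simp only [ShiftedHom.map, cancel_mono] at hfg
  exact (BoundedDerived.ι E).map_injective hfg

lemma bddOfNatTrans_app (τ : F ⟶ G) (X : C) :
    (S.bddOfNatTrans T τ).app ((toBounded C).obj X) =
      ShiftedHom.mk₀ 0 rfl ((S.singleBdd X).hom ≫ (toBounded E).map (τ.app X) ≫
        (T.singleBdd X).inv) := by
  apply BoundedDerived.map_ι_injective
  dsimp only
  rw [bddOfNatTrans, bddNat_app, ShiftedHom.map_mk₀]
  refine (congrArg (fun f => _ ≫ f ≫ _) (S.derOfNatTrans_app T τ X)).trans ?_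
  refine (ShiftedHom.conj_mk₀ _ _ _).trans (congrArg _ ?_)
  simp only [Functor.map_comp, singleBdd, Functor.preimageIso_hom,
    Functor.preimageIso_inv, Functor.map_preimage]
  have assoc {D : Type max v' u'} [Category.{max v' u'} D] {X₁ X₂ X₃ X₄ X₅ X₆ : D} (f₁ : X₁ ⟶ X₂) (f₂ : X₂ ⟶ X₃)
      (f₃ : X₃ ⟶ X₄) (f₄ : X₄ ⟶ X₅) (f₅ : X₅ ⟶ X₆) :
      f₁ ≫ (f₂ ≫ f₃ ≫ f₄) ≫ f₅ = (f₁ ≫ f₂) ≫ f₃ ≫ f₄ ≫ f₅ := by simp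
  exact assoc (D := DerivedCategory E) _ _ _ _ _

/-- Makes invertibility at `X` visible: the component is invertible as soon as `toDsg.map (τ.app X)`
is, even if `τ` itself is far from invertible. -/
lemma sgOfNatTrans_app (τ : F ⟶ G) (X : C) :
    (S.sgNat T (S.bddOfNatTrans T τ)).app (toDsg.obj X) =
      ShiftedHom.mk₀ 0 rfl ((S.singleSg X).hom ≫ toDsg.map (τ.app X) ≫
        (T.singleSg X).inv) := by
  change (S.sgNat T _).app ((IsPerfectB C).trW.Q.obj ((toBounded C).obj X)) = _
  rw [sgNat_app, bddOfNatTrans_app, ShiftedHom.map_mk₀, ShiftedHom.conj_mk₀]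
  refine congrArg _ ?_
  simp only [Functor.map_comp, Category.assoc]
  exact (Category.assoc _ _ _).symm

end SgLift

end SgLift

/-! ### Connecting morphisms as transformations of degree one. -/

section Connecting

lemma distinguished_of_iso {D : Type*} [Category* D] [Preadditive D] [HasZeroObject D]
    [HasShift D ℤ] [∀ n : ℤ, (shiftFunctor D n).Additive] [Pretriangulated D]
    {X₁ X₂ X₃ Y₁ Y₂ Y₃ : D} {f : X₁ ⟶ X₂} {g : X₂ ⟶ X₃} {h : X₃ ⟶ X₁⟦(1 : ℤ)⟧}
    (hT : Triangle.mk f g h ∈ distTriang D) (e₁ : Y₁ ≅ X₁) (e₂ : Y₂ ≅ X₂) (e₃ : Y₃ ≅ X₃)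
    {f' : Y₁ ⟶ Y₂} {g' : Y₂ ⟶ Y₃} {h' : Y₃ ⟶ Y₁⟦(1 : ℤ)⟧} (hf : f' ≫ e₂.hom = e₁.hom ≫ f)
    (hg : g' ≫ e₃.hom = e₂.hom ≫ g) (hh : h' ≫ e₁.hom⟦(1 : ℤ)⟧' = e₃.hom ≫ h) :
    Triangle.mk f' g' h' ∈ distTriang D :=
  isomorphic_distinguished _ hT _ (Triangle.isoMk _ _ e₁ e₂ e₃ hf hg hh)

universe v' u'

variable {C : Type u} [Category.{v} C] [Abelian C] {E : Type u'} [Category.{v'} E] [Abelian E]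

open DerivedCategory

/-- This is the third square of `shiftTriangleIso`. Shifting a triangle multiplies its morphisms by
`(-1)^n`, and the comparison with the triangle of `φ⟦n⟧'` is the identity on the shift of `K`, so
nothing absorbs the sign. -/
lemma CochainComplex.mappingCone.shiftIso_hom_mor₃ {K L : CochainComplex C ℤ} (φ : K ⟶ L) (n : ℤ) :
    (shiftIso φ n).hom ≫ (triangle (φ⟦n⟧')).mor₃ =
      n.negOnePow • ((triangle φ).mor₃⟦n⟧' ≫ (shiftFunctorComm _ 1 n).hom.app K) := by
  have h2 : (𝟙 (K⟦n⟧))⟦(1 : ℤ)⟧' = 𝟙 _ := CategoryTheory.Functor.map_id _ _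
  refine (shiftTriangleIso φ n).hom.comm₃.symm.trans ?_
  exact (congrArg (_ ≫ ·) h2).trans (Category.comp_id _)

section

variable {K₁ K₂ K₃ : CochainComplex C ℤ} {f : K₁ ⟶ K₂} {g : K₂ ⟶ K₃} {w : f ≫ g = 0}

open CochainComplex.mappingCone in
-- No sign appears here: `shiftIso` changes the sign only on the part of the cone coming from `K₁`,
-- which the map to `K₃` kills.
lemma CochainComplex.mappingCone.shiftIso_hom_descShortComplex (n : ℤ)
    (w' : f⟦n⟧' ≫ g⟦n⟧' = 0) :
    (shiftIso f n).hom ≫ descShortComplex (ShortComplex.mk (f⟦n⟧') (g⟦n⟧') w') =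
      (descShortComplex (ShortComplex.mk f g w))⟦n⟧' := by
  symm
  rw [← Iso.inv_comp_eq]
  ext p
  rw [ext_from_iff _ (p + 1) _ rfl]
  constructor
  · have h1 : (inl (f⟦n⟧')).v (p + 1) p (by lia) ≫ (shiftIso f n).inv.f p =
        n.negOnePow • (inl f).v (p + 1 + n) (p + n) (by lia) := by
      simp only [shiftIso, inl_v_desc_f, HomComplex.Cochain.units_smul_v,
        HomComplex.Cochain.shift_v']
      rfl
    have h2 : (inl f).v (p + 1 + n) (p + n) (by lia) ≫
        (descShortComplex (ShortComplex.mk f g w)).f (p + n) = 0 :=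
      (inl_v_desc_f f _ _ _ _ _ _).trans (HomComplex.Cochain.zero_v _ _ _)
    have h3 : (inl (f⟦n⟧')).v (p + 1) p (by lia) ≫
        (descShortComplex (ShortComplex.mk (f⟦n⟧') (g⟦n⟧') w')).f p = 0 :=
      (inl_v_desc_f (f⟦n⟧') _ _ _ _ _ _).trans (HomComplex.Cochain.zero_v _ _ _)
    refine (Category.assoc _ _ _).symm.trans ((congrArg (· ≫
      (descShortComplex (ShortComplex.mk f g w)).f (p + n)) h1).trans ?_)
    exact (Linear.units_smul_comp _ _ _).trans ((congrArg (n.negOnePow • ·) h2).trans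
      ((smul_zero _).trans h3.symm))
  · have h1 : (inr (f⟦n⟧')).f p ≫ (shiftIso f n).inv.f p = (inr f).f (p + n) := by
      simp only [shiftIso, inr_f_desc_f]
      rfl
    refine (Category.assoc _ _ _).symm.trans ((congrArg (· ≫
      (descShortComplex (ShortComplex.mk f g w)).f (p + n)) h1).trans ?_)
    have h3 : (inr (f⟦n⟧')).f p ≫
        (descShortComplex (ShortComplex.mk (f⟦n⟧') (g⟦n⟧') w')).f p = g.f (p + n) :=
      inr_f_desc_f (f⟦n⟧') _ _ _ _
    exact (inr_f_desc_f f _ _ _ _).trans h3.symm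

/-- The connecting morphism of a short exact sequence of complexes. -/
def connecting (h : (ShortComplex.mk f g w).ShortExact) : Q.obj K₃ ⟶ (Q.obj K₁)⟦(1 : ℤ)⟧ :=
  triangleOfSESδ h

/-- The connecting morphism is the roof `K₃ ← cone f → K₁⟦1⟧`. The left leg, a quasi-isomorphism, is
compatible with shifts on the nose, while the right leg contributes `(-1)^n`. -/
lemma connecting_shift (h : (ShortComplex.mk f g w).ShortExact) (n : ℤ)
    {w' : f⟦n⟧' ≫ g⟦n⟧' = 0} (h' : (ShortComplex.mk (f⟦n⟧') (g⟦n⟧') w').ShortExact) :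
    connecting h' ≫ ((Q.commShiftIso n).hom.app K₁)⟦(1 : ℤ)⟧' =
      n.negOnePow • ((Q.commShiftIso n).hom.app K₃ ≫ (connecting h)⟦n⟧' ≫
        (shiftFunctorComm _ 1 n).hom.app (Q.obj K₁)) := by
  have hq := CochainComplex.mappingCone.quasiIso_descShortComplex h'
  let d : CochainComplex.mappingCone f ⟶ K₃ :=
    CochainComplex.mappingCone.descShortComplex (ShortComplex.mk f g w)
  let d' : CochainComplex.mappingCone (f⟦n⟧') ⟶ K₃⟦n⟧ :=
    CochainComplex.mappingCone.descShortComplex (ShortComplex.mk (f⟦n⟧') (g⟦n⟧') w')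
  have hq' : IsIso (Q.map d') := by
    have : QuasiIso d' := hq
    infer_instance
  let m : CochainComplex.mappingCone f ⟶ K₁⟦(1 : ℤ)⟧ :=
    (CochainComplex.mappingCone.triangle f).mor₃
  let m' : CochainComplex.mappingCone (f⟦n⟧') ⟶ (K₁⟦n⟧)⟦(1 : ℤ)⟧ :=
    (CochainComplex.mappingCone.triangle (f⟦n⟧')).mor₃
  have h1 : Q.map d' ≫ connecting h' = Q.map m' ≫ (Q.commShiftIso 1).hom.app _ :=
    descShortComplex_triangleOfSESδ h'
  have h2 : Q.map d ≫ connecting h = Q.map m ≫ (Q.commShiftIso 1).hom.app _ :=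
    descShortComplex_triangleOfSESδ h
  have h3 := Q.map_shiftFunctorComm_hom_app K₁ 1 n
  have h4 : Q.map (CochainComplex.mappingCone.shiftIso f n).hom ≫ Q.map d' = Q.map (d⟦n⟧') := by
    rw [← Functor.map_comp]
    exact congrArg Q.map (CochainComplex.mappingCone.shiftIso_hom_descShortComplex n w')
  have h5 : Q.map (CochainComplex.mappingCone.shiftIso f n).hom ≫ Q.map m' =
      n.negOnePow • (Q.map (m⟦n⟧') ≫ Q.map ((shiftFunctorComm _ 1 n).hom.app K₁)) := by
    rw [← Functor.map_comp, ← Functor.map_comp, ← Functor.map_units_smul]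
    exact congrArg Q.map (CochainComplex.mappingCone.shiftIso_hom_mor₃ f n)
  have h6 : Q.map (d⟦n⟧') ≫ (Q.commShiftIso n).hom.app K₃ ≫ (connecting h)⟦n⟧' =
      Q.map (m⟦n⟧') ≫ (Q.commShiftIso n).hom.app _ ≫ ((Q.commShiftIso 1).hom.app K₁)⟦n⟧' := by
    rw [Functor.commShiftIso_hom_naturality_assoc, ← Functor.map_comp, h2, Functor.map_comp,
      ← Functor.commShiftIso_hom_naturality_assoc]
  have h7 : ((Q.commShiftIso n).inv.app K₁)⟦(1 : ℤ)⟧' ≫ ((Q.commShiftIso n).hom.app K₁)⟦(1 : ℤ)⟧'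
      = 𝟙 _ := by
    rw [← Functor.map_comp, Iso.inv_hom_id_app, CategoryTheory.Functor.map_id]
  -- Both sides are precomposed with the invertible images of `d'` and of `shiftIso`, which turns
  -- the connecting morphisms into the explicit maps out of the cones.
  rw [← cancel_epi (Q.map d'), ← cancel_epi (Q.map
      (CochainComplex.mappingCone.shiftIso f n).hom), reassoc_of% h1, reassoc_of% h5,
      Linear.comp_units_smul, Linear.comp_units_smul, reassoc_of% h4, h3, reassoc_of% h6]
  simp only [Linear.units_smul_comp, Category.assoc, Iso.inv_hom_id_app_assoc, h7]
  simp

end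

variable {F₁ F₂ F₃ : C ⥤ E} [F₁.Additive] [F₂.Additive] [F₃.Additive] (i : F₁ ⟶ F₂) (p : F₂ ⟶ F₃)

/-- A short exact sequence of functors. -/
structure IsFunctorSES : Prop where
  zero (X : C) : i.app X ≫ p.app X = 0
  shortExact (X : C) : (ShortComplex.mk (i.app X) (p.app X) (zero X)).ShortExact

namespace IsFunctorSES

variable {i p} (h : IsFunctorSES i p)
include h

lemma map_zero (K : CochainComplex C ℤ) : (NatTrans.mapHomologicalComplex i (.up ℤ)).app K ≫
    (NatTrans.mapHomologicalComplex p (.up ℤ)).app K = 0 := by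
  ext n
  exact h.zero _

lemma map_shortExact (K : CochainComplex C ℤ) : (ShortComplex.mk _ _ (h.map_zero K)).ShortExact :=
  HomologicalComplex.shortExact_of_degreewise_shortExact _ (fun _ => h.shortExact _)

/-- The connecting morphism of a short exact sequence of functors. -/
def chNat : GradedNatTrans (F₃.mapHomologicalComplex (.up ℤ) ⋙ Q)
    (F₁.mapHomologicalComplex (.up ℤ) ⋙ Q) 1 where
  app K := connecting (h.map_shortExact K)
  naturality {K L} f := (triangleOfSESδ_naturality (h.map_shortExact K) (h.map_shortExact L)
    { τ₁ := (F₁.mapHomologicalComplex _).map f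
      τ₂ := (F₂.mapHomologicalComplex _).map f
      τ₃ := (F₃.mapHomologicalComplex _).map f }).symm
  shift n K := by
    have hw := (h.map_zero K)
    let i' := (NatTrans.mapHomologicalComplex i (.up ℤ)).app K
    let p' := (NatTrans.mapHomologicalComplex p (.up ℤ)).app K
    have hw' : i'⟦n⟧' ≫ p'⟦n⟧' = 0 := by
      rw [← Functor.map_comp]
      exact (congrArg (fun f => f⟦n⟧') hw).trans ((shiftFunctor _ n).map_zero _ _)
    have h' : (ShortComplex.mk (i'⟦n⟧') (p'⟦n⟧') hw').ShortExact :=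
      HomologicalComplex.shortExact_of_degreewise_shortExact _ (fun _ => h.shortExact _)
    have h1 := triangleOfSESδ_naturality (h.map_shortExact (K⟦n⟧)) h'
      { τ₁ := ((F₁.mapHomologicalComplex _).commShiftIso n).hom.app K
        τ₂ := ((F₂.mapHomologicalComplex _).commShiftIso n).hom.app K
        τ₃ := ((F₃.mapHomologicalComplex _).commShiftIso n).hom.app K
        comm₁₂ := (NatTrans.shift_app_comm (NatTrans.mapHomologicalComplex i (.up ℤ)) n K)
        comm₂₃ := (NatTrans.shift_app_comm (NatTrans.mapHomologicalComplex p (.up ℤ)) n K) }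
    have h2 := connecting_shift (h.map_shortExact K) n h'
    have h3 : connecting (h.map_shortExact (K⟦n⟧)) ≫
        (Q.map (((F₁.mapHomologicalComplex _).commShiftIso n).hom.app K))⟦(1 : ℤ)⟧' =
      Q.map (((F₃.mapHomologicalComplex _).commShiftIso n).hom.app K) ≫ connecting h' := h1
    rw [Functor.commShiftIso_comp_hom_app, Functor.commShiftIso_comp_hom_app, Functor.map_comp,
      reassoc_of% h3, h2, one_mul, Linear.comp_units_smul, Category.assoc]
    rfl

lemma chNat_triangle (K : CochainComplex C ℤ) :
    Triangle.mk (Q.map ((NatTrans.mapHomologicalComplex i (.up ℤ)).app K))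
      (Q.map ((NatTrans.mapHomologicalComplex p (.up ℤ)).app K)) (h.chNat.app K) ∈
      distTriang (DerivedCategory E) :=
  triangleOfSES_distinguished (h.map_shortExact K)

end IsFunctorSES

namespace SgLift

variable {i p} (S₃ : SgLift F₃) (S₁ : SgLift F₁) (S₂ : SgLift F₂) (h : IsFunctorSES i p)

/-- The connecting morphism of a short exact sequence of functors. -/
def derConnecting : GradedNatTrans S₃.der S₁.der 1 := S₃.derNat S₁ h.chNat

/-- The connecting morphism of a short exact sequence of functors. -/
def bddConnecting : GradedNatTrans S₃.bdd S₁.bdd 1 := S₃.bddNat S₁ (S₃.derConnecting S₁ h)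

-- Every object of the derived category is the image of a complex, where the triangle is the one
-- attached to a short exact sequence of complexes; naturality of the connecting morphism transports
-- it to `Z`.
include S₂ in
lemma derConnecting_triangle (Z : DerivedCategory C) :
    ∃ (f : S₁.der.obj Z ⟶ S₂.der.obj Z) (g : S₂.der.obj Z ⟶ S₃.der.obj Z),
      Triangle.mk f g ((S₃.derConnecting S₁ h).app Z) ∈ distTriang (DerivedCategory E) := by
  let K := Q.objPreimage Z
  let e : Q.obj K ≅ Z := Q.objObjPreimageIso Z
  let e₁ := S₁.isoDer.symm.app K ≪≫ S₁.der.mapIso e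
  let e₂ := S₂.isoDer.symm.app K ≪≫ S₂.der.mapIso e
  let e₃ := S₃.isoDer.symm.app K ≪≫ S₃.der.mapIso e
  refine ⟨e₁.inv ≫ Q.map ((NatTrans.mapHomologicalComplex i (.up ℤ)).app K) ≫ e₂.hom,
    e₂.inv ≫ Q.map ((NatTrans.mapHomologicalComplex p (.up ℤ)).app K) ≫ e₃.hom,
    distinguished_of_iso (h.chNat_triangle K) e₁.symm e₂.symm e₃.symm (by simp) (by simp) ?_⟩
  have h1 := (S₃.derConnecting S₁ h).naturality e.hom
  have h2 := S₃.derNat_app S₁ h.chNat K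
  have h3 : e₃.hom ≫ (S₃.derConnecting S₁ h).app Z = h.chNat.app K ≫ e₁.hom⟦(1 : ℤ)⟧' := by
    change (S₃.isoDer.inv.app K ≫ S₃.der.map e.hom) ≫ _ =
      _ ≫ (S₁.isoDer.inv.app K ≫ S₁.der.map e.hom)⟦(1 : ℤ)⟧'
    rw [Category.assoc, h1, derConnecting, h2]
    simp only [Functor.map_comp, Category.assoc, Iso.inv_hom_id_app_assoc]
  rw [Iso.symm_hom, Iso.symm_hom, Iso.eq_inv_comp, reassoc_of% h3, ← Functor.map_comp,
    Iso.hom_inv_id, CategoryTheory.Functor.map_id, Category.comp_id]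

/-- Distinguished triangles of the bounded derived category are detected in the derived category,
where `derConnecting_triangle` applies. -/
lemma bddConnecting_triangle (Z : BoundedDerived C) :
    ∃ (f : S₁.bdd.obj Z ⟶ S₂.bdd.obj Z) (g : S₂.bdd.obj Z ⟶ S₃.bdd.obj Z),
      Triangle.mk f g ((S₃.bddConnecting S₁ h).app Z) ∈ distTriang (BoundedDerived E) := by
  obtain ⟨f, g, hT⟩ := S₃.derConnecting_triangle S₁ S₂ h Z.obj
  let e₁ : (BoundedDerived.ι E).obj (S₁.bdd.obj Z) ≅ S₁.der.obj Z.obj := S₁.isoBdd.app Z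
  let e₂ : (BoundedDerived.ι E).obj (S₂.bdd.obj Z) ≅ S₂.der.obj Z.obj := S₂.isoBdd.app Z
  let e₃ : (BoundedDerived.ι E).obj (S₃.bdd.obj Z) ≅ S₃.der.obj Z.obj := S₃.isoBdd.app Z
  refine ⟨(BoundedDerived.ι E).preimage (e₁.hom ≫ f ≫ e₂.inv),
    (BoundedDerived.ι E).preimage (e₂.hom ≫ g ≫ e₃.inv), ?_⟩
  rw [← (BoundedDerived.ι E).map_distinguished_iff]
  refine distinguished_of_iso hT e₁ e₂ e₃ ?_ ?_ ?_
  · exact (congrArg (· ≫ e₂.hom) ((BoundedDerived.ι E).map_preimage (e₁.hom ≫ f ≫ e₂.inv))).trans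
      (by simp only [Category.assoc, Iso.inv_hom_id, Category.comp_id])
  · exact (congrArg (· ≫ e₃.hom) ((BoundedDerived.ι E).map_preimage (e₂.hom ≫ g ≫ e₃.inv))).trans
      (by simp only [Category.assoc, Iso.inv_hom_id, Category.comp_id])
  · refine (congrArg (· ≫ e₁.hom⟦(1 : ℤ)⟧') (S₃.bddNat_app S₁ (S₃.derConnecting S₁ h) Z)).trans ?_
    have h1 : (e₁.inv)⟦(1 : ℤ)⟧' ≫ e₁.hom⟦(1 : ℤ)⟧' = 𝟙 _ := by
      rw [← Functor.map_comp, Iso.inv_hom_id, CategoryTheory.Functor.map_id]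
    have h2 := (e₃.hom ≫ (S₃.derConnecting S₁ h).app Z.obj) ≫= h1
    rw [Category.comp_id] at h2
    refine Eq.trans ?_ h2
    have assoc {D : Type max v' u'} [Category.{max v' u'} D] {X₁ X₂ X₃ X₄ X₅ : D} (f₁ : X₁ ⟶ X₂)
        (f₂ : X₂ ⟶ X₃) (f₃ : X₃ ⟶ X₄) (f₄ : X₄ ⟶ X₅) :
        (f₁ ≫ f₂ ≫ f₃) ≫ f₄ = (f₁ ≫ f₂) ≫ f₃ ≫ f₄ := by simp
    exact assoc (D := DerivedCategory E) _ _ _ _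

end SgLift

end Connecting

/-! ### Vanishing of morphisms out of perfect complexes. -/

section Vanishing

variable {C : Type u} [Category.{v} C] [Abelian C]

/-- Bounded complexes of projectives are K-projective, so `f` is represented by a map of complexes,
and complexes without a common nonzero degree have only the zero map between them. -/
lemma DerivedCategory.hom_eq_zero_of_isBoundedProjective {K L : CochainComplex C ℤ}
    (hK : IsBoundedProjective K) (h : ∀ i, IsZero (K.X i) ∨ IsZero (L.X i))
    (f : DerivedCategory.Q.obj K ⟶ DerivedCategory.Q.obj L) : f = 0 := by
  have := hK.isKProjective
  obtain ⟨g, hg⟩ := (CochainComplex.IsKProjective.Qh_map_bijective K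
      ((HomotopyCategory.quotient _ _).obj L)).surjective
      ((DerivedCategory.quotientCompQhIso C).hom.app K ≫ f ≫
        (DerivedCategory.quotientCompQhIso C).inv.app L)
  obtain ⟨φ, rfl⟩ := (HomotopyCategory.quotient _ _).map_surjective g
  obtain rfl : φ = 0 := by
    ext i
    rcases h i with h | h
    · exact h.eq_of_src _ _
    · exact h.eq_of_tgt _ _
  rw [Functor.map_zero, Functor.map_zero] at hg
  rw [← cancel_epi ((DerivedCategory.quotientCompQhIso C).hom.app K),
    ← cancel_mono ((DerivedCategory.quotientCompQhIso C).inv.app L), Category.assoc, ← hg,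
    comp_zero, zero_comp]

/-- The cohomological degree of `X⟦m⟧` is `-m`. -/
def singleShiftIso (X : C) (m : ℤ) : ((DerivedCategory.singleFunctor C 0).obj X)⟦m⟧ ≅
    DerivedCategory.Q.obj (((HomologicalComplex.single C (.up ℤ) 0).obj X)⟦m⟧) :=
  ((DerivedCategory.Q.commShiftIso m).app ((HomologicalComplex.single C (.up ℤ) 0).obj X)).symm

lemma isZero_single_shift (X : C) (m i : ℤ) (h : i + m ≠ 0) :
    IsZero ((((HomologicalComplex.single C (.up ℤ) 0).obj X)⟦m⟧).X i) :=
  HomologicalComplex.isZero_single_obj_X (.up ℤ) 0 X (i + m) h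

lemma isBoundedProjective_single (P : C) [Projective P] :
    IsBoundedProjective ((CochainComplex.singleFunctor C 0).obj P) where
  bounded := ⟨0, 0, inferInstance, inferInstance⟩
  projective n := by
    by_cases hn : n = 0
    · subst hn
      exact Projective.of_iso
        (HomologicalComplex.singleObjXSelf (.up ℤ) 0 P).symm inferInstance
    · exact (HomologicalComplex.isZero_single_obj_X (.up ℤ) 0 P n hn).projective

lemma isPerfectB_toBounded (P : C) [Projective P] :
    IsPerfectB C ((SgLift.toBounded C).obj P) :=
  ⟨_, isBoundedProjective_single P, ⟨Iso.refl _⟩⟩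

/-- `singleShiftIso` for the bounded derived category. -/
def BoundedDerived.shiftIso (X : C) (m : ℤ) :
    (BoundedDerived.ι C).obj (((SgLift.toBounded C).obj X)⟦m⟧) ≅
    DerivedCategory.Q.obj (((HomologicalComplex.single C (.up ℤ) 0).obj X)⟦m⟧) :=
  ((BoundedDerived.ι C).commShiftIso m).app _ ≪≫ singleShiftIso X m

/-- The complex `P` sits in degree `0` and `X⟦m⟧` in degree `-m`. The sign of `m` does not matter.
-/
lemma BoundedDerived.hom_projective_eq_zero (P X : C) [Projective P] {m : ℤ} (hm : m ≠ 0)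
    (f : (SgLift.toBounded C).obj P ⟶ ((SgLift.toBounded C).obj X)⟦m⟧) : f = 0 := by
  have key (g : DerivedCategory.Q.obj ((CochainComplex.singleFunctor C 0).obj P) ⟶
      DerivedCategory.Q.obj (((HomologicalComplex.single C (.up ℤ) 0).obj X)⟦m⟧)) : g = 0 :=
    DerivedCategory.hom_eq_zero_of_isBoundedProjective (isBoundedProjective_single P) (fun i => by
      by_cases hi : i = 0
      · exact Or.inr (isZero_single_shift X m i (by lia))
      · exact Or.inl (HomologicalComplex.isZero_single_obj_X (.up ℤ) 0 P i hi)) g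
  refine (BoundedDerived.ι C).map_injective ?_
  rw [← cancel_mono (BoundedDerived.shiftIso X m).hom]
  exact (key _).trans (key _).symm

lemma BoundedDerived.exists_hom_perfect_eq_zero {K : BoundedDerived C} (hK : IsPerfectB C K) :
    ∃ d : ℤ, ∀ (m : ℤ) (_ : d ≤ m) (X : C)
      (f : K ⟶ ((SgLift.toBounded C).obj X)⟦m⟧), f = 0 := by
  obtain ⟨L, hL, ⟨e⟩⟩ := hK
  obtain ⟨a, b, ha, hb⟩ := hL.bounded
  -- The complex `L` lives in degrees at least `a`, and `X⟦m⟧` sits in degree `-m`, which is below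
  -- `a` once `m ≥ 1 - a`. The bound does not depend on `X`.
  refine ⟨1 - a, fun m hm X f => ?_⟩
  have key (g : DerivedCategory.Q.obj L ⟶
      DerivedCategory.Q.obj (((HomologicalComplex.single C (.up ℤ) 0).obj X)⟦m⟧)) : g = 0 :=
    DerivedCategory.hom_eq_zero_of_isBoundedProjective hL (fun i => by
      by_cases hi : i + m = 0
      · exact Or.inl (L.isZero_of_isStrictlyGE a i (by lia))
      · exact Or.inr (isZero_single_shift X m i hi)) g
  refine (BoundedDerived.ι C).map_injective ?_
  rw [← cancel_mono (BoundedDerived.shiftIso X m).hom,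
    ← cancel_epi e.inv]
  exact (key _).trans (key _).symm

/-- Used for morphisms of degree `0` between syzygies: in the bounded derived category these are
honest morphisms of `C`. -/
instance : (SgLift.toBounded C).Full where
  map_surjective f := by
    obtain ⟨g, hg⟩ := (DerivedCategory.singleFunctor C 0).map_surjective
      ((BoundedDerived.ι C).map f)
    exact ⟨g, (BoundedDerived.ι C).map_injective hg⟩

end Vanishing

/-! ### Shifted morphisms as fractions, and their passage to the singularity category. -/

lemma ShiftedHom.exists_map_comp_eq_map {C D : Type*} [Category* C] [Category* D] [HasShift C ℤ]
    [HasShift D ℤ] (L : C ⥤ D) (W : MorphismProperty C) [L.IsLocalization W] [L.CommShift ℤ]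
    [W.HasRightCalculusOfFractions] {X Y : C} {n : ℤ}
    (g : ShiftedHom (L.obj X) (L.obj Y) n) :
    ∃ (Z : C) (s : Z ⟶ X) (_ : W s) (g₀ : ShiftedHom Z Y n), L.map s ≫ g = g₀.map L := by
  obtain ⟨φ, hφ⟩ := Localization.exists_rightFraction L W (g ≫ (L.commShiftIso n).inv.app Y)
  refine ⟨_, φ.s, φ.hs, φ.f, ?_⟩
  have h := φ.map_s_comp_map L (Localization.inverts L W)
  rw [← hφ] at h
  simp [ShiftedHom.map, ← h]

/-- If the fraction `g = g₀ s⁻¹` becomes divisible by `s` after multiplication by `d`, the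
denominator disappears: the product comes from an honest morphism `f`. -/
lemma ShiftedHom.comp_map_eq_map {C D : Type*} [Category* C] [Category* D] [HasShift C ℤ]
    [HasShift D ℤ] (L : C ⥤ D) [L.CommShift ℤ] {X Y Z W : C} {a b c : ℤ} {h : b + a = c}
    (s : Z ⟶ X) [IsIso (L.map s)] {g : ShiftedHom (L.obj X) (L.obj Y) a} {g₀ : ShiftedHom Z Y a}
    (hg : L.map s ≫ g = g₀.map L) {d : ShiftedHom Y W b} {f : ShiftedHom X W c}
    (hf : g₀.comp d h = s ≫ f) : g.comp (d.map L) h = f.map L := by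
  refine ShiftedHom.comp_left_cancel (ShiftedHom.mk₀ 0 rfl (L.map s)) (add_zero _) ?_
  rw [← ShiftedHom.comp_assoc _ _ _ (add_zero _) h (by lia), ShiftedHom.mk₀_comp,
    ShiftedHom.mk₀_comp, hg, ← ShiftedHom.map_comp, hf]
  simp [ShiftedHom.map]

lemma ShiftedHom.exists_eq_comp {D : Type*} [Category* D] [HasShift D ℤ] {X Y Z : D} {a b c : ℤ}
    (u : ShiftedHom X Y a) [IsIso u] (h : b + a = c) (f : ShiftedHom X Z c) :
    ∃ g : ShiftedHom Y Z b, f = u.comp g h := by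
  obtain ⟨g, hg⟩ := (shiftFunctor D a).map_surjective
    (inv u ≫ f ≫ (shiftFunctorAdd' D b a c h).hom.app _)
  exact ⟨g, by simp [ShiftedHom.comp, hg]⟩

namespace SgLift

universe v' u'

variable {C : Type u} [Category.{v} C] [Abelian C] {E : Type u'} [Category.{v'} E] [Abelian E]
variable {F G H : C ⥤ E} [F.Additive] [G.Additive] [H.Additive]
  (S : SgLift F) (T : SgLift G) (U : SgLift H) {Z : BoundedDerived C} {a b c : ℤ}

/-- The image in the singularity category of a morphism in the bounded derived category. -/
def toSg (f : ShiftedHom (S.bdd.obj Z) (T.bdd.obj Z) a) :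
    ShiftedHom (S.sg.obj ((IsPerfectB C).trW.Q.obj Z)) (T.sg.obj ((IsPerfectB C).trW.Q.obj Z)) a :=
  S.isoSg.hom.app Z ≫ f.map (IsPerfectB E).trW.Q ≫ (T.isoSg.inv.app Z)⟦a⟧'

lemma toSg_comp (f : ShiftedHom (S.bdd.obj Z) (T.bdd.obj Z) a)
    (g : ShiftedHom (T.bdd.obj Z) (U.bdd.obj Z) b) (h : b + a = c) :
    S.toSg U (f.comp g h) = (S.toSg T f).comp (T.toSg U g) h := by
  have h1 : (T.isoSg.inv.app Z)⟦a⟧' ≫ (T.isoSg.hom.app Z)⟦a⟧' = 𝟙 _ := by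
    rw [← Functor.map_comp, Iso.inv_hom_id_app, CategoryTheory.Functor.map_id]
  have h2 := (shiftFunctorAdd' (Dsg E) b a c h).inv.naturality (U.isoSg.inv.app Z)
  simp only [Functor.comp_map] at h2
  rw [toSg, toSg, toSg, ShiftedHom.map_comp]
  simp only [ShiftedHom.comp, Functor.map_comp, Category.assoc, reassoc_of% h1]
  exact congrArg (fun x => _ ≫ _ ≫ _ ≫ x) h2.symm

/-- For the lift of the identity functor the comparison on the source is trivial, so only the one on
the target remains. -/
lemma id_toSg {F : C ⥤ C} [F.Additive] (T : SgLift F)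
    (f : ShiftedHom (SgLift.id.bdd.obj Z) (T.bdd.obj Z) a) :
    SgLift.id.toSg T f = ShiftedHom.comp (f.map (IsPerfectB C).trW.Q)
      (ShiftedHom.mk₀ 0 rfl (T.isoSg.inv.app Z)) (zero_add _) := by
  rw [toSg, ShiftedHom.comp_mk₀]
  exact (congrArg (· ≫ _) (Category.comp_id _)).trans (Category.id_comp _)

lemma isIso_toSg (f : ShiftedHom (S.bdd.obj Z) (T.bdd.obj Z) a) (hf : (IsPerfectB E).trW f) :
    IsIso (S.toSg T f) := by
  have := Localization.inverts (IsPerfectB E).trW.Q _ _ hf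
  have : IsIso (f.map (IsPerfectB E).trW.Q) := by
    unfold ShiftedHom.map; infer_instance
  unfold toSg
  infer_instance

lemma intertwines (u : GradedNatTrans S.sg T.sg a) (X : Dsg C) :
    Intertwines (GrEndMaps.ofFunctor S.sg X) (GrEndMaps.ofFunctor T.sg X) (u.app X) :=
  fun _ _ f h => u.map_comp f h

/-- The image of `u.app Z` is the component of the transformation that `u` induces on singularity
categories, and components of graded transformations intertwine. -/
lemma intertwines_toSg (u : GradedNatTrans S.bdd T.bdd a) :
    Intertwines (GrEndMaps.ofFunctor S.sg _) (GrEndMaps.ofFunctor T.sg _)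
      (S.toSg T (u.app Z)) := by
  have := S.intertwines T (S.sgNat T u) ((IsPerfectB C).trW.Q.obj Z)
  rwa [sgNat_app] at this

end SgLift

/-! ### Syzygy systems and the Koszul rule for classes in the singularity category. -/

variable {C : Type u} [Category.{v} C] [Abelian C]

/-- Exact functors `R r` which are iterated syzygies of the identity functor, relative to
functors that take projective values at `A`. -/
structure SyzygySystem (A : C) (R V : ℕ → C ⥤ C) [∀ r, (R r).Additive]
    [∀ r, (V r).Additive] where
  lift (r : ℕ) : SgLift (R r)
  liftV (r : ℕ) : SgLift (V r)
  i (r : ℕ) : R (r + 1) ⟶ V r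
  p (r : ℕ) : V r ⟶ R r
  ses (r : ℕ) : IsFunctorSES (i r) (p r)
  projective (r : ℕ) : Projective ((V r).obj A)
  iso : 𝟭 C ≅ R 0

/-- `A` as an object of the singularity category. -/
abbrev sgObj (A : C) : Dsg C := (IsPerfectB C).trW.Q.obj ((SgLift.toBounded C).obj A)

namespace SyzygySystem

variable {A : C} {R V : ℕ → C ⥤ C} [∀ r, (R r).Additive] [∀ r, (V r).Additive]
  (T : SyzygySystem A R V)

/-- The object `A` of the bounded derived category, with `R r` applied to it. -/
abbrev obj (r : ℕ) : BoundedDerived C := (T.lift r).bdd.obj ((SgLift.toBounded C).obj A)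

/-- The connecting morphism `R r A ⟶ (R (r + 1) A)⟦1⟧`. -/
def δ (r : ℕ) : ShiftedHom (T.obj r) (T.obj (r + 1)) (1 : ℤ) :=
  ((T.lift r).bddConnecting (T.lift (r + 1)) (T.ses r)).app _

lemma isPerfectB_liftV (r : ℕ) :
    IsPerfectB C ((T.liftV r).bdd.obj ((SgLift.toBounded C).obj A)) :=
  have := T.projective r
  (IsPerfectB C).prop_of_iso ((T.liftV r).singleBdd A).symm (isPerfectB_toBounded _)

/-- The composition `A ⟶ (R r A)⟦r⟧` of connecting morphisms. -/
def d : ∀ r : ℕ, ShiftedHom (SgLift.id.bdd.obj ((SgLift.toBounded C).obj A)) (T.obj r) (r : ℤ)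
  | 0 => (SgLift.id.bddOfNatTrans (T.lift 0) T.iso.hom).app _
  | r + 1 => (d r).comp (T.δ r) (by push_cast; ring)

/-- The composition `A ⟶ (R r A)⟦r⟧` of connecting morphisms, in the singularity category. -/
def σ (r : ℕ) : ShiftedHom (SgLift.id.sg.obj (sgObj A)) ((T.lift r).sg.obj (sgObj A))
    (r : ℤ) :=
  SgLift.id.toSg (T.lift r) (T.d r)

/-- The action of `R r` on graded endomorphisms in the singularity category. -/
abbrev θ (r : ℕ) : GrEndMaps (sgObj A) ((T.lift r).sg.obj (sgObj A)) :=
  GrEndMaps.ofFunctor (T.lift r).sg (sgObj A)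

/-- In the rotated triangle the morphism preceding `δ` starts at `V r` applied to `A`, which is
perfect. -/
lemma trW_δ (r : ℕ) : (IsPerfectB C).trW (T.δ r) := by
  obtain ⟨f, g, hT⟩ := (T.lift r).bddConnecting_triangle (T.lift (r + 1)) (T.liftV r) (T.ses r)
    ((SgLift.toBounded C).obj A)
  exact ((IsPerfectB C).trW_iff_of_distinguished' _ (rot_of_distTriang _ hT)).2
    (T.isPerfectB_liftV r)

/-- Each factor of `σ` is the component at `A` of a graded natural transformation, and intertwiners
compose. -/
lemma intertwines_σ (r : ℕ) : Intertwines (GrEndMaps.ofFunctor (SgLift.id (C := C)).sg (sgObj A))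
    (T.θ r) (T.σ r) := by
  induction r with
  | zero => exact SgLift.intertwines_toSg _ _ _
  | succ r ih =>
    rw [σ, d, SgLift.toSg_comp _ (T.lift r)]
    exact ih.comp (SgLift.intertwines_toSg _ _ _) _

lemma isIso_σ (r : ℕ) : IsIso (T.σ r) := by
  induction r with
  | zero =>
    refine SgLift.isIso_toSg _ _ _ ?_
    change (IsPerfectB C).trW ((SgLift.id.bddOfNatTrans (T.lift 0) T.iso.hom).app _)
    rw [SgLift.bddOfNatTrans_app]
    exact ObjectProperty.trW_of_isIso _ _
  | succ r ih =>
    rw [σ, d, SgLift.toSg_comp _ (T.lift r)]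
    have := SgLift.isIso_toSg _ (T.lift (r + 1)) _ (T.trW_δ r)
    have : IsIso (SgLift.id.toSg (T.lift r) (T.d r)) := ih
    infer_instance

/-- Dimension shifting. The obstruction to extending `f` along `δ` is its restriction to the
projective object `(V r).obj A`, which vanishes in nonzero degree. -/
lemma exists_eq_δ_comp {r s : ℕ} {c e : ℤ} (hc : e = c + 1) (he : e ≠ 0)
    (f : ShiftedHom (T.obj r) (T.obj s) e) :
    ∃ g : ShiftedHom (T.obj (r + 1)) (T.obj s) c, f = (T.δ r).comp g hc.symm := by
  obtain ⟨f₁, g₁, hT⟩ := (T.lift r).bddConnecting_triangle (T.lift (r + 1)) (T.liftV r) (T.ses r)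
    ((SgLift.toBounded C).obj A)
  -- The hypothesis `e ≠ 0` enters only here. In degree `0` the restriction to the projective need
  -- not vanish.
  have h0 : g₁ ≫ f = 0 := by
    have := T.projective r
    rw [← cancel_epi ((T.liftV r).singleBdd A).inv,
      ← cancel_mono (((T.lift s).singleBdd A).hom⟦e⟧')]
    rw [comp_zero, zero_comp]
    exact BoundedDerived.hom_projective_eq_zero _ _ he _
  obtain ⟨g, hg⟩ : ∃ g : (T.obj (r + 1))⟦(1 : ℤ)⟧ ⟶ (T.obj s)⟦e⟧, f = T.δ r ≫ g :=
    Triangle.yoneda_exact₃ _ hT f h0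
  obtain ⟨g', hg'⟩ := (shiftFunctor (BoundedDerived C) (1 : ℤ)).map_surjective
    (g ≫ (shiftFunctorAdd' (BoundedDerived C) c 1 e hc.symm).hom.app _)
  refine ⟨g', ?_⟩
  change f = T.δ r ≫ g'⟦(1 : ℤ)⟧' ≫ _
  rw [hg', Category.assoc, Iso.hom_inv_id_app]
  exact hg.trans (congrArg (T.δ r ≫ ·) (Category.comp_id g).symm)

/-- Induction on the degree `c`: each `δ` split off lowers the degree by one and replaces `r` by `r
+ 1`. In degree `0` a morphism of `C` remains, and `full` extends it to a natural transformation.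
Every morphism of nonnegative degree is thus built from components of graded transformations. -/
lemma intertwines_toSg (full : ∀ (r s : ℕ) (f : (R r).obj A ⟶ (R s).obj A),
      ∃ τ : R r ⟶ R s, τ.app A = f) (c : ℕ) {r s : ℕ}
    (f : ShiftedHom (T.obj r) (T.obj s) (c : ℤ)) :
    Intertwines (T.θ r) (T.θ s) ((T.lift r).toSg (T.lift s) f) := by
  induction c generalizing r with
  | zero =>
    obtain ⟨f, rfl⟩ : ∃ f', f = ShiftedHom.mk₀ (0 : ℤ) rfl f' :=
      ⟨_, ((ShiftedHom.homEquiv 0 rfl).apply_symm_apply f).symm⟩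
    obtain ⟨φ, hφ⟩ := (SgLift.toBounded C).map_surjective
      (((T.lift r).singleBdd A).inv ≫ f ≫ ((T.lift s).singleBdd A).hom)
    obtain ⟨τ, rfl⟩ := full r s φ
    have : ShiftedHom.mk₀ (0 : ℤ) rfl f = ((T.lift r).bddOfNatTrans (T.lift s) τ).app _ := by
      rw [SgLift.bddOfNatTrans_app, hφ]
      simp
    rw [this]
    exact SgLift.intertwines_toSg _ _ _
  | succ c ih =>
    obtain ⟨g, rfl⟩ := T.exists_eq_δ_comp (c := c) (by push_cast; ring) (by positivity) f
    rw [SgLift.toSg_comp _ (T.lift (r + 1))]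
    exact Intertwines.comp (SgLift.intertwines_toSg _ _ _) (ih g) _

lemma intertwines_toSg_id (full : ∀ (r s : ℕ) (f : (R r).obj A ⟶ (R s).obj A),
      ∃ τ : R r ⟶ R s, τ.app A = f) {c : ℤ} (hc : 0 ≤ c) {s : ℕ}
    (f : ShiftedHom (SgLift.id.bdd.obj ((SgLift.toBounded C).obj A)) (T.obj s) c) :
    Intertwines (GrEndMaps.ofFunctor (SgLift.id (C := C)).sg (sgObj A)) (T.θ s)
      (SgLift.id.toSg (T.lift s) f) := by
  lift c to ℕ using hc
  have : IsIso ((SgLift.id.bddOfNatTrans (T.lift 0) T.iso.hom).app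
      ((SgLift.toBounded C).obj A)) := by
    rw [SgLift.bddOfNatTrans_app]
    infer_instance
  obtain ⟨g, rfl⟩ : ∃ g : ShiftedHom (T.obj 0) (T.obj s) (c : ℤ),
      f = ((SgLift.id.bddOfNatTrans (T.lift 0) T.iso.hom).app _).comp g (add_zero _) :=
    ShiftedHom.exists_eq_comp _ _ _
  rw [SgLift.toSg_comp _ (T.lift 0)]
  exact Intertwines.comp (SgLift.intertwines_toSg _ _ _) (T.intertwines_toSg full c g) _

-- A morphism of the singularity category need not come from the bounded derived category, but it
-- does after multiplication by `σ p` for large `p`. The product is then an intertwiner by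
-- `intertwines_toSg_id`, and the invertible intertwiner `σ p` can be cancelled.
include T in
lemma intertwines_id (full : ∀ (r s : ℕ) (f : (R r).obj A ⟶ (R s).obj A),
      ∃ τ : R r ⟶ R s, τ.app A = f) {n : ℤ}
    (g : ShiftedHom (sgObj A) (sgObj A) n) :
    Intertwines (GrEndMaps.ofFunctor (SgLift.id (C := C)).sg (sgObj A))
      (GrEndMaps.ofFunctor (SgLift.id (C := C)).sg (sgObj A)) g := by
  let Q := (IsPerfectB C).trW.Q
  let Ab := (SgLift.toBounded C).obj A
  obtain ⟨Z, s, hs, g₀, hg⟩ := ShiftedHom.exists_map_comp_eq_map Q (IsPerfectB C).trW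
    (X := Ab) (Y := Ab) g
  have := Localization.inverts Q _ s hs
  -- Here `K` is the fibre of the denominator `s`. A morphism out of `Z` is divisible by `s` once it
  -- vanishes on `K`.
  obtain ⟨K, f, f', hT, hK⟩ := ((IsPerfectB C).trW_iff' s).1 hs
  obtain ⟨e, he⟩ := BoundedDerived.exists_hom_perfect_eq_zero hK
  -- The first inequality makes every morphism from `K` to a syzygy in degree `p + n` vanish; the
  -- second puts the numerator in nonnegative degree, as dimension shifting requires.
  obtain ⟨p, hp⟩ : ∃ p : ℕ, e ≤ p + n ∧ 0 ≤ p + n := ⟨(max e 0 - n).toNat, by lia⟩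
  let x : ShiftedHom Z (T.obj p) (p + n) := ShiftedHom.comp (a := n) g₀ (T.d p) rfl
  have hx : f ≫ x = 0 := by
    rw [← cancel_mono (((T.lift p).singleBdd A).hom⟦(p + n : ℤ)⟧'), zero_comp]
    exact he _ hp.1 _ _
  obtain ⟨h, hh⟩ : ∃ h : Ab ⟶ (T.obj p)⟦(p + n : ℤ)⟧, x = s ≫ h :=
    Triangle.yoneda_exact₂ _ hT x hx
  have key : ShiftedHom.comp g ((T.d p).map Q) rfl = ShiftedHom.map (X := Ab) h Q :=
    ShiftedHom.comp_map_eq_map Q s hg hh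
  have hσ : g.comp (T.σ p) rfl = SgLift.id.toSg (T.lift p) h := by
    have h₁ : T.σ p = _ := SgLift.id_toSg (T.lift p) (T.d p)
    refine Eq.trans ?_ (SgLift.id_toSg (T.lift p) h).symm
    refine (congrArg (fun y => ShiftedHom.comp g y rfl) h₁).trans ?_
    refine (ShiftedHom.comp_assoc g ((T.d p).map Q) (ShiftedHom.mk₀ 0 rfl _) rfl (zero_add _)
      (by lia)).symm.trans ?_
    exact congrArg (fun y => ShiftedHom.comp y _ _) key
  have := T.isIso_σ p
  -- Cancels `σ p`, leaving the claim for the product of `g` and `σ p`, which comes from `h`.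
  refine Intertwines.of_comp rfl ?_ (T.intertwines_σ p)
  have h₂ := T.intertwines_toSg_id full hp.2 h
  exact Eq.mp (congrArg (Intertwines (GrEndMaps.ofFunctor (SgLift.id (C := C)).sg (sgObj A))
    (T.θ p)) hσ.symm) h₂

end SyzygySystem

/-! ### Transport of graded endomorphism rings along a functor and a shifted isomorphism. -/

section GradedRing

universe v' u'

variable {D : Type u} [Category.{v} D] [HasShift D ℤ]
  {D' : Type u'} [Category.{v'} D'] [HasShift D' ℤ]

namespace GrEndPart

/-- `GrEndPart.induced` in terms of shifted morphisms. -/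
def transport (F : D ⥤ D') [F.CommShift ℤ] {X : D} {Y : D'} {l : ℤ}
    (α : (F.obj X)⟦l⟧ ≅ Y) (n : ℤ) (f : ShiftedHom X X n) : ShiftedHom Y Y n :=
  induced F α n f

/-- The inverse of `α`, as a shifted morphism. -/
def shiftedInv {X Y : D} {l : ℤ} (α : X⟦l⟧ ≅ Y) : ShiftedHom Y X l := α.inv

instance {X Y : D} {l : ℤ} (α : X⟦l⟧ ≅ Y) : IsIso (shiftedInv α) := inferInstanceAs (IsIso α.inv)

/-- With `α⁻¹` read as a morphism `Y → F X` of degree `l`, the transported class is `F f` conjugated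
by it. The exchange of shifts is the one without sign, so none occurs. Since `α` is invertible this
property determines the class (`transport_unique`), and compatibility with units and products
follows from it. -/
lemma transport_comp (F : D ⥤ D') [F.CommShift ℤ] {X : D} {Y : D'} {l : ℤ}
    (α : (F.obj X)⟦l⟧ ≅ Y) (n : ℤ) (f : ShiftedHom X X n) {c : ℤ} (h : l + n = c) :
    (transport F α n f).comp (shiftedInv α) h =
      (shiftedInv α).comp (f.map F) ((add_comm n l).trans h) := by
  simp only [ShiftedHom.comp, transport, induced, shiftedInv, Category.assoc]
  rw [← Functor.map_comp_assoc, Iso.hom_inv_id, CategoryTheory.Functor.map_id, Category.id_comp,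
    shiftFunctorComm_eq D' n l c ((add_comm n l).trans h)]
  simp

lemma transport_unique (F : D ⥤ D') [F.CommShift ℤ] {X : D} {Y : D'} {l : ℤ}
    (α : (F.obj X)⟦l⟧ ≅ Y) (n : ℤ) (f : ShiftedHom X X n) {c : ℤ} (h : l + n = c)
    {g : ShiftedHom Y Y n} (hg : g.comp (shiftedInv α) h =
      (shiftedInv α).comp (f.map F) ((add_comm n l).trans h)) : transport F α n f = g :=
  ShiftedHom.comp_right_cancel (shiftedInv α) h ((transport_comp F α n f h).trans hg.symm)

lemma transport_mul (F : D ⥤ D') [F.CommShift ℤ] {X : D} {Y : D'} {l : ℤ}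
    (α : (F.obj X)⟦l⟧ ≅ Y) {m n c : ℤ} (f : ShiftedHom X X m) (g : ShiftedHom X X n)
    (h : n + m = c) :
    transport F α c (f.comp g h) = (transport F α m f).comp (transport F α n g) h := by
  refine transport_unique F α _ _ rfl ?_
  rw [ShiftedHom.comp_assoc _ _ _ _ (rfl : l + n = l + n) (by lia),
    transport_comp F α n g rfl,
    ← ShiftedHom.comp_assoc _ _ _ rfl (add_comm n l) (by lia), transport_comp F α m f rfl,
    ShiftedHom.map_comp, ShiftedHom.comp_assoc _ _ _ _ h (by lia)]

lemma induced_one (F : D ⥤ D') [F.CommShift ℤ] {X : D} {Y : D'} {l : ℤ}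
    (α : (F.obj X)⟦l⟧ ≅ Y) :
    induced F α 0 (GradedMonoid.GOne.one : GrEndPart X 0) = GradedMonoid.GOne.one := by
  refine transport_unique F α 0 (ShiftedHom.mk₀ (0 : ℤ) rfl (𝟙 X)) (add_zero l)
    (g := ShiftedHom.mk₀ (0 : ℤ) rfl (𝟙 Y)) ?_
  rw [ShiftedHom.map_mk₀, CategoryTheory.Functor.map_id, ShiftedHom.mk₀_id_comp,
    ShiftedHom.comp_mk₀_id]

lemma induced_mul (F : D ⥤ D') [F.CommShift ℤ] {X : D} {Y : D'} {l : ℤ}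
    (α : (F.obj X)⟦l⟧ ≅ Y) {m n : ℤ} (f : GrEndPart X m) (g : GrEndPart X n) :
    induced F α (m + n) (GradedMonoid.GMul.mul f g) =
      GradedMonoid.GMul.mul (induced F α m f) (induced F α n g) :=
  transport_mul F α (show ShiftedHom X X n from g) (show ShiftedHom X X m from f) rfl

variable [Preadditive D] [Preadditive D']

lemma induced_add (F : D ⥤ D') [F.CommShift ℤ] [F.Additive]
    [∀ n : ℤ, (shiftFunctor D' n).Additive] {X : D} {Y : D'} {l : ℤ}
    (α : (F.obj X)⟦l⟧ ≅ Y) {n : ℤ} (f g : GrEndPart X n) :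
    induced F α n (f + g) = induced F α n f + induced F α n g := by
  have : ShiftedHom.map (f + g) F = ShiftedHom.map f F + ShiftedHom.map g F := by
    simp only [ShiftedHom.map]
    exact (congrArg (· ≫ _) (F.map_add (f := f) (g := g))).trans (Preadditive.add_comp _ _ _ _ _ _)
  unfold induced
  rw [this, Functor.map_add, Preadditive.add_comp, Preadditive.comp_add]
  rfl

variable [∀ n : ℤ, (shiftFunctor D n).Additive] [∀ n : ℤ, (shiftFunctor D' n).Additive]

/-- The ring homomorphism with components `GrEndPart.induced`. -/
def inducedHom (F : D ⥤ D') [F.CommShift ℤ] [F.Additive] {X : D} {Y : D'} {l : ℤ}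
    (α : (F.obj X)⟦l⟧ ≅ Y) : GrEnd X →+* GrEnd Y :=
  DirectSum.toSemiring (fun n => (DirectSum.of (GrEndPart Y) n).comp
      (AddMonoidHom.mk' (induced F α n) (induced_add F α)))
    (congrArg (DirectSum.of (GrEndPart Y) 0) (induced_one F α))
    (fun f g => (congrArg (DirectSum.of (GrEndPart Y) _) (induced_mul F α f g)).trans
      (DirectSum.of_mul_of _ _).symm)

lemma inducedHom_of (F : D ⥤ D') [F.CommShift ℤ] [F.Additive] {X : D} {Y : D'} {l : ℤ}
    (α : (F.obj X)⟦l⟧ ≅ Y) (n : ℤ) (f : GrEndPart X n) :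
    inducedHom F α (DirectSum.of (GrEndPart X) n f) =
      DirectSum.of (GrEndPart Y) n (induced F α n f) :=
  DirectSum.toSemiring_of _ _ _ _ _

omit [∀ n : ℤ, (shiftFunctor D n).Additive] in
lemma of_comp_eq {X : D} {a b c c' : ℤ} (f : ShiftedHom X X a) (g : ShiftedHom X X b)
    (h : b + a = c) (h' : b + a = c') :
    DirectSum.of (GrEndPart X) c (f.comp g h) = DirectSum.of (GrEndPart X) c' (f.comp g h') := by
  subst h
  subst h'
  rfl

/-- The two products have degrees `m + n` and `n + m`; reading both in one degree turns the identity
in the direct sum into one of morphisms, because the inclusion of a summand is injective. -/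
lemma _root_.GrEnd.isGradedCommutative_iff (X : D) : GrEnd.IsGradedCommutative X ↔
    ∀ (m n : ℤ) (f : ShiftedHom X X m) (g : ShiftedHom X X n), g.comp f rfl =
      (m * n).negOnePow • f.comp g (add_comm n m) := by
  refine forall_congr' fun m => forall_congr' fun n => ?_
  change (∀ (f : ShiftedHom X X m) (g : ShiftedHom X X n), _) ↔ _
  refine forall_congr' fun f => forall_congr' fun g => ?_
  have hfg := DirectSum.of_mul_of (A := GrEndPart X) (i := m) (j := n) f g
  have hgf := DirectSum.of_mul_of (A := GrEndPart X) (i := n) (j := m) g f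
  refine (iff_of_eq (congrArg₂ (fun a b => a = (m * n).negOnePow • b) hfg hgf)).trans ?_
  change DirectSum.of (GrEndPart X) _ (ShiftedHom.comp g f rfl) =
    _ • DirectSum.of (GrEndPart X) _ (ShiftedHom.comp f g rfl) ↔ _
  rw [of_comp_eq f g rfl (add_comm n m), Units.smul_def,
    show ((m * n).negOnePow : ℤ) • (DirectSum.of (GrEndPart X) (m + n)) (f.comp g (add_comm n m)) =
      DirectSum.of (GrEndPart X) (m + n) (((m * n).negOnePow : ℤ) • f.comp g (add_comm n m)) from
      (map_zsmul (DirectSum.of (GrEndPart X) (m + n)) _ _).symm]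
  exact (DirectSum.of_injective (β := GrEndPart X) (m + n)).eq_iff

omit [Preadditive D'] [∀ n : ℤ, (shiftFunctor D' n).Additive] in
/-- Functors whose composition is a shift of the identity, as far as the action on graded
endomorphisms of `X` is concerned, induce inverse maps. -/
lemma transport_transport (F : D ⥤ D') [F.CommShift ℤ] (G : D' ⥤ D) [G.CommShift ℤ] {X : D}
    {Y : D'} {l : ℤ} (α : (F.obj X)⟦l⟧ ≅ Y) (β : (G.obj Y)⟦l⟧ ≅ X)
    (hX : GrEnd.IsGradedCommutative X)
    (w : ShiftedHom X (G.obj (F.obj X)) (l + l)) [IsIso w]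
    (hw : Intertwines (GrEndMaps.ofFunctor (𝟭 D) X) (GrEndMaps.ofFunctor (F ⋙ G) X) w)
    {n : ℤ} (f : ShiftedHom X X n) : transport G β n (transport F α n f) = f := by
  rw [GrEnd.isGradedCommutative_iff] at hX
  let α' : ShiftedHom Y (F.obj X) l := shiftedInv α
  let β' : ShiftedHom X (G.obj Y) l := shiftedInv β
  let f₁ : ShiftedHom Y Y n := transport F α n f
  let f₂ : ShiftedHom X X n := transport G β n f₁
  have h₁ : f₁.comp α' rfl = α'.comp (f.map F) (add_comm n l) := transport_comp F α n f rfl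
  have h₂ : f₂.comp β' rfl = β'.comp (f₁.map G) (add_comm n l) := transport_comp G β n f₁ rfl
  -- The two isomorphisms combine into a second invertible morphism parallel to `w`; by construction
  -- it carries `f₂` to `G (F f)`.
  let γ : ShiftedHom X (G.obj (F.obj X)) (l + l) := β'.comp (α'.map G) rfl
  have h₃ : f₂.comp γ rfl = γ.comp ((f.map F).map G) (add_comm n (l + l)) := by
    rw [← ShiftedHom.comp_assoc _ _ _ (rfl : l + n = l + n) _ (by lia), h₂,
      ShiftedHom.comp_assoc _ _ _ _ (rfl : l + n = l + n) (by lia), ← ShiftedHom.map_comp, h₁,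
      ShiftedHom.map_comp, ShiftedHom.comp_assoc _ _ _ _ (add_comm n l) (by lia)]
  -- The discrepancy between `γ` and `w`: an automorphism of `X` of degree `0`.
  let y : ShiftedHom X X (0 : ℤ) := γ ≫
    (shiftFunctorAdd' D (l + l) 0 (l + l) (add_zero _)).hom.app _ ≫ inv (w⟦(0 : ℤ)⟧')
  have hy : γ = y.comp w (add_zero _) := by simp [y, ShiftedHom.comp]
  have : IsIso y := by dsimp only [y]; infer_instance
  have h₄ : f.comp w rfl = w.comp ((f.map F).map G) (add_comm n (l + l)) := by
    have h := hw n _ f rfl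
    -- The Koszul sign of `w` disappears because its degree is even, whatever `l` is.
    have hs : ((l + l) * n).negOnePow = 1 := Int.negOnePow_even _ ⟨l * n, by ring⟩
    have e₁ : GrEndMaps.ofFunctor (𝟭 D) X n f = f := ShiftedHom.id_map f
    have e₂ : GrEndMaps.ofFunctor (F ⋙ G) X n f = (f.map F).map G := ShiftedHom.comp_map f F G
    rw [hs, one_smul] at h
    exact ((congrArg (fun x => ShiftedHom.comp (X := X) (Z := G.obj (F.obj X)) x w rfl)
      e₁).symm.trans h).trans (congrArg (fun x => ShiftedHom.comp (X := X) w x _) e₂)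
  -- So `f₂` is a conjugate of `f` by `y`. Graded commutativity is needed only against the degree
  -- `0` class `y`, hence without sign.
  have h₅ : f₂.comp y (zero_add n) = f.comp y (zero_add n) := by
    have h := hX 0 n y f
    rw [zero_mul, Int.negOnePow_zero, one_smul] at h
    have h' : f.comp y (zero_add n) = y.comp f (add_zero n) := by
      have e : ∀ {c c' : ℤ} (hc : c = c') (h₁ : 0 + n = c) (h₂ : n + 0 = c) (h₁' : 0 + n = c')
          (h₂' : n + 0 = c'), f.comp y h₁ = y.comp f h₂ → f.comp y h₁' = y.comp f h₂' := by
        rintro _ _ rfl _ _ _ _ h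
        exact h
      exact e (zero_add n) _ _ _ _ h
    refine ShiftedHom.comp_right_cancel w rfl ?_
    rw [h', ShiftedHom.comp_assoc _ _ _ _ (add_zero _) (by lia), ← hy, h₃, hy,
      ShiftedHom.comp_assoc _ _ _ _ (add_comm n (l + l)) (by lia), ← h₄,
      ShiftedHom.comp_assoc _ _ _ _ rfl (by lia)]
  exact ShiftedHom.comp_right_cancel y _ h₅

end GrEndPart

end GradedRing

/-- Graded commutativity says exactly that every class intertwines the identity action on the object
with itself. -/
lemma SyzygySystem.isGradedCommutative {C : Type u} [Category.{v} C] [Abelian C] {A : C}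
    {R V : ℕ → C ⥤ C} [∀ r, (R r).Additive] [∀ r, (V r).Additive] (T : SyzygySystem A R V)
    (full : ∀ (r s : ℕ) (f : (R r).obj A ⟶ (R s).obj A), ∃ τ : R r ⟶ R s, τ.app A = f) :
    GrEnd.IsGradedCommutative (toDsg.obj A) := by
  refine (GrEnd.isGradedCommutative_iff _).2 fun m n f g => ?_
  have h := T.intertwines_id full f n (m + n) g rfl
  have e : GrEndMaps.ofFunctor (SgLift.id (C := C)).sg (sgObj A) n g = g := ShiftedHom.id_map g
  exact ((congrArg (fun x => ShiftedHom.comp (X := sgObj A) (Y := sgObj A) (Z := sgObj A) x f rfl)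
    e).symm.trans h).trans (congrArg (fun x => (m * n).negOnePow •
      ShiftedHom.comp (X := sgObj A) (Y := sgObj A) (Z := sgObj A) f x (add_comm n m)) e)

/-! ### Sequences of bimodules that split after restriction to one side. -/

section Splitting

/-- A short exact sequence of modules over `R` that splits over `S`, by additive maps. -/
structure RestrictedSplitting {S R : Type u} [Ring S] [Ring R] (φ : S →+* R)
    {X₁ X₂ X₃ : Type u} [AddCommGroup X₁] [AddCommGroup X₂] [AddCommGroup X₃]
    [Module R X₁] [Module R X₂] [Module R X₃] (f : X₁ →ₗ[R] X₂) (g : X₂ →ₗ[R] X₃) where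
  r : X₂ →+ X₁
  s : X₃ →+ X₂
  r_smul (a : S) (x : X₂) : r (φ a • x) = φ a • r x
  s_smul (a : S) (x : X₃) : s (φ a • x) = φ a • s x
  r_f (x : X₁) : r (f x) = x
  g_s (x : X₃) : g (s x) = x
  g_f (x : X₁) : g (f x) = 0
  add (x : X₂) : f (r x) + s (g x) = x

namespace RestrictedSplitting

variable {S R : Type u} [Ring S] [Ring R] {φ : S →+* R}

/-- Projectivity of the quotient over `S` gives an `S`-linear section `s`, and the retraction is
forced by `f ∘ r = 1 - s ∘ g` together with injectivity of `f`. -/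
lemma nonempty {X₁ X₂ X₃ : ModuleCat.{u} R} (f : X₁ →ₗ[R] X₂) (g : X₂ →ₗ[R] X₃)
    (hf : Function.Injective f) (hg : Function.Surjective g) (h : Function.Exact f g)
    (hX : Module.Projective S ((ModuleCat.restrictScalars φ).obj X₃)) :
    Nonempty (RestrictedSplitting φ f g) := by
  let g' : (ModuleCat.restrictScalars φ).obj X₂ →ₗ[S] (ModuleCat.restrictScalars φ).obj X₃ :=
    { g.toAddMonoidHom with map_smul' := fun a x => g.map_smul (φ a) x }
  obtain ⟨s₀, hs₀⟩ := Module.projective_lifting_property g' LinearMap.id hg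
  obtain ⟨s, hs', hs_add, hs_smul, hs_zero⟩ : ∃ s : X₃ → X₂, (∀ x, g (s x) = x) ∧
      (∀ x y, s (x + y) = s x + s y) ∧ (∀ (a : S) x, s (φ a • x) = φ a • s x) ∧ s 0 = 0 :=
    ⟨fun x => s₀ x, fun x => LinearMap.congr_fun hs₀ x, s₀.map_add, s₀.map_smul, s₀.map_zero⟩
  have hr (x : X₂) : ∃ y, f y = x - s (g x) := (h _).1 (by
    rw [map_sub, hs', sub_self])
  choose r hr using hr
  exact ⟨{
    r := AddMonoidHom.mk' r (fun x y => hf (by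
      rw [map_add, hr, hr, hr, map_add, hs_add]; abel))
    s := AddMonoidHom.mk' s hs_add
    r_smul := fun a x => hf (by
      change f (r _) = f (φ a • r x)
      rw [map_smul, hr, hr, map_smul, hs_smul, smul_sub])
    s_smul := hs_smul
    r_f := fun x => hf (by
      change f (r _) = _
      rw [hr, h.apply_apply_eq_zero]
      rw [hs_zero, sub_zero])
    g_s := hs'
    g_f := h.apply_apply_eq_zero
    add := fun x => by
      change f (r x) + s (g x) = x
      rw [hr, sub_add_cancel] }⟩

/-- The retraction makes `X₁` a direct summand of `X₂` over `S`. -/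
lemma projective {X₁ X₂ X₃ : ModuleCat.{u} R} {f : X₁ →ₗ[R] X₂} {g : X₂ →ₗ[R] X₃}
    (e : RestrictedSplitting φ f g)
    (hX : Module.Projective S ((ModuleCat.restrictScalars φ).obj X₂)) :
    Module.Projective S ((ModuleCat.restrictScalars φ).obj X₁) := by
  let f' : (ModuleCat.restrictScalars φ).obj X₁ →ₗ[S] (ModuleCat.restrictScalars φ).obj X₂ :=
    { f.toAddMonoidHom with map_smul' := fun a x => f.map_smul (φ a) x }
  let r' : (ModuleCat.restrictScalars φ).obj X₂ →ₗ[S] (ModuleCat.restrictScalars φ).obj X₁ :=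
    { e.r with map_smul' := fun a x => e.r_smul a x }
  exact Module.Projective.of_split f' r' (LinearMap.ext e.r_f)

end RestrictedSplitting

/-- A split sequence of abelian groups is short exact. -/
lemma FGModuleCat.shortExact_of_splitting {R : Type u} [Ring R] [IsNoetherianRing R]
    (T : ShortComplex (FGModuleCat.{u} R)) (r : T.X₂.obj → T.X₁.obj) (s : T.X₃.obj → T.X₂.obj)
    (hr : ∀ x, r (T.f.hom.hom x) = x) (hs : ∀ x, T.g.hom.hom (s x) = x)
    (h : ∀ x, T.g.hom.hom x = 0 → T.f.hom.hom (r x) = x) : T.ShortExact where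
  exact := by
    rw [FGModuleCat.exact_iff_function_exact]
    refine fun x => ⟨fun hx => ⟨r x, h x hx⟩, ?_⟩
    rintro ⟨y, rfl⟩
    exact congrArg (fun f => f.hom.hom y) T.zero
  mono_f := by
    refine (forget₂ (FGModuleCat.{u} R) (ModuleCat.{u} R)).mono_of_mono_map ?_
    rw [ModuleCat.mono_iff_injective]
    exact Function.LeftInverse.injective (g := r) hr
  epi_g := by
    refine (forget₂ (FGModuleCat.{u} R) (ModuleCat.{u} R)).epi_of_epi_map ?_
    rw [ModuleCat.epi_iff_surjective]
    exact Function.RightInverse.surjective (g := s) hs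

end Splitting

/-! ### One-sided splittings make tensor product functors exact in the bimodule. -/

section TensorSplitting

open scoped ModuleCat.Algebra
open MulOpposite

variable {k : Type u} [Field k]
variable {A B D E : Type u} [Ring A] [Algebra k A] [Ring B] [Algebra k B] [Ring D] [Algebra k D]
  [Ring E] [Algebra k E]

/-- The inclusion of the left tensor factor. -/
abbrev inclLeft (k A E : Type u) [Field k] [Ring A] [Algebra k A] [Ring E] [Algebra k E] :
    A →+* A ⊗[k] E :=
  (Algebra.TensorProduct.includeLeft : A →ₐ[k] A ⊗[k] E).toRingHom

/-- The inclusion of the right tensor factor. -/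
abbrev inclRight (k A E : Type u) [Field k] [Ring A] [Algebra k A] [Ring E] [Algebra k E] :
    E →+* A ⊗[k] E :=
  (Algebra.TensorProduct.includeRight : E →ₐ[k] A ⊗[k] E).toRingHom

namespace BTensor

variable {M M' : ModuleCat.{u} (A ⊗[k] Bᵐᵒᵖ)} {X X' : ModuleCat.{u} (B ⊗[k] D)}

/-- `M ⊗_B f` for a left `B`-linear map `f`. -/
def mapRightAdd (M : ModuleCat.{u} (A ⊗[k] Bᵐᵒᵖ)) (f : X →+ X')
    (hf : ∀ (b : B) x, f (inclLeft k B D b • x) = inclLeft k B D b • f x) :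
    BTensor M X →+ BTensor M X' :=
  liftAdd (AddMonoidHom.compl₂ tmulHom f) (fun b m x => by
    change tmul _ (f x) = tmul m (f (inclLeft k B D b • x))
    rw [balanced, hf]
    rfl)

/-- `f ⊗_B X` for a right `B`-linear map `f`. -/
def mapLeftAdd (X : ModuleCat.{u} (B ⊗[k] D)) (f : M →+ M')
    (hf : ∀ (b : Bᵐᵒᵖ) x, f (inclRight k A Bᵐᵒᵖ b • x) = inclRight k A Bᵐᵒᵖ b • f x) :
    BTensor M X →+ BTensor M' X :=
  liftAdd (tmulHom.comp f) (fun b m x => by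
    change tmul (f (inclRight k A Bᵐᵒᵖ (op b) • m)) x = tmul (f m) _
    rw [← balanced, hf]
    rfl)

end BTensor

variable [Module.Finite k A] [Module.Finite k B] [Module.Finite k D] [Module.Finite k E]

/-- Functoriality of `tensorRight` in the bimodule. -/
def tensorRightMap {N N' : FGModuleCat.{u} (B ⊗[k] D)} (φ : N ⟶ N') :
    tensorRight (A := A) N ⟶ tensorRight N' where
  app _ := FGModuleCat.ofHom (BTensor.map LinearMap.id φ.hom.hom)
  naturality _ _ _ := FGModuleCat.hom_ext (BTensor.linearMap_ext fun _ _ => rfl)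

/-- Functoriality of `tensorLeft` in the bimodule. -/
def tensorLeftMap {M M' : FGModuleCat.{u} (A ⊗[k] Bᵐᵒᵖ)} (φ : M ⟶ M') :
    tensorLeft (D := D) M ⟶ tensorLeft M' where
  app _ := FGModuleCat.ofHom (BTensor.map φ.hom.hom LinearMap.id)
  naturality _ _ _ := FGModuleCat.hom_ext (BTensor.linearMap_ext fun _ _ => rfl)

/-- The splitting maps need not be bimodule maps, but left `B`-linearity is all that tensoring over
`B` on the left requires. They induce additive splittings after tensoring with any `X`, which
suffices for exactness. -/
lemma isFunctorSES_tensorRight {N₁ N₂ N₃ : FGModuleCat.{u} (B ⊗[k] D)} (f : N₁ ⟶ N₂) (g : N₂ ⟶ N₃)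
    (e : RestrictedSplitting (inclLeft k B D) f.hom.hom g.hom.hom) :
    IsFunctorSES (tensorRightMap (A := A) f) (tensorRightMap g) := by
  have zero (X : FGModuleCat.{u} (A ⊗[k] Bᵐᵒᵖ)) :
      (tensorRightMap (A := A) f).app X ≫ (tensorRightMap g).app X = 0 :=
    FGModuleCat.hom_ext (BTensor.linearMap_ext fun m x =>
      (congrArg (BTensor.tmul m) (e.g_f x)).trans ((BTensor.tmulHom m).map_zero))
  refine ⟨zero, fun X => ?_⟩
  let F : BTensor X.obj N₁.obj →+ BTensor X.obj N₂.obj :=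
    (BTensor.map LinearMap.id f.hom.hom).toAddMonoidHom
  let G : BTensor X.obj N₂.obj →+ BTensor X.obj N₃.obj :=
    (BTensor.map LinearMap.id g.hom.hom).toAddMonoidHom
  let r := BTensor.mapRightAdd X.obj e.r e.r_smul
  let s := BTensor.mapRightAdd X.obj e.s e.s_smul
  have h₁ : r.comp F = AddMonoidHom.id _ :=
    BTensor.hom_ext fun m x => congrArg (BTensor.tmul m) (e.r_f x)
  have h₂ : G.comp s = AddMonoidHom.id _ :=
    BTensor.hom_ext fun m x => congrArg (BTensor.tmul m) (e.g_s x)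
  have h₃ : F.comp r + s.comp G = AddMonoidHom.id _ :=
    BTensor.hom_ext fun m x => (BTensor.tmul_add m _ _).symm.trans
      (congrArg (BTensor.tmul m) (e.add x))
  refine FGModuleCat.shortExact_of_splitting _ r s (DFunLike.congr_fun h₁)
    (DFunLike.congr_fun h₂) (fun x hx => ?_)
  have h : F (r x) + s (G x) = x := DFunLike.congr_fun h₃ x
  have hx' : G x = 0 := hx
  rw [hx', map_zero, add_zero] at h
  exact h

/-- Mirror image of `isFunctorSES_tensorRight`, with a splitting that is linear for the right action
of `B`. -/
lemma isFunctorSES_tensorLeft {M₁ M₂ M₃ : FGModuleCat.{u} (A ⊗[k] Bᵐᵒᵖ)} (f : M₁ ⟶ M₂) (g : M₂ ⟶ M₃)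
    (e : RestrictedSplitting (inclRight k A Bᵐᵒᵖ) f.hom.hom g.hom.hom) :
    IsFunctorSES (tensorLeftMap (D := D) f) (tensorLeftMap g) := by
  have zero (X : FGModuleCat.{u} (B ⊗[k] D)) :
      (tensorLeftMap (D := D) f).app X ≫ (tensorLeftMap g).app X = 0 :=
    FGModuleCat.hom_ext (BTensor.linearMap_ext fun m x =>
      (congrArg (fun y => BTensor.tmul y x) (e.g_f m)).trans
        ((BTensor.tmulHom.flip x).map_zero))
  refine ⟨zero, fun X => ?_⟩
  let F : BTensor M₁.obj X.obj →+ BTensor M₂.obj X.obj :=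
    (BTensor.map f.hom.hom LinearMap.id).toAddMonoidHom
  let G : BTensor M₂.obj X.obj →+ BTensor M₃.obj X.obj :=
    (BTensor.map g.hom.hom LinearMap.id).toAddMonoidHom
  let r := BTensor.mapLeftAdd X.obj e.r e.r_smul
  let s := BTensor.mapLeftAdd X.obj e.s e.s_smul
  have h₁ : r.comp F = AddMonoidHom.id _ :=
    BTensor.hom_ext fun m x => congrArg (fun y => BTensor.tmul y x) (e.r_f m)
  have h₂ : G.comp s = AddMonoidHom.id _ :=
    BTensor.hom_ext fun m x => congrArg (fun y => BTensor.tmul y x) (e.g_s m)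
  have h₃ : F.comp r + s.comp G = AddMonoidHom.id _ :=
    BTensor.hom_ext fun m x => (BTensor.add_tmul _ _ x).symm.trans
      (congrArg (fun y => BTensor.tmul y x) (e.add m))
  refine FGModuleCat.shortExact_of_splitting _ r s (DFunLike.congr_fun h₁)
    (DFunLike.congr_fun h₂) (fun x hx => ?_)
  have h : F (r x) + s (G x) = x := DFunLike.congr_fun h₃ x
  have hx' : G x = 0 := hx
  rw [hx', map_zero, add_zero] at h
  exact h

end TensorSplitting

/-! ### Unit and associativity isomorphisms for tensor products of bimodules. -/

section UnitAssociator

open scoped ModuleCat.Algebra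
open MulOpposite

variable {k : Type u} [Field k]
variable {A B C D E : Type u} [Ring A] [Algebra k A] [Ring B] [Algebra k B] [Ring C] [Algebra k C]
  [Ring D] [Algebra k D] [Ring E] [Algebra k E]

namespace BTensor

section Unit

variable [Module.Finite k A]

/-- `A ⊗_A X → X`, `a ⊗ x ↦ a x` -/
def leftUnitHom (X : ModuleCat.{u} (A ⊗[k] D)) : BTensor (regular k A).obj X →ₗ[A ⊗[k] D] X :=
  lift (M := (regular k A).obj) (leftAct X).flip
    (fun b m x => by
      change (((1 : A) * ((show A from m) * b)) ⊗ₜ[k] (1 : D)) • x =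
        ((show A from m) ⊗ₜ[k] (1 : D)) • (b ⊗ₜ[k] (1 : D)) • x
      rw [smul_smul, Algebra.TensorProduct.tmul_mul_tmul, one_mul, one_mul])
    (fun a d m x => by
      change ((a * ((show A from m) * 1)) ⊗ₜ[k] (1 : D)) • ((1 : A) ⊗ₜ[k] d) • x =
        (a ⊗ₜ[k] d) • ((show A from m) ⊗ₜ[k] (1 : D)) • x
      rw [smul_smul, smul_smul, Algebra.TensorProduct.tmul_mul_tmul,
        Algebra.TensorProduct.tmul_mul_tmul, mul_one, mul_one, mul_one, one_mul])

/-- `A ⊗_A X ≃ X` -/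
def leftUnit (X : ModuleCat.{u} (A ⊗[k] D)) : BTensor (regular k A).obj X ≃ₗ[A ⊗[k] D] X :=
  LinearEquiv.ofBijective (leftUnitHom X)
    ⟨by
      have h : ((tmulHom (M := (regular k A).obj) (X := X) (1 : A)).comp
          (leftUnitHom X).toAddMonoidHom) = AddMonoidHom.id _ := hom_ext fun m x => by
        refine (balanced (M := (regular k A).obj) (X := X) (show A from m) (1 : A) x).symm.trans
          (congrArg (fun y => tmul y x) ?_)
        change (1 : A) * ((1 : A) * (show A from m)) = m
        rw [one_mul, one_mul]
      exact Function.LeftInverse.injective (g := tmulHom (M := (regular k A).obj) (X := X) (1 : A))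
        (DFunLike.congr_fun h),
    fun x => ⟨tmul (M := (regular k A).obj) (1 : A) x, by
      change ((1 : A) ⊗ₜ[k] (1 : D)) • x = x
      exact one_smul (A ⊗[k] D) x⟩⟩

/-- `X ⊗_A A → X`, `x ⊗ a ↦ x a` -/
def rightUnitHom (X : ModuleCat.{u} (D ⊗[k] Aᵐᵒᵖ)) :
    BTensor X (regular k A).obj →ₗ[D ⊗[k] Aᵐᵒᵖ] X :=
  lift (X := (regular k A).obj)
    ((rightAct X).compl₂ (MulOpposite.opAddEquiv : A ≃+ Aᵐᵒᵖ).toAddMonoidHom)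
    (fun b m x => by
      change ((1 : D) ⊗ₜ[k] op (show A from x)) • ((1 : D) ⊗ₜ[k] op b) • m =
        ((1 : D) ⊗ₜ[k] op (b * ((show A from x) * 1))) • m
      rw [smul_smul, Algebra.TensorProduct.tmul_mul_tmul, one_mul, mul_one, op_mul])
    (fun a d m x => by
      change ((1 : D) ⊗ₜ[k] op ((1 : A) * ((show A from x) * unop d))) •
        (a ⊗ₜ[k] (1 : Aᵐᵒᵖ)) • m = (a ⊗ₜ[k] d) • ((1 : D) ⊗ₜ[k] op (show A from x)) • m
      rw [smul_smul, smul_smul, Algebra.TensorProduct.tmul_mul_tmul,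
        Algebra.TensorProduct.tmul_mul_tmul, one_mul, one_mul, mul_one, mul_one, op_mul,
        op_unop])

/-- `X ⊗_A A ≃ X` -/
def rightUnit (X : ModuleCat.{u} (D ⊗[k] Aᵐᵒᵖ)) :
    BTensor X (regular k A).obj ≃ₗ[D ⊗[k] Aᵐᵒᵖ] X :=
  LinearEquiv.ofBijective (rightUnitHom X)
    ⟨by
      have h : ((tmulHom (M := X) (X := (regular k A).obj)).flip (1 : A)).comp
          (rightUnitHom X).toAddMonoidHom = AddMonoidHom.id _ := hom_ext fun m x => by
        refine (balanced (M := X) (X := (regular k A).obj) (show A from x) m (1 : A)).trans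
          (congrArg (tmul m) ?_)
        change (show A from x) * ((1 : A) * (1 : A)) = x
        rw [mul_one, mul_one]
      exact Function.LeftInverse.injective
        (g := (tmulHom (M := X) (X := (regular k A).obj)).flip (1 : A)) (DFunLike.congr_fun h),
    fun x => ⟨tmul (X := (regular k A).obj) x (1 : A), by
      change ((1 : D) ⊗ₜ[k] op (1 : A)) • x = x
      exact one_smul (D ⊗[k] Aᵐᵒᵖ) x⟩⟩

end Unit

section Associator

variable (X : ModuleCat.{u} (A ⊗[k] Bᵐᵒᵖ)) (Y : ModuleCat.{u} (B ⊗[k] Cᵐᵒᵖ))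
  (Z : ModuleCat.{u} (C ⊗[k] D))

/-- `(x ⊗ y) ⊗ z ↦ x ⊗ (y ⊗ z)` -/
def assocHom : BTensor (ModuleCat.of (A ⊗[k] Cᵐᵒᵖ) (BTensor X Y)) Z →ₗ[A ⊗[k] D]
    BTensor X (ModuleCat.of (B ⊗[k] D) (BTensor Y Z)) := by
  let f : BTensor X Y →+ Z →+ BTensor X (ModuleCat.of (B ⊗[k] D) (BTensor Y Z)) :=
    liftAdd (AddMonoidHom.mk' (fun x => AddMonoidHom.mk'
        (fun y => (tmulHom (X := ModuleCat.of (B ⊗[k] D) (BTensor Y Z)) x).comp (tmulHom y))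
        (fun y y' => AddMonoidHom.ext fun z =>
          (congrArg (tmul x) (add_tmul y y' z)).trans (tmul_add _ _ _)))
        (fun x x' => AddMonoidHom.ext fun y => AddMonoidHom.ext fun z => add_tmul _ _ _))
      (fun b x y => AddMonoidHom.ext fun z => by
        refine (balanced (X := ModuleCat.of (B ⊗[k] D) (BTensor Y Z)) b x (tmul y z)).trans
          (congrArg (tmul x) ?_)
        refine (smul_tmul b (1 : D) y z).trans (congrArg (tmul _) ?_)
        exact one_smul (C ⊗[k] D) z)
  refine lift (M := ModuleCat.of (A ⊗[k] Cᵐᵒᵖ) (BTensor X Y)) f (fun c w z => ?_) (fun a d w z => ?_)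
  · induction w using induction_on with
    | zero => 
      refine (congrArg (fun w => f w z) (smul_zero ((1 : A) ⊗ₜ[k] op c))).trans ?_
      rw [map_zero]; rfl
    | add w w' h h' =>
      refine (congrArg (fun w => f w z) (smul_add ((1 : A) ⊗ₜ[k] op c) w w')).trans ?_
      rw [map_add, map_add]
      exact congrArg₂ (· + ·) h h'
    | tmul x y =>
      refine (congrArg (fun w => f w z) (smul_tmul (1 : A) (op c) x y)).trans ?_
      change tmul (X := ModuleCat.of (B ⊗[k] D) (BTensor Y Z)) ((1 : A ⊗[k] Bᵐᵒᵖ) • x) (tmul _ z) =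
        tmul (X := ModuleCat.of (B ⊗[k] D) (BTensor Y Z)) x (tmul y _)
      rw [one_smul]
      exact congrArg (tmul x) (balanced c y z)
  · induction w using induction_on with
    | zero =>
      refine (congrArg (fun w => f w _) (smul_zero (a ⊗ₜ[k] (1 : Cᵐᵒᵖ)))).trans ?_
      rw [map_zero]; exact (smul_zero _).symm
    | add w w' h h' =>
      refine (congrArg (fun w => f w _) (smul_add (a ⊗ₜ[k] (1 : Cᵐᵒᵖ)) w w')).trans ?_
      rw [map_add, map_add]
      exact (congrArg₂ (· + ·) h h').trans (smul_add _ _ _).symm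
    | tmul x y =>
      refine (congrArg (fun w => f w _) (smul_tmul a (1 : Cᵐᵒᵖ) x y)).trans ?_
      refine Eq.trans ?_ (smul_tmul (X := ModuleCat.of (B ⊗[k] D) (BTensor Y Z)) a d x
        (tmul y z)).symm
      refine congrArg (tmul _) ?_
      refine Eq.trans ?_ (smul_tmul (1 : B) d y z).symm
      rfl

/-- `x ⊗ (y ⊗ z) ↦ (x ⊗ y) ⊗ z` -/
def assocInv : BTensor X (ModuleCat.of (B ⊗[k] D) (BTensor Y Z)) →+
    BTensor (ModuleCat.of (A ⊗[k] Cᵐᵒᵖ) (BTensor X Y)) Z := by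
  let f (x : X) : BTensor Y Z →+ BTensor (ModuleCat.of (A ⊗[k] Cᵐᵒᵖ) (BTensor X Y)) Z :=
    liftAdd ((tmulHom (M := ModuleCat.of (A ⊗[k] Cᵐᵒᵖ) (BTensor X Y))).comp (tmulHom x))
      (fun c y z => by
        refine Eq.trans ?_ (balanced (M := ModuleCat.of (A ⊗[k] Cᵐᵒᵖ) (BTensor X Y)) c
          (tmul x y) z)
        refine congrArg (fun w => tmul (M := ModuleCat.of (A ⊗[k] Cᵐᵒᵖ) (BTensor X Y)) w z) ?_
        refine Eq.trans ?_ (smul_tmul (1 : A) (op c) x y).symm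
        exact congrArg (fun w => tmul w _) (one_smul (A ⊗[k] Bᵐᵒᵖ) x).symm)
  refine liftAdd (AddMonoidHom.mk' f (fun x x' => hom_ext fun y z => ?_)) (fun b x w => ?_)
  · refine (congrArg (fun w => tmul (M := ModuleCat.of (A ⊗[k] Cᵐᵒᵖ) (BTensor X Y)) w z)
      (add_tmul x x' y)).trans (add_tmul _ _ _)
  · change f _ _ = f _ _
    induction w using induction_on with
    | zero => 
      rw [map_zero]
      exact ((congrArg (f x) (smul_zero (b ⊗ₜ[k] (1 : D)))).trans (map_zero _)).symm
    | add w w' h h' =>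
      rw [map_add, h, h']
      exact ((congrArg (f x) (smul_add (b ⊗ₜ[k] (1 : D)) w w')).trans (map_add _ _ _)).symm
    | tmul y z =>
      refine Eq.trans ?_ (congrArg (f x) (smul_tmul b (1 : D) y z)).symm
      change tmul (M := ModuleCat.of (A ⊗[k] Cᵐᵒᵖ) (BTensor X Y)) (tmul _ y) z =
        tmul (M := ModuleCat.of (A ⊗[k] Cᵐᵒᵖ) (BTensor X Y)) (tmul x _) ((1 : C ⊗[k] D) • z)
      rw [one_smul, balanced]

/-- `(X ⊗_B Y) ⊗_C Z ≃ X ⊗_B (Y ⊗_C Z)` -/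
def assoc : BTensor (ModuleCat.of (A ⊗[k] Cᵐᵒᵖ) (BTensor X Y)) Z ≃ₗ[A ⊗[k] D]
    BTensor X (ModuleCat.of (B ⊗[k] D) (BTensor Y Z)) :=
  { assocHom X Y Z with
    invFun := assocInv X Y Z
    left_inv := by
      have h : (assocInv X Y Z).comp (assocHom X Y Z).toAddMonoidHom = AddMonoidHom.id _ :=
        hom_ext fun w z => by
          induction w using induction_on with
          | zero =>
            have h : tmul (M := ModuleCat.of (A ⊗[k] Cᵐᵒᵖ) (BTensor X Y)) 0 z = 0 :=
              ((tmulHom (M := ModuleCat.of (A ⊗[k] Cᵐᵒᵖ) (BTensor X Y)) (X := Z)).flip z).map_zero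
            exact (congrArg _ h).trans ((map_zero _).trans h.symm)
          | add w w' h h' =>
            have e := add_tmul (M := ModuleCat.of (A ⊗[k] Cᵐᵒᵖ) (BTensor X Y)) w w' z
            refine (congrArg _ e).trans ((map_add _ _ _).trans ?_)
            exact (congrArg₂ (· + ·) h h').trans e.symm
          | tmul x y => rfl
      exact DFunLike.congr_fun h
    right_inv := by
      have h : (assocHom X Y Z).toAddMonoidHom.comp (assocInv X Y Z) = AddMonoidHom.id _ :=
        hom_ext fun x w => by
          induction w using induction_on with
          | zero =>
            have h : tmul (X := ModuleCat.of (B ⊗[k] D) (BTensor Y Z)) x 0 = 0 :=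
              (tmulHom (X := ModuleCat.of (B ⊗[k] D) (BTensor Y Z)) x).map_zero
            exact (congrArg _ h).trans ((map_zero _).trans h.symm)
          | add w w' h h' =>
            have e := tmul_add (X := ModuleCat.of (B ⊗[k] D) (BTensor Y Z)) x w w'
            refine (congrArg _ e).trans ((map_add _ _ _).trans ?_)
            exact (congrArg₂ (· + ·) h h').trans e.symm
          | tmul y z => rfl
      exact DFunLike.congr_fun h }

variable {X Y Z} in
/-- Linear maps from `(X ⊗_B Y) ⊗_C Z` are determined by their values on `(x ⊗ y) ⊗ z`. -/
lemma linearMap_ext_assoc {P : Type u} [AddCommGroup P] [Module (A ⊗[k] D) P]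
    {f g : BTensor (ModuleCat.of (A ⊗[k] Cᵐᵒᵖ) (BTensor X Y)) Z →ₗ[A ⊗[k] D] P}
    (h : ∀ x y z, f (tmul (M := ModuleCat.of (A ⊗[k] Cᵐᵒᵖ) (BTensor X Y)) (tmul x y) z) =
      g (tmul (M := ModuleCat.of (A ⊗[k] Cᵐᵒᵖ) (BTensor X Y)) (tmul x y) z)) : f = g :=
  linearMap_ext fun w z => by
    have h' : (f.toAddMonoidHom.comp ((tmulHom (M := ModuleCat.of (A ⊗[k] Cᵐᵒᵖ)
        (BTensor X Y)) (X := Z)).flip z)) = g.toAddMonoidHom.comp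
        ((tmulHom (M := ModuleCat.of (A ⊗[k] Cᵐᵒᵖ) (BTensor X Y)) (X := Z)).flip z) :=
      hom_ext fun x y => h x y z
    exact DFunLike.congr_fun h' w

end Associator

end BTensor

variable [Module.Finite k A] [Module.Finite k B] [Module.Finite k C] [Module.Finite k D]

/-- A linear equivalence as an isomorphism of finitely generated modules. -/
def FGModuleCat.isoOfLinearEquiv {R : Type u} [Ring R] {X Y : FGModuleCat.{u} R}
    (e : X.obj ≃ₗ[R] Y.obj) : X ≅ Y where
  hom := FGModuleCat.ofHom e.toLinearMap
  inv := FGModuleCat.ofHom e.symm.toLinearMap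
  hom_inv_id := FGModuleCat.hom_ext (LinearMap.ext e.symm_apply_apply)
  inv_hom_id := FGModuleCat.hom_ext (LinearMap.ext e.apply_symm_apply)

variable (k A D) in
/-- `A ⊗_A -` is the identity functor. -/
def tensorLeftRegular : tensorLeft (D := D) (regular k A) ≅ 𝟭 (FGModuleCat.{u} (A ⊗[k] D)) :=
  NatIso.ofComponents (fun X => FGModuleCat.isoOfLinearEquiv (BTensor.leftUnit X.obj))
    (fun f => FGModuleCat.hom_ext (BTensor.linearMap_ext fun _ _ =>
      (f.hom.hom.map_smul _ _).symm))

variable (k A D) in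
/-- `- ⊗_A A` is the identity functor. -/
def tensorRightRegular :
    tensorRight (A := D) (regular k A) ≅ 𝟭 (FGModuleCat.{u} (D ⊗[k] Aᵐᵒᵖ)) :=
  NatIso.ofComponents (fun X => FGModuleCat.isoOfLinearEquiv (BTensor.rightUnit X.obj))
    (fun f => FGModuleCat.hom_ext (BTensor.linearMap_ext fun _ _ =>
      (f.hom.hom.map_smul _ _).symm))

/-- `(M ⊗_B N) ⊗_C - ≅ M ⊗_B (N ⊗_C -)` -/
def tensorLeftTensor (M : FGModuleCat.{u} (A ⊗[k] Bᵐᵒᵖ)) (N : FGModuleCat.{u} (B ⊗[k] Cᵐᵒᵖ)) :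
    tensorLeft (D := D) ((tensorLeft M).obj N) ≅ tensorLeft N ⋙ tensorLeft M :=
  NatIso.ofComponents (fun X => FGModuleCat.isoOfLinearEquiv (BTensor.assoc M.obj N.obj X.obj))
    (fun _ => FGModuleCat.hom_ext (BTensor.linearMap_ext_assoc fun _ _ _ => rfl))

/-- `- ⊗_B (M ⊗_C N) ≅ (- ⊗_B M) ⊗_C N` -/
def tensorRightTensor (M : FGModuleCat.{u} (B ⊗[k] Cᵐᵒᵖ)) (N : FGModuleCat.{u} (C ⊗[k] D)) :
    tensorRight M ⋙ tensorRight N ≅ tensorRight (A := A) ((tensorLeft M).obj N) :=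
  NatIso.ofComponents (fun X => FGModuleCat.isoOfLinearEquiv (BTensor.assoc X.obj M.obj N.obj))
    (fun _ => FGModuleCat.hom_ext (BTensor.linearMap_ext_assoc fun _ _ _ => rfl))

/-- `(M ⊗_B -) ⊗_C N ≅ M ⊗_B (- ⊗_C N)` -/
def tensorLeftRight (M : FGModuleCat.{u} (A ⊗[k] Bᵐᵒᵖ)) (N : FGModuleCat.{u} (C ⊗[k] D)) :
    tensorLeft M ⋙ tensorRight N ≅ tensorRight N ⋙ tensorLeft M :=
  NatIso.ofComponents (fun X => FGModuleCat.isoOfLinearEquiv (BTensor.assoc M.obj X.obj N.obj))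
    (fun _ => FGModuleCat.hom_ext (BTensor.linearMap_ext_assoc fun _ _ _ => rfl))

end UnitAssociator

/-! ### Projective bimodules are projective on each side. -/

section RestrictedProjective

/-- Restriction of scalars preserves projectivity if the larger ring is projective. -/
lemma Module.Projective.restrictScalars_obj {S R : Type u} [Ring S] [Ring R] (φ : S →+* R)
    (hφ : Module.Projective S ((ModuleCat.restrictScalars φ).obj (ModuleCat.of R R)))
    (P : ModuleCat.{u} R) (hP : Module.Projective R P) :
    Module.Projective S ((ModuleCat.restrictScalars φ).obj P) := by
  obtain ⟨s, hs⟩ := hP.out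
  let F := (ModuleCat.restrictScalars φ).obj (ModuleCat.of R R)
  let i : (ModuleCat.restrictScalars φ).obj P →ₗ[S] (P →₀ F) :=
    { s.toAddMonoidHom with
      map_smul' := fun a x => Finsupp.ext fun j => DFunLike.congr_fun (s.map_smul (φ a) x) j }
  let π : (P →₀ F) →ₗ[S] (ModuleCat.restrictScalars φ).obj P :=
    { (Finsupp.linearCombination R (id : P → P)).toAddMonoidHom with
      map_smul' := fun a x => ((congrArg (Finsupp.linearCombination R (id : P → P))
        (Finsupp.ext fun j => rfl)).trans ((Finsupp.linearCombination R (id : P → P)).map_smul (φ a) x)) }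
  classical
  have : Module.Projective S (P →₀ F) := Module.Projective.of_equiv (finsuppLequivDFinsupp S).symm
  exact Module.Projective.of_split i π (LinearMap.ext hs)

variable {k : Type u} [Field k] {A E : Type u} [Ring A] [Algebra k A] [Ring E] [Algebra k E]

lemma inclLeft_mul (a : A) (x : A ⊗[k] E) : inclLeft k A E a * x = a • x := by
  induction x using TensorProduct.induction_on with
  | zero => rw [mul_zero, smul_zero]
  | add x y hx hy => rw [mul_add, hx, hy, smul_add]
  | tmul b e =>
    exact (Algebra.TensorProduct.tmul_mul_tmul _ _ _ _).trans (congrArg _ (one_mul e))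

/-- A basis of `E` over the field `k` is a basis of `A ⊗ E` over `A`. -/
lemma projective_resLeft (P : ModuleCat.{u} (A ⊗[k] E)) (hP : Module.Projective (A ⊗[k] E) P) :
    Module.Projective A (resLeft P) := by
  refine Module.Projective.restrictScalars_obj (inclLeft k A E) ?_ P hP
  let e : (A ⊗[k] E) ≃ₗ[A]
      (ModuleCat.restrictScalars (inclLeft k A E)).obj (ModuleCat.of (A ⊗[k] E) (A ⊗[k] E)) :=
    { AddEquiv.refl (A ⊗[k] E) with map_smul' := fun a x => (inclLeft_mul a x).symm }
  have := Module.Projective.of_basis (Algebra.TensorProduct.basis A (Module.Free.chooseBasis k E))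
  exact Module.Projective.of_equiv e

/-- Exchanging the tensor factors reduces this to freeness of `E ⊗ A` over `E`. -/
lemma projective_resRight (P : ModuleCat.{u} (A ⊗[k] E)) (hP : Module.Projective (A ⊗[k] E) P) :
    Module.Projective E (resRight P) := by
  refine Module.Projective.restrictScalars_obj (inclRight k A E) ?_ P hP
  let e : (E ⊗[k] A) ≃ₗ[E]
      (ModuleCat.restrictScalars (inclRight k A E)).obj (ModuleCat.of (A ⊗[k] E) (A ⊗[k] E)) :=
    { (Algebra.TensorProduct.comm k E A).toAddEquiv with
      map_smul' := fun a x =>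
        (congrArg (Algebra.TensorProduct.comm k E A) (inclLeft_mul a x).symm).trans
          (map_mul (Algebra.TensorProduct.comm k E A) _ x) }
  have := Module.Projective.of_basis (Algebra.TensorProduct.basis E (Module.Free.chooseBasis k A))
  exact Module.Projective.of_equiv e

/-- Projective bimodules are projective on both sides. -/
lemma IsLeftRightProjective.of_projective (P : FGModuleCat.{u} (A ⊗[k] E))
    (hP : Module.Projective (A ⊗[k] E) P.obj) : IsLeftRightProjective P :=
  ⟨projective_resLeft P.obj hP, projective_resRight P.obj hP⟩

end RestrictedProjective

/-! ### Exactness of the bar complex and one-sided projectivity of its syzygies. -/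

section BarComplex

open scoped ModuleCat.Algebra
open MulOpposite

variable {k : Type u} [Field k] {A : Type u} [Ring A] [Algebra k A] [Module.Finite k A]

/-- The universal property of `A ⊗_k X`. -/
def freeLeftLift (X : FGBimod k A) (Q : ModuleCat.{u} (A ⊗[k] Aᵐᵒᵖ)) (t : X.obj →+ Q)
    (ht : ∀ (d : Aᵐᵒᵖ) x, t (((1 : A) ⊗ₜ[k] d) • x) = ((1 : A) ⊗ₜ[k] d) • t x) :
    (freeLeft X).obj →ₗ[A ⊗[k] Aᵐᵒᵖ] Q :=
  KTensor.lift (M := (regular k A).obj) (X := X.obj) (((BTensor.leftAct Q).comp t).flip)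
    (fun c (a : A) x => by
      change ((algebraMap k A c * (a * 1)) ⊗ₜ[k] (1 : Aᵐᵒᵖ)) • t x =
        (a ⊗ₜ[k] (1 : Aᵐᵒᵖ)) • t (c • x)
      have h : c • x = ((1 : A) ⊗ₜ[k] algebraMap k Aᵐᵒᵖ c) • x := by
        rw [Algebra.algebraMap_eq_smul_one, ← TensorProduct.smul_tmul,
          ← Algebra.algebraMap_eq_smul_one]
        rfl
      rw [h, ht, smul_smul, Algebra.TensorProduct.tmul_mul_tmul, mul_one,
        one_mul, Algebra.algebraMap_eq_smul_one, Algebra.algebraMap_eq_smul_one,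
        ← TensorProduct.smul_tmul, smul_mul_assoc, one_mul])
    (fun a d (b : A) x => by
      change ((a * (b * 1)) ⊗ₜ[k] (1 : Aᵐᵒᵖ)) • t (((1 : A) ⊗ₜ[k] d) • x) =
        (a ⊗ₜ[k] d) • (b ⊗ₜ[k] (1 : Aᵐᵒᵖ)) • t x
      rw [ht, smul_smul, smul_smul, Algebra.TensorProduct.tmul_mul_tmul,
        Algebra.TensorProduct.tmul_mul_tmul, mul_one, mul_one, mul_one, one_mul])

/-- `A ⊗_k X` is projective if `X` is projective as a right module. -/
lemma projective_freeLeft (X : FGBimod k A) (hX : Module.Projective Aᵐᵒᵖ (resRight X.obj)) :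
    Module.Projective (A ⊗[k] Aᵐᵒᵖ) (freeLeft X).obj := by
  refine Module.Projective.of_lifting_property'' fun f hf => ?_
  let Q : ModuleCat.{u} (A ⊗[k] Aᵐᵒᵖ) := ModuleCat.of _ ((freeLeft X).obj →₀ A ⊗[k] Aᵐᵒᵖ)
  let f' : resRight Q →ₗ[Aᵐᵒᵖ] resRight (freeLeft X).obj :=
    { f.toAddMonoidHom with map_smul' := fun a x => f.map_smul (inclRight k A Aᵐᵒᵖ a) x }
  let η : resRight X.obj →ₗ[Aᵐᵒᵖ] resRight (freeLeft X).obj :=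
    { toFun := fun x => KTensor.tmul (M := (regular k A).obj) (X := X.obj) (1 : A) x
      map_add' := fun x y => KTensor.tmul_add _ _ _
      map_smul' := fun d x => by
        refine Eq.trans ?_ (KTensor.smul_tmul (M := (regular k A).obj) (X := X.obj)
          (1 : A) d (1 : A) x).symm
        refine congrArg (fun y => KTensor.tmul y _) ?_
        change (1 : A) = (1 : A) * ((1 : A) * 1)
        rw [one_mul, one_mul] }
  -- Bimodule maps out of `A ⊗_k X` are right linear maps out of `X`. A section of `f` is thus a
  -- right linear lift of `x ↦ 1 ⊗ x`, which exists because `X` is projective on the right.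
  obtain ⟨s, hs⟩ := Module.projective_lifting_property f' η hf
  let g : (freeLeft X).obj →ₗ[A ⊗[k] Aᵐᵒᵖ] Q := freeLeftLift X Q s.toAddMonoidHom s.map_smul
  have hg (a : A) (x : X.obj) :
      f (g (KTensor.tmul (M := (regular k A).obj) (X := X.obj) a x)) =
        KTensor.tmul (M := (regular k A).obj) (X := X.obj) a x := by
    have h₀ : f (g (KTensor.tmul (M := (regular k A).obj) (X := X.obj) a x)) =
        (a ⊗ₜ[k] (1 : Aᵐᵒᵖ)) • f (s x) := f.map_smul (a ⊗ₜ[k] (1 : Aᵐᵒᵖ)) (s x)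
    have h₁ : f (s x) = KTensor.tmul (M := (regular k A).obj) (X := X.obj) (1 : A) x :=
      LinearMap.congr_fun hs x
    rw [h₀, h₁]
    refine (KTensor.smul_tmul (M := (regular k A).obj) (X := X.obj) a 1 (1 : A) x).trans ?_
    refine (congrArg (KTensor.tmul _) (one_smul (A ⊗[k] Aᵐᵒᵖ) x)).trans
      (congrArg (fun y => KTensor.tmul y x) ?_)
    change a * ((1 : A) * 1) = a
    rw [mul_one, mul_one]
  refine ⟨g, LinearMap.ext fun z => ?_⟩
  change f (g z) = z
  induction z using KTensor.induction_on with
  | zero => exact (congrArg f (map_zero g)).trans (map_zero f)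
  | add z w hz hw =>
    exact (congrArg f (map_add g _ _)).trans ((map_add f _ _).trans (congrArg₂ (· + ·) hz hw))
  | tmul a x => exact hg a x

variable (k A)

instance isLeftRightProjective_regular : IsLeftRightProjective (regular k A) where
  left := by
    let e : A ≃ₗ[A] resLeft (regular k A).obj :=
      { AddEquiv.refl A with
        map_smul' := fun a x => by
          change a * x = a * (x * 1)
          rw [mul_one] }
    exact Module.Projective.of_equiv e
  right := by
    let e : Aᵐᵒᵖ ≃ₗ[Aᵐᵒᵖ] resRight (regular k A).obj :=
      { (MulOpposite.opAddEquiv : A ≃+ Aᵐᵒᵖ).symm with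
        map_smul' := fun a x => by
          change unop x * unop a = (1 : A) * (unop x * unop a)
          rw [one_mul] }
    exact Module.Projective.of_equiv e

/-- The two claims are proved together: a term that is projective on the right makes the next one a
projective bimodule, and that one is in turn projective on both sides. -/
lemma projective_barObj_succ (n : ℕ) :
    Module.Projective (A ⊗[k] Aᵐᵒᵖ) (barObj k A (n + 1)).obj ∧
      IsLeftRightProjective (barObj k A n) := by
  induction n with
  | zero => exact ⟨projective_freeLeft _ (isLeftRightProjective_regular k A).right,
      isLeftRightProjective_regular k A⟩
  | succ n ih =>
    have h := IsLeftRightProjective.of_projective _ ih.1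
    exact ⟨projective_freeLeft _ h.right, h⟩

instance isLeftRightProjective_barObj (n : ℕ) : IsLeftRightProjective (barObj k A n) :=
  (projective_barObj_succ k A n).2

variable {A} in
/-- `x ↦ a ⊗ x`; for `a = 1` this is the contracting homotopy of the bar complex. -/
def barTmul (n : ℕ) (a : A) : (barObj k A n).obj →+ (barObj k A (n + 1)).obj :=
  AddMonoidHom.mk' (KTensor.tmul (M := (regular k A).obj) (X := (barObj k A n).obj) a)
    (KTensor.tmul_add _)

variable {k A} in
lemma barObj_hom_ext {n : ℕ} {P : Type*} [AddMonoid P] {f g : (barObj k A (n + 1)).obj →+ P}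
    (h : ∀ a x, f (barTmul k n a x) = g (barTmul k n a x)) : f = g :=
  AddMonoidHom.ext fun z => by
    induction z using KTensor.induction_on with
    | zero => exact (map_zero f).trans (map_zero g).symm
    | add z w hz hw =>
      exact (map_add f _ _).trans ((congrArg₂ (· + ·) hz hw).trans (map_add g _ _).symm)
    | tmul a x => exact h a x

variable {A} in
lemma barD_zero_barTmul (a : A) (x : (barObj k A 0).obj) :
    (barD k A 0).hom.hom (barTmul k 0 a x) = (a ⊗ₜ[k] (1 : Aᵐᵒᵖ)) • x := rfl

variable {A} in
lemma barD_succ_barTmul (n : ℕ) (a : A) (x : (barObj k A (n + 1)).obj) :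
    (barD k A (n + 1)).hom.hom (barTmul k (n + 1) a x) =
      (a ⊗ₜ[k] (1 : Aᵐᵒᵖ)) • x - barTmul k n a ((barD k A n).hom.hom x) := rfl

/-- Induction from the recursion `d(a ⊗ x) = a x - a ⊗ d x`: applying `d` again gives `a d x - (a d
x - a ⊗ d d x)`. -/
lemma barD_comp_barD (n : ℕ) (x : (barObj k A (n + 2)).obj) :
    (barD k A n).hom.hom ((barD k A (n + 1)).hom.hom x) = 0 := by
  suffices h : (barD k A n).hom.hom.toAddMonoidHom.comp (barD k A (n + 1)).hom.hom.toAddMonoidHom =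
      0 from DFunLike.congr_fun h x
  induction n with
  | zero =>
    refine barObj_hom_ext fun a x => ?_
    change (barD k A 0).hom.hom ((barD k A 1).hom.hom (barTmul k 1 a x)) = 0
    rw [barD_succ_barTmul, map_sub, map_smul, barD_zero_barTmul, sub_self]
  | succ n ih =>
    refine barObj_hom_ext fun a x => ?_
    change (barD k A (n + 1)).hom.hom ((barD k A (n + 2)).hom.hom (barTmul k (n + 2) a x)) = 0
    have h : (barD k A n).hom.hom ((barD k A (n + 1)).hom.hom x) = 0 := DFunLike.congr_fun (ih x) x
    rw [barD_succ_barTmul, map_sub, map_smul, barD_succ_barTmul, h, map_zero, sub_zero, sub_self]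

/-- The map `x ↦ 1 ⊗ x` contracts the complex: `d x = 0` implies `d(1 ⊗ x) = x`. -/
lemma exact_barD (n : ℕ) :
    Function.Exact (barD k A (n + 1)).hom.hom (barD k A n).hom.hom := fun x =>
  ⟨fun hx => ⟨barTmul k (n + 1) 1 x, by
    rw [barD_succ_barTmul, hx, map_zero, sub_zero]
    exact one_smul (A ⊗[k] Aᵐᵒᵖ) x⟩,
  by rintro ⟨y, rfl⟩; exact barD_comp_barD k A n y⟩

/-- The inclusion `Ω^(r+1)(A) ⟶ A^{⊗ (r + 2)}`. -/
def syzygyι (r : ℕ) : syzygy k A (r + 1) ⟶ barObj k A (r + 1) :=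
  FGModuleCat.ofHom (LinearMap.range (barD k A (r + 1)).hom.hom).subtype

/-- The projection `A^{⊗ (r + 2)} ⟶ Ω^r(A)`. -/
def syzygyπ : (r : ℕ) → (barObj k A (r + 1) ⟶ syzygy k A r)
  | 0 => barD k A 0
  | r + 1 => FGModuleCat.ofHom (barD k A (r + 1)).hom.hom.rangeRestrict

lemma syzygyι_injective (r : ℕ) : Function.Injective (syzygyι k A r).hom.hom :=
  Subtype.val_injective

lemma syzygyπ_surjective : (r : ℕ) → Function.Surjective (syzygyπ k A r).hom.hom
  | 0 => fun x => ⟨barTmul k 0 1 x, one_smul (A ⊗[k] Aᵐᵒᵖ) x⟩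
  | r + 1 => (barD k A (r + 1)).hom.hom.surjective_rangeRestrict

lemma syzygyπ_eq_zero_iff (r : ℕ) (x : (barObj k A (r + 1)).obj) :
    (syzygyπ k A r).hom.hom x = 0 ↔ (barD k A r).hom.hom x = 0 :=
  match r with
  | 0 => Iff.rfl
  | _ + 1 => Subtype.ext_iff

lemma syzygy_exact (r : ℕ) :
    Function.Exact (syzygyι k A r).hom.hom (syzygyπ k A r).hom.hom := fun x => by
  rw [syzygyπ_eq_zero_iff, exact_barD k A r x]
  exact ⟨fun ⟨y, hy⟩ => ⟨⟨x, y, hy⟩, rfl⟩, by rintro ⟨⟨_, y, rfl⟩, rfl⟩; exact ⟨y, rfl⟩⟩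

lemma nonempty_syzygySplitting {S : Type u} [Ring S] (φ : S →+* A ⊗[k] Aᵐᵒᵖ) (r : ℕ)
    (h : Module.Projective S ((ModuleCat.restrictScalars φ).obj (syzygy k A r).obj)) :
    Nonempty (RestrictedSplitting φ (syzygyι k A r).hom.hom (syzygyπ k A r).hom.hom) :=
  RestrictedSplitting.nonempty _ _ (syzygyι_injective k A r) (syzygyπ_surjective k A r)
    (syzygy_exact k A r) h

/-- If `Ω^r` is projective on one side, the bar sequence splits on that side and exhibits `Ω^(r+1)`
as a summand of a bar term there. -/
instance isLeftRightProjective_syzygy (r : ℕ) : IsLeftRightProjective (syzygy k A r) := by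
  induction r with
  | zero => exact isLeftRightProjective_regular k A
  | succ r ih =>
    obtain ⟨e⟩ := nonempty_syzygySplitting k A (inclLeft k A Aᵐᵒᵖ) r ih.left
    obtain ⟨e'⟩ := nonempty_syzygySplitting k A (inclRight k A Aᵐᵒᵖ) r ih.right
    exact ⟨e.projective (isLeftRightProjective_barObj k A (r + 1)).left,
      e'.projective (isLeftRightProjective_barObj k A (r + 1)).right⟩

end BarComplex

/-! ### The syzygy systems of an algebra, and graded commutativity. -/

section SyzygySystems

open scoped ModuleCat.Algebra
open MulOpposite

variable (k : Type u) [Field k] (A : Type u) [Ring A] [Algebra k A] [Module.Finite k A]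

/-- The functors `- ⊗_A Ω^r(A)`. -/
def rightSyzygySystem : SyzygySystem (regular k A)
    (fun r => tensorRight (A := A) (syzygy k A r))
    (fun r => tensorRight (A := A) (barObj k A (r + 1))) where
  lift _ := SgLift.ofExact _
  liftV _ := SgLift.ofExact _
  i r := tensorRightMap (syzygyι k A r)
  p r := tensorRightMap (syzygyπ k A r)
  ses r := isFunctorSES_tensorRight _ _
    (nonempty_syzygySplitting k A (inclLeft k A Aᵐᵒᵖ) r (isLeftRightProjective_syzygy k A r).left).some
  projective r := Projective.of_iso ((tensorLeftRegular k A Aᵐᵒᵖ).app (barObj k A (r + 1))).symm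
    ((FGModuleCat.projective_iff _).2 (projective_barObj_succ k A r).1)
  iso := (tensorRightRegular k A A).symm

/-- The functors `Ω^r(A) ⊗_A -`. -/
def leftSyzygySystem : SyzygySystem (regular k A)
    (fun r => tensorLeft (D := Aᵐᵒᵖ) (syzygy k A r))
    (fun r => tensorLeft (D := Aᵐᵒᵖ) (barObj k A (r + 1))) where
  lift _ := SgLift.ofExact _
  liftV _ := SgLift.ofExact _
  i r := tensorLeftMap (syzygyι k A r)
  p r := tensorLeftMap (syzygyπ k A r)
  ses r := isFunctorSES_tensorLeft _ _
    (nonempty_syzygySplitting k A (inclRight k A Aᵐᵒᵖ) r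
      (isLeftRightProjective_syzygy k A r).right).some
  projective r := Projective.of_iso ((tensorRightRegular k A A).app (barObj k A (r + 1))).symm
    ((FGModuleCat.projective_iff _).2 (projective_barObj_succ k A r).1)
  iso := (tensorLeftRegular k A Aᵐᵒᵖ).symm

variable {k A}

/-- Naturality of the isomorphism `A ⊗_A N ≅ N` in `N`. -/
lemma tensorRightMap_app_regular {N N' : FGBimod k A} (φ : N ⟶ N') :
    (tensorRightMap (A := A) φ).app (regular k A) =
      ((tensorLeftRegular k A Aᵐᵒᵖ).hom.app N ≫ φ) ≫ (tensorLeftRegular k A Aᵐᵒᵖ).inv.app N' :=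
  (Iso.eq_comp_inv ((tensorLeftRegular k A Aᵐᵒᵖ).app N')).2
    ((tensorLeftRegular k A Aᵐᵒᵖ).hom.naturality φ)

lemma tensorLeftMap_app_regular {N N' : FGBimod k A} (φ : N ⟶ N') :
    (tensorLeftMap (D := Aᵐᵒᵖ) φ).app (regular k A) =
      ((tensorRightRegular k A A).hom.app N ≫ φ) ≫ (tensorRightRegular k A A).inv.app N' :=
  (Iso.eq_comp_inv ((tensorRightRegular k A A).app N')).2
    ((tensorRightRegular k A A).hom.naturality φ)

/-- A bimodule map `A ⊗_A N → A ⊗_A N'` is a map `N → N'` up to the unit isomorphisms, and `- ⊗_A`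
turns the latter into a natural transformation. This is the hypothesis `full` of the syzygy
argument. -/
lemma exists_tensorRightMap {N N' : FGBimod k A}
    (f : (tensorRight (A := A) N).obj (regular k A) ⟶ (tensorRight N').obj (regular k A)) :
    ∃ τ : tensorRight (A := A) N ⟶ tensorRight (A := A) N', τ.app (regular k A) = f := by
  refine ⟨tensorRightMap ((tensorLeftRegular k A Aᵐᵒᵖ).inv.app N ≫ f ≫
    (tensorLeftRegular k A Aᵐᵒᵖ).hom.app N'), (tensorRightMap_app_regular _).trans ?_⟩
  refine (Iso.comp_inv_eq ((tensorLeftRegular k A Aᵐᵒᵖ).app N')).2 ?_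
  exact Iso.hom_inv_id_assoc ((tensorLeftRegular k A Aᵐᵒᵖ).app N) _

theorem isGradedCommutative_regularSg : GrEnd.IsGradedCommutative (regularSg k A) :=
  (rightSyzygySystem k A).isGradedCommutative fun _ _ f => exists_tensorRightMap f

end SyzygySystems

/-! ### From the stable category to the singularity category. -/

section StableToSg

variable {C : Type u} [Category.{v} C] [Abelian C]

instance : (toDsg (C := C)).Additive where
  map_add {X Y f g} := by
    have h : (SgLift.toBounded C).map (f + g) =
        (SgLift.toBounded C).map f + (SgLift.toBounded C).map g :=
      (BoundedDerived.ι C).map_injective ((DerivedCategory.singleFunctor C 0).map_add (f := f) (g := g))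
    exact (congrArg (IsPerfectB C).trW.Q.map h).trans ((IsPerfectB C).trW.Q.map_add)

instance {E : Type u} [Category.{v} E] [Abelian E] (F : C ⥤ E) [F.Additive]
    [PreservesFiniteLimits F] [PreservesFiniteColimits F] [F.PreservesProjectiveObjects] :
    (mapDsg F).Additive := by
  rw [Localization.functor_additive_iff (IsPerfectB C).trW.Q (IsPerfectB C).trW]
  have : (mapBoundedDerived F ⋙ (IsPerfectB E).trW.Q).Additive := inferInstance
  exact Functor.additive_of_iso (F := mapBoundedDerived F ⋙ (IsPerfectB E).trW.Q)
    (SgLift.ofExact F).isoSg.symm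

open scoped ZeroObject in
-- The cone of `0 → P` is `P`, a perfect object, so this morphism becomes invertible.
lemma isZero_toDsg (P : C) [Projective P] : IsZero (toDsg.obj P) := by
  let f : (0 : BoundedDerived C) ⟶ (SgLift.toBounded C).obj P := 0
  have h : (IsPerfectB C).trW f :=
    ⟨_, _, _, contractible_distinguished₁ _, isPerfectB_toBounded P⟩
  have := Localization.inverts (IsPerfectB C).trW.Q _ _ h
  exact ((IsPerfectB C).trW.Q.map_isZero (isZero_zero _)).of_iso
    (asIso ((IsPerfectB C).trW.Q.map f)).symm

variable (C) in
/-- The functor from the stable category to the singularity category. -/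
def stableToDsg : StableCategory C ⥤ Dsg C :=
  CategoryTheory.Quotient.lift _ toDsg (by
    rintro X Y f g ⟨P, hP, a, b, hab⟩
    rw [← sub_eq_zero, ← toDsg.map_sub, hab, toDsg.map_comp,
      (isZero_toDsg P).eq_of_src (toDsg.map b) 0, comp_zero])

/-- The functor `toDsg` kills projectives and so factors through the stable category. An honest
morphism `φ` representing the stable isomorphism is extracted because natural transformations of
tensor functors are built from bimodule maps. -/
lemma exists_isIso_toDsg {X Y : C} (e : (toStable C).obj X ≅ (toStable C).obj Y) :
    ∃ φ : X ⟶ Y, IsIso (toDsg.map φ) := by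
  obtain ⟨φ, hφ⟩ := (Quotient.functor (stableRel C)).map_surjective e.hom
  refine ⟨φ, ?_⟩
  have h : toDsg.map φ = (stableToDsg C).map e.hom := by rw [← hφ]; rfl
  rw [h]
  exact inferInstanceAs (IsIso ((stableToDsg C).map e.hom))

end StableToSg

/-! ### Composing invertible intertwiners. -/

section AreIntertwined

universe v₁ v₂ v₃ u₁ u₂ u₃

variable {C : Type u₁} [Category.{v₁} C] [HasShift C ℤ]
  {D : Type u₂} [Category.{v₂} D] [HasShift D ℤ] [Preadditive D]
  {D' : Type u₃} [Category.{v₃} D'] [HasShift D' ℤ] [Preadditive D']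
  [∀ n : ℤ, (shiftFunctor D n).Additive] [∀ n : ℤ, (shiftFunctor D' n).Additive] {X : C}

/-- There is an isomorphism of degree `a` that intertwines `θ` and `θ'`. -/
def AreIntertwined {W W' : D} (θ : GrEndMaps X W) (θ' : GrEndMaps X W') (a : ℤ) : Prop :=
  ∃ w : ShiftedHom W W' a, IsIso w ∧ Intertwines θ θ' w

namespace AreIntertwined

omit [∀ n : ℤ, (shiftFunctor D' n).Additive] [Preadditive D'] in
lemma comp {W W' W'' : D} {θ : GrEndMaps X W} {θ' : GrEndMaps X W'} {θ'' : GrEndMaps X W''}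
    {a b c : ℤ} (h : AreIntertwined θ θ' a) (h' : AreIntertwined θ' θ'' b) (hc : b + a = c) :
    AreIntertwined θ θ'' c := by
  obtain ⟨w, _, hw⟩ := h
  obtain ⟨w', _, hw'⟩ := h'
  exact ⟨w.comp w' hc, inferInstance, hw.comp hw' hc⟩

omit [∀ n : ℤ, (shiftFunctor D n).Additive] [∀ n : ℤ, (shiftFunctor D' n).Additive] in
-- Whiskering at a single object: applying `H` to the relation between the identity and `F` gives
-- the one between `H` and `F` followed by `H`, and additivity of `H` preserves the sign.
lemma map {X : D} {F : D ⥤ D} [F.CommShift ℤ] {a : ℤ}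
    (h : AreIntertwined (GrEndMaps.ofFunctor (𝟭 D) X) (GrEndMaps.ofFunctor F X) a) (H : D ⥤ D')
    [H.CommShift ℤ] [H.Additive] :
    AreIntertwined (GrEndMaps.ofFunctor H X) (GrEndMaps.ofFunctor (F ⋙ H) X) a := by
  obtain ⟨w, _, hw⟩ := h
  refine ⟨w.map H, inferInstance, fun n c f hc => ?_⟩
  have h₁ : GrEndMaps.ofFunctor H X n f = (GrEndMaps.ofFunctor (𝟭 D) X n f).map H :=
    congrArg (fun x : ShiftedHom X X n => x.map H) (ShiftedHom.id_map f).symm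
  have h₂ : GrEndMaps.ofFunctor (F ⋙ H) X n f = (GrEndMaps.ofFunctor F X n f).map H :=
    ShiftedHom.comp_map f F H
  have h₃ : ((GrEndMaps.ofFunctor (𝟭 D) X n f).map H).comp (w.map H) hc = (a * n).negOnePow •
      (w.map H).comp ((GrEndMaps.ofFunctor F X n f).map H) ((add_comm n a).trans hc) := by
    rw [← ShiftedHom.map_comp, ← ShiftedHom.map_comp, hw n c f hc]
    simp only [ShiftedHom.map, Functor.map_units_smul, Linear.units_smul_comp]
  exact (congrArg (fun x => ShiftedHom.comp (X := H.obj X) (Y := H.obj X) x (w.map H) hc)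
    h₁).trans (h₃.trans (congrArg (fun x => (a * n).negOnePow • ShiftedHom.comp (X := H.obj X)
      (Z := H.obj (F.obj X)) (w.map H) x ((add_comm n a).trans hc)) h₂.symm))

end AreIntertwined

end AreIntertwined

section

variable {C E : Type u} [Category.{v} C] [Abelian C] [Category.{v} E] [Abelian E]

lemma SgLift.areIntertwined {F G : C ⥤ E} [F.Additive] [G.Additive] (S : SgLift F) (T : SgLift G)
    (τ : F ⟶ G) (X : C) [IsIso (toDsg.map (τ.app X))] :
    AreIntertwined (GrEndMaps.ofFunctor S.sg (toDsg.obj X))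
      (GrEndMaps.ofFunctor T.sg (toDsg.obj X)) 0 :=
  ⟨_, by rw [S.sgOfNatTrans_app T τ]; infer_instance,
    S.intertwines T (S.sgNat T (S.bddOfNatTrans T τ)) (toDsg.obj X)⟩

/-- The intertwiner is `σ r` followed by the component of `τ`. Only the component at `A` has to be
invertible, and only in the singularity category. -/
lemma SyzygySystem.areIntertwined {A : C} {R V : ℕ → C ⥤ C} [∀ r, (R r).Additive]
    [∀ r, (V r).Additive] (T : SyzygySystem A R V) (r : ℕ) {G : C ⥤ C} [G.Additive]
    (S : SgLift G) (τ : R r ⟶ G) [IsIso (toDsg.map (τ.app A))] :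
    AreIntertwined (GrEndMaps.ofFunctor (𝟭 (Dsg C)) (toDsg.obj A))
      (GrEndMaps.ofFunctor S.sg (toDsg.obj A)) r :=
  AreIntertwined.comp (θ' := GrEndMaps.ofFunctor (T.lift r).sg (toDsg.obj A))
    ⟨T.σ r, T.isIso_σ r, T.intertwines_σ r⟩ ((T.lift r).areIntertwined S τ A) (zero_add _)

end

/-! ### The two functors of a singular equivalence of Morita type. -/

section SingularEquivalenceProof

open scoped ModuleCat.Algebra
open MulOpposite

variable {k : Type u} [Field k] {A B : Type u} [Ring A] [Algebra k A] [Ring B] [Algebra k B]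
  [Module.Finite k A] [Module.Finite k B]

lemma CategoryTheory.Functor.isIso_map_of_eq_conj {C D : Type*} [Category* C] [Category* D]
    (T : C ⥤ D) {X Y X' Y' : C} (e : X ≅ X') (e' : Y ≅ Y') (φ : X' ⟶ Y') [IsIso (T.map φ)]
    {f : X ⟶ Y} (hf : f = (e.hom ≫ φ) ≫ e'.inv) : IsIso (T.map f) := by
  rw [hf, T.map_comp, T.map_comp]
  infer_instance

lemma isIso_toDsg_tensorRightMap {N N' : FGBimod k A} (φ : N ⟶ N') [IsIso (toDsg.map φ)] :
    IsIso (toDsg.map ((tensorRightMap (A := A) φ).app (regular k A))) :=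
  toDsg.isIso_map_of_eq_conj ((tensorLeftRegular k A Aᵐᵒᵖ).app N) ((tensorLeftRegular k A Aᵐᵒᵖ).app N')
    φ (tensorRightMap_app_regular φ)

lemma isIso_toDsg_tensorLeftMap {N N' : FGBimod k A} (φ : N ⟶ N') [IsIso (toDsg.map φ)] :
    IsIso (toDsg.map ((tensorLeftMap (D := Aᵐᵒᵖ) φ).app (regular k A))) :=
  toDsg.isIso_map_of_eq_conj ((tensorRightRegular k A A).app N) ((tensorRightRegular k A A).app N')
    φ (tensorLeftMap_app_regular φ)

variable {l : ℕ} {M : FGModuleCat.{u} (A ⊗[k] Bᵐᵒᵖ)} {N : FGModuleCat.{u} (B ⊗[k] Aᵐᵒᵖ)}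

section

variable [IsLeftRightProjective M] [IsLeftRightProjective N]

variable (M N) in
/-- The lift of `N ⊗_A (M ⊗_B -)`. -/
abbrev leftLift : SgLift (tensorLeft (D := Bᵐᵒᵖ) M ⋙ tensorLeft (D := Bᵐᵒᵖ) N) :=
  (SgLift.ofExact (tensorLeft M)).comp (SgLift.ofExact (tensorLeft N))

variable (M N) in
/-- The lift of `(- ⊗_B N) ⊗_A M`. -/
abbrev rightLift : SgLift (tensorRight (A := B) N ⋙ tensorRight (A := B) M) :=
  (SgLift.ofExact (tensorRight N)).comp (SgLift.ofExact (tensorRight M))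

/-- At the bimodule `B`, the transformation `Ω^l(B) ⊗_B - → (N ⊗_A M) ⊗_B -` induced by `φ` is `φ`
itself up to unit isomorphisms, hence invertible in the singularity category. -/
lemma areIntertwined_left (φ : syzygy k B l ⟶ (tensorLeft N).obj M) [IsIso (toDsg.map φ)] :
    AreIntertwined (GrEndMaps.ofFunctor (𝟭 (Dsg (FGBimod k B))) (regularSg k B))
      (GrEndMaps.ofFunctor (leftLift M N).sg (regularSg k B)) l := by
  have h : IsIso (toDsg.map ((tensorLeftMap (D := Bᵐᵒᵖ) φ ≫ (tensorLeftTensor N M).hom).app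
      (regular k B))) := by
    have := isIso_toDsg_tensorLeftMap φ
    rw [NatTrans.comp_app, Functor.map_comp]
    infer_instance
  exact (leftSyzygySystem k B).areIntertwined l (leftLift M N)
    (tensorLeftMap φ ≫ (tensorLeftTensor N M).hom)

lemma areIntertwined_right (φ : syzygy k B l ⟶ (tensorLeft N).obj M) [IsIso (toDsg.map φ)] :
    AreIntertwined (GrEndMaps.ofFunctor (𝟭 (Dsg (FGBimod k B))) (regularSg k B))
      (GrEndMaps.ofFunctor (rightLift M N).sg (regularSg k B)) l := by
  have h : IsIso (toDsg.map ((tensorRightMap (A := B) φ ≫ (tensorRightTensor N M).inv).app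
      (regular k B))) := by
    have := isIso_toDsg_tensorRightMap φ
    rw [NatTrans.comp_app, Functor.map_comp]
    infer_instance
  exact (rightSyzygySystem k B).areIntertwined l (rightLift M N)
    (tensorRightMap φ ≫ (tensorRightTensor N M).inv)

instance : (rightLift M N).sg.Additive :=
  inferInstanceAs (mapDsg (tensorRight (A := B) N) ⋙ mapDsg (tensorRight M)).Additive

/-- `(N ⊗_A (M ⊗_B -)) ⊗_B N ⊗_A M` is `G ∘ F`. -/
def exchangeIso : (tensorLeft (D := Bᵐᵒᵖ) M ⋙ tensorLeft N) ⋙ (tensorRight N ⋙ tensorRight M) ≅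
    tensorBoth M N ⋙ tensorBoth N M :=
  Functor.isoWhiskerLeft (tensorLeft M)
    (Functor.isoWhiskerRight (tensorLeftRight N N) (tensorRight M))

lemma areIntertwined_tensorBoth (φ : syzygy k B l ⟶ (tensorLeft N).obj M)
    [IsIso (toDsg.map φ)] :
    AreIntertwined (GrEndMaps.ofFunctor (𝟭 (Dsg (FGBimod k B))) (regularSg k B))
      (GrEndMaps.ofFunctor (mapDsg (tensorBoth M N) ⋙ mapDsg (tensorBoth N M)) (regularSg k B))
      (l + l) := by
  -- The isomorphism for `- ⊗_B N ⊗_A M` is followed by the image under that functor of the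
  -- isomorphism for `N ⊗_A M ⊗_B -`; each contributes degree `l`.
  have h : AreIntertwined (GrEndMaps.ofFunctor (𝟭 (Dsg (FGBimod k B))) (regularSg k B))
      (GrEndMaps.ofFunctor ((leftLift M N).sg ⋙ (rightLift M N).sg) (regularSg k B)) (l + l) :=
    (areIntertwined_right φ).comp ((areIntertwined_left φ).map (rightLift M N).sg) rfl
  have : IsIso (toDsg.map ((exchangeIso (M := M) (N := N)).hom.app (regular k B))) := inferInstance
  exact AreIntertwined.comp (θ' := GrEndMaps.ofFunctor ((leftLift M N).sg ⋙ (rightLift M N).sg)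
    (regularSg k B)) h (((leftLift M N).comp (rightLift M N)).areIntertwined
      ((SgLift.ofExact (tensorBoth M N)).comp (SgLift.ofExact (tensorBoth N M)))
      exchangeIso.hom (regular k B)) (zero_add _)

/-- `(M ⊗_B B) ⊗_B N ≅ M ⊗_B N` -/
def tensorBothRegular : (tensorBoth M N).obj (regular k B) ≅ (tensorLeft M).obj N :=
  (tensorRight N).mapIso ((tensorRightRegular k B A).app M)

/-- In the singularity category `M ⊗_B B ⊗_B N ≅ M ⊗_B N ≅ Ω^l(A)`, and the inverse of `σ l`
identifies `Ω^l(A)` shifted by `l` with `A`. -/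
lemma nonempty_iso_regularSg (φ : syzygy k A l ⟶ (tensorLeft M).obj N) [IsIso (toDsg.map φ)] :
    Nonempty (((mapDsg (tensorBoth M N)).obj (regularSg k B))⟦(l : ℤ)⟧ ≅ regularSg k A) := by
  let T := rightSyzygySystem k A
  have := T.isIso_σ l
  let e₁ : (mapDsg (tensorBoth M N)).obj (regularSg k B) ≅
      toDsg.obj ((tensorBoth M N).obj (regular k B)) :=
    (SgLift.ofExact (tensorBoth M N)).singleSg (regular k B)
  let e₂ : toDsg.obj ((tensorBoth M N).obj (regular k B)) ≅ toDsg.obj (syzygy k A l) :=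
    toDsg.mapIso tensorBothRegular ≪≫ (asIso (toDsg.map φ)).symm
  let e₃ : toDsg.obj (syzygy k A l) ≅ toDsg.obj ((tensorRight (syzygy k A l)).obj (regular k A)) :=
    toDsg.mapIso ((tensorLeftRegular k A Aᵐᵒᵖ).app (syzygy k A l)).symm
  let e₄ : toDsg.obj ((tensorRight (syzygy k A l)).obj (regular k A)) ≅
      (T.lift l).sg.obj (regularSg k A) := ((T.lift l).singleSg (regular k A)).symm
  exact ⟨(shiftFunctor _ (l : ℤ)).mapIso (e₁ ≪≫ e₂ ≪≫ e₃ ≪≫ e₄) ≪≫ (asIso (T.σ l)).symm⟩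

end

namespace IsSingularEquivalenceOfMoritaType

lemma exists_iso (h : IsSingularEquivalenceOfMoritaType l M N) :
    Nonempty ((shiftFunctor _ (l : ℤ)).obj (h.functor.obj (regularSg k B)) ≅ regularSg k A) := by
  have := h.projective_M
  have := h.projective_N
  obtain ⟨e⟩ := h.iso_left
  obtain ⟨φ, _⟩ := exists_isIso_toDsg e.symm
  exact nonempty_iso_regularSg φ

instance (h : IsSingularEquivalenceOfMoritaType l M N) : h.functor.Additive :=
  have := h.projective_M
  have := h.projective_N
  inferInstanceAs (mapDsg (tensorBoth M N)).Additive

/-- Only the stable isomorphism `N ⊗_A M ≅ Ω^l(B)` is used for this composite; the one for `M ⊗_B N`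
serves the other composite through `h.symm`. -/
lemma transport_transport (h : IsSingularEquivalenceOfMoritaType l M N)
    (α : (shiftFunctor _ (l : ℤ)).obj (h.functor.obj (regularSg k B)) ≅ regularSg k A)
    (β : (shiftFunctor _ (l : ℤ)).obj (h.symm.functor.obj (regularSg k A)) ≅ regularSg k B)
    (n : ℤ) (f : GrEndPart (regularSg k B) n) :
    GrEndPart.induced h.symm.functor β n (GrEndPart.induced h.functor α n f) = f := by
  have := h.projective_M
  have := h.projective_N
  obtain ⟨e⟩ := h.iso_right
  obtain ⟨φ, _⟩ := exists_isIso_toDsg e.symm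
  obtain ⟨w, hw', hw⟩ := areIntertwined_tensorBoth φ
  let w' : ShiftedHom (regularSg k B) (h.symm.functor.obj (h.functor.obj (regularSg k B)))
    ((l : ℤ) + l) := w
  have : IsIso w' := hw'
  exact GrEndPart.transport_transport h.functor h.symm.functor α β isGradedCommutative_regularSg
    w' hw f

lemma inducedHom_comp_inducedHom (h : IsSingularEquivalenceOfMoritaType l M N)
    (α : (shiftFunctor _ (l : ℤ)).obj (h.functor.obj (regularSg k B)) ≅ regularSg k A)
    (β : (shiftFunctor _ (l : ℤ)).obj (h.symm.functor.obj (regularSg k A)) ≅ regularSg k B) :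
    (GrEndPart.inducedHom h.symm.functor β).comp (GrEndPart.inducedHom h.functor α) =
      RingHom.id (HHsg k B) := by
  refine DirectSum.ringHom_ext' fun n => AddMonoidHom.ext fun f => ?_
  change GrEndPart.inducedHom h.symm.functor β (GrEndPart.inducedHom h.functor α
    (DirectSum.of (GrEndPart (regularSg k B)) n f)) = DirectSum.of (GrEndPart (regularSg k B)) n f
  refine (congrArg (GrEndPart.inducedHom h.symm.functor β)
    (GrEndPart.inducedHom_of h.functor α n f)).trans ?_
  refine (GrEndPart.inducedHom_of h.symm.functor β n _).trans ?_
  exact congrArg _ (h.transport_transport α β n f)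

end IsSingularEquivalenceOfMoritaType

end SingularEquivalenceProof

end

theorem mainTheorem6 {k : Type u} [Field k]
    {A B : Type u} [Ring A] [Algebra k A] [Module.Finite k A]
    [Ring B] [Algebra k B] [Module.Finite k B]
    (l : ℕ) (M : FGModuleCat.{u} (A ⊗[k] Bᵐᵒᵖ)) (N : FGModuleCat.{u} (B ⊗[k] Aᵐᵒᵖ))
    (h : IsSingularEquivalenceOfMoritaType l M N) :
    GrEnd.IsGradedCommutative (regularSg k A) ∧ GrEnd.IsGradedCommutative (regularSg k B) ∧
    Nonempty ((CategoryTheory.shiftFunctor _ (l : ℤ)).obj (h.functor.obj (regularSg k B)) ≅ regularSg k A) ∧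
    Nonempty ((CategoryTheory.shiftFunctor _ (l : ℤ)).obj (h.symm.functor.obj (regularSg k A)) ≅
      regularSg k B) ∧
    ∀ (α : (CategoryTheory.shiftFunctor _ (l : ℤ)).obj (h.functor.obj (regularSg k B)) ≅ regularSg k A)
      (β : (CategoryTheory.shiftFunctor _ (l : ℤ)).obj (h.symm.functor.obj (regularSg k A)) ≅ regularSg k B),
      ∃ Φ : HHsg k B ≃+* HHsg k A,
        (∀ (n : ℤ) (f : GrEndPart (regularSg k B) n),
          Φ (DirectSum.of (GrEndPart (regularSg k B)) n f) =
            DirectSum.of (GrEndPart (regularSg k A)) n (GrEndPart.induced h.functor α n f)) ∧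
        (∀ (n : ℤ) (g : GrEndPart (regularSg k A) n),
          Φ.symm (DirectSum.of (GrEndPart (regularSg k A)) n g) =
            DirectSum.of (GrEndPart (regularSg k B)) n
              (GrEndPart.induced h.symm.functor β n g)) :=
  ⟨isGradedCommutative_regularSg, isGradedCommutative_regularSg, h.exists_iso, h.symm.exists_iso,
    fun α β => ⟨RingEquiv.ofRingHom (GrEndPart.inducedHom h.functor α)
      (GrEndPart.inducedHom h.symm.functor β) (h.symm.inducedHom_comp_inducedHom β α)
      (h.inducedHom_comp_inducedHom α β), GrEndPart.inducedHom_of h.functor α,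
      GrEndPart.inducedHom_of h.symm.functor β⟩⟩
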